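/- **Setting.** Let $p=p(n)\to\infty$. For each $n$ let $\Sigma^*$ be a positive definite $p\times p$ matrix, let $d_{\mathrm{in}},d_{\mathrm{out}}\in\{1,\dots,p\}$, let $\sigma$ be a permutation of $[p]=\{1,\dots,p\}$, and let $c_1>0$, $c_2\ge 0$, $\alpha\in(0,1)$, $\gamma>0$, $\kappa\ge 0$; all of these may depend on $n$. Let $X$ be an $n\times p$ matrix whose rows are i.i.d. $N_p(0,\Sigma^*)$, with columns $X_j$ and, for $S\subseteq[p]$, with $X_S$ the submatrix of the columns in $S$. For a permutation $\tau$ let $(B_\tau,\Omega_\tau)$ be the unique pair such that $(B_\tau)_{ij}=0$ whenever $\tau^{-1}(i)\ge\tau^{-1}(j)$, $\Omega_\tau$ is diagonal with positive diagonal, and $\Sigma^*=(I-B_\tau^\top)^{-1}\Omega_\tau(I-B_\tau)^{-1}$. Let $G^*_\tau$ be the DAG (the minimal I-map with ordering $\tau$) in which $i\to j$ if and only if $(B_\tau)_{ij}\ne0$, let $d^*_\tau=\max_j|\mathrm{Pa}_j(G^*_\tau)\cup\mathrm{Ch}_j(G^*_\tau)|$, where $\mathrm{Pa}_j$ and $\mathrm{Ch}_j$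 are the sets of parents and children of node $j$, and let $d^*=\max_\tau d^*_\tau$. Let $\mathcal G_p^\sigma$ be the set of DAGs $G$ on $[p]$ such that $\sigma(i)\to\sigma(j)\in G$ implies $i<j$, and let $\mathcal G_p^\sigma(d_{\mathrm{in}},d_{\mathrm{out}})$ be the set of those $G\in\mathcal G_p^\sigma$ with all in-degrees at most $d_{\mathrm{in}}$ and all out-degrees at most $d_{\mathrm{out}}$. On $\mathcal G_p^\sigma(d_{\mathrm{in}},d_{\mathrm{out}})$ let $\pi^\sigma$ be the probability distribution with $$\pi^\sigma(G)\ \propto\ \prod_{j=1}^p\Big(c_1p^{c_2}\sqrt{1+\alpha/\gamma}\Big)^{-|\mathrm{Pa}_j(G)|}\Big(X_j^\top\big(I-X_S(X_S^\top X_S)^{-1}X_S^\top\big)X_j\Big)^{-(\alpha n+\kappa)/2}\Big|_{S=\mathrm{Pa}_j(G)},$$ and let $\pi^\sigma_{\min}=\min_G\pi^\sigma(G)$. Let $\mathcal N_{\mathrm{ads}}(G)$ be the set of DAGs obtained from $G$ by adding one edge, deleting one edge, or replacing one edge $\ell\to j$ of $G$ by an edge $k\to j$ not in $G$. Let $\mathcal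 N(G)$ be either $\mathcal N_{\mathrm{ads}}(G)$ or $\mathcal N_{\mathrm{ads}}(G)\cap\mathcal G_p^\sigma$, let $K(G,G')=\mathbf 1\{G'\in\mathcal N(G)\}/|\mathcal N(G)|$, and let $P_\sigma$ be the Metropolis–Hastings matrix on $\mathcal G_p^\sigma(d_{\mathrm{in}},d_{\mathrm{out}})$ given by $$P_\sigma(G,G')=K(G,G')\min\Big\{1,\frac{\pi^\sigma(G')K(G',G)}{\pi^\sigma(G)K(G,G')}\Big\}\quad(G'\ne G),\qquad P_\sigma(G,G)=1-\sum_{G'\ne G}P_\sigma(G,G').$$ Its mixing time is $T_{\mathrm{mix}}(P_\sigma)=\max_G\min\{k\in\mathbb N:\|P_\sigma^k(G,\cdot)-\pi^\sigma\|_{\mathrm{TV}}\le 1/4\}$. **Theorem.** There is a universal constant $C>0$ such that the following holds in every such setting. Let $\delta_0\in(0,1)$, $t>3$ and $C_\beta\ge 8t/3$ be constants that do not depend on $n$, let $\underline\nu,\overline\nu>0$ possibly depend on $n$, suppose that $d_{\mathrm{in}}\log p=o(n)$, and suppose that for all sufficiently large $n$: - (A) every eigenvalue of $\Sigma^*$ lies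 in $\big[\underline\nu/(1-\delta_0)^2,\ \overline\nu/(1+\delta_0)^2\big]$; - (C) $\kappa\le n$, $\ 1\le c_1\sqrt{1+\alpha/\gamma}\le p$, and $c_2\ge(\alpha+1)(4d_{\mathrm{in}}+6)+t$; - (D) $\big(4\overline\nu^2\underline\nu^{-4}(\overline\nu-\underline\nu)^2+1\big)\,d^*_\sigma\le d_{\mathrm{in}}$; - (E) $|(B_\sigma)_{ij}|^2\ge 5(C_\beta+4c_2)\,\dfrac{\overline\nu^2\log p}{\alpha\,\underline\nu^2\,n}$ whenever $(B_\sigma)_{ij}\ne0$; - $\min\{d^*d_{\mathrm{in}}+1,\,p\}\le d_{\mathrm{out}}$. Then for all sufficiently large $n$, with probability at least $1-3/p$ (over $X$), $$T_{\mathrm{mix}}(P_\sigma)\ \le\ C\,d_{\mathrm{in}}^2\,p^3\,\log\!\Big(\frac{4}{\pi^\sigma_{\min}}\Big)$$ simultaneously for both choices of $\mathcal N$. -/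

import Mathlib

open scoped ENNReal Matrix
open Filter MeasureTheory ProbabilityTheory

noncomputable section

namespace SparseDAG

/-! ### Directed graphs on the vertex set `Fin p`, given by their edge sets -/

/-- A directed graph on `Fin p`; `(i, j) ∈ E` is the edge `i → j`. -/
abbrev EdgeSet (p : ℕ) : Type := Finset (Fin p × Fin p)

/-- No directed cycle (in particular no loop). -/
def IsAcyclic {p : ℕ} (E : EdgeSet p) : Prop :=
  ∀ i, ¬ Relation.TransGen (fun a b => (a, b) ∈ E) i i

def parents {p : ℕ} (E : EdgeSet p) (j : Fin p) : Finset (Fin p) :=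
  Finset.univ.filter fun i => (i, j) ∈ E

def children {p : ℕ} (E : EdgeSet p) (j : Fin p) : Finset (Fin p) :=
  Finset.univ.filter fun i => (j, i) ∈ E

open Classical in
/-- All DAGs with topological ordering `σ`, where `σ i` is the node in position `i`. -/
def orderedDAGs {p : ℕ} (σ : Equiv.Perm (Fin p)) : Finset (EdgeSet p) :=
  Finset.univ.filter fun E => IsAcyclic E ∧ ∀ i j, (σ i, σ j) ∈ E → i < j

open Classical in
/-- The DAGs with ordering `σ`, in-degrees at most `din` and out-degrees at most `dout`. -/
def sparseDAGs {p : ℕ} (σ : Equiv.Perm (Fin p)) (din dout : ℕ) : Finset (EdgeSet p) :=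
  (orderedDAGs σ).filter fun E =>
    (∀ j, (parents E j).card ≤ din) ∧ ∀ j, (children E j).card ≤ dout

open Classical in
/-- The add-delete-swap neighborhood in the space of all DAGs. -/
def adsNbhd {p : ℕ} (E : EdgeSet p) : Finset (EdgeSet p) :=
  Finset.univ.filter fun E' => IsAcyclic E' ∧
    ((∃ i j, (i, j) ∉ E ∧ E' = insert (i, j) E) ∨
     (∃ i j, (i, j) ∈ E ∧ E' = E.erase (i, j)) ∨
     (∃ k l j, (k, j) ∉ E ∧ (l, j) ∈ E ∧ E' = (insert (k, j) E).erase (l, j)))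

/-- The add-delete-swap neighborhood in the space of the DAGs with ordering `σ`. -/
def adsNbhdOrdered {p : ℕ} (σ : Equiv.Perm (Fin p)) (E : EdgeSet p) : Finset (EdgeSet p) :=
  adsNbhd E ∩ orderedDAGs σ

/-! ### Modified Cholesky decomposition and minimal I-maps -/

/-- `Σ = (I - Bᵀ)⁻¹ Ω (I - B)⁻¹` with `Ω = diag ω` positive and `B i j = 0` unless `i` strictly
precedes `j` in the ordering `σ`. -/
def IsModifiedCholesky {p : ℕ} (S : Matrix (Fin p) (Fin p) ℝ) (σ : Equiv.Perm (Fin p))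
    (B : Matrix (Fin p) (Fin p) ℝ) (ω : Fin p → ℝ) : Prop :=
  (∀ i j, σ.symm j ≤ σ.symm i → B i j = 0) ∧ (∀ i, 0 < ω i) ∧
    (1 - Bᵀ)⁻¹ * Matrix.diagonal ω * (1 - B)⁻¹ = S

theorem one_sub_triangular {p : ℕ} (σ : Equiv.Perm (Fin p)) (B : Matrix (Fin p) (Fin p) ℝ)
    (hB : ∀ i j, σ.symm j ≤ σ.symm i → B i j = 0) :
    (1 - B).BlockTriangular σ.symm ∧ (1 - B).det = 1 := by
  have h : (1 - B).BlockTriangular σ.symm := by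
    intro i j hij
    have : i ≠ j := by rintro rfl; exact lt_irrefl _ hij
    simp [this, hB i j hij.le]
  refine ⟨h, ?_⟩
  have h2 : ((1 - B).submatrix σ σ).IsUpperTriangular := by
    intro i j hij
    exact h (by simpa using hij)
  rw [← Matrix.det_submatrix_equiv_self σ, Matrix.det_of_isUpperTriangular h2]
  refine Finset.prod_eq_one fun i _ => ?_
  simp [hB _ _ le_rfl]

/-- The decomposition written without inverses. -/
theorem isModifiedCholesky_iff {p : ℕ} (S : Matrix (Fin p) (Fin p) ℝ) (σ : Equiv.Perm (Fin p))
    (B : Matrix (Fin p) (Fin p) ℝ) (ω : Fin p → ℝ) :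
    IsModifiedCholesky S σ B ω ↔ (∀ i j, σ.symm j ≤ σ.symm i → B i j = 0) ∧ (∀ i, 0 < ω i) ∧
      (1 - B)ᵀ * S * (1 - B) = Matrix.diagonal ω := by
  refine and_congr_right fun hB => and_congr_right fun _ => ?_
  have hu : IsUnit (1 - B).det := by simp [(one_sub_triangular σ B hB).2]
  have hu' : IsUnit (1 - B)ᵀ.det := by rwa [Matrix.det_transpose]
  have e : (1 - Bᵀ : Matrix (Fin p) (Fin p) ℝ) = (1 - B)ᵀ := by simp
  rw [e]
  constructor
  · rintro rfl
    rw [Matrix.mul_assoc, Matrix.mul_assoc, Matrix.nonsing_inv_mul _ hu, Matrix.mul_one,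
      Matrix.mul_nonsing_inv_cancel_left _ _ hu']
  · intro h
    rw [← h, Matrix.mul_assoc, Matrix.mul_nonsing_inv_cancel_right _ _ hu,
      Matrix.nonsing_inv_mul_cancel_left _ _ hu']

theorem exists_isModifiedCholesky {p : ℕ} {S : Matrix (Fin p) (Fin p) ℝ} (hS : S.PosDef)
    (σ : Equiv.Perm (Fin p)) : ∃ B ω, IsModifiedCholesky S σ B ω := by
  classical
  have key : ∀ j, ∃ b : Fin p → ℝ, (∀ i, σ.symm j ≤ σ.symm i → b i = 0) ∧
      ∀ k, σ.symm k < σ.symm j → ∑ i, b i * S i k = S j k := by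
    intro j
    let f : {i // σ.symm i < σ.symm j} → Fin p := Subtype.val
    have hP : (S.submatrix f f).PosDef := hS.submatrix Subtype.val_injective
    have hu : IsUnit (S.submatrix f f).det := (Matrix.isUnit_iff_isUnit_det _).1 hP.isUnit
    let c := (fun k => S j (f k)) ᵥ* (S.submatrix f f)⁻¹
    have hc : c ᵥ* S.submatrix f f = fun k => S j (f k) := by
      simp only [c]
      rw [Matrix.vecMul_vecMul, Matrix.nonsing_inv_mul _ hu, Matrix.vecMul_one]
    refine ⟨fun i => if h : σ.symm i < σ.symm j then c ⟨i, h⟩ else 0, fun i hi => ?_,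
      fun k hk => ?_⟩
    · simp [not_lt.2 hi]
    · have := congrFun hc ⟨k, hk⟩
      simp only [Matrix.vecMul, dotProduct, Matrix.submatrix_apply, f] at this
      rw [← this]
      symm
      rw [← Finset.sum_subset (Finset.subset_univ
        (Finset.univ.filter fun i => σ.symm i < σ.symm j))]
      · symm
        rw [Finset.sum_subtype (p := fun i => σ.symm i < σ.symm j) _ (by simp)]
        exact Finset.sum_congr rfl fun x _ => by simp [x.2]
      · intro x _ hx
        have : ¬ σ.symm x < σ.symm j := by simpa using hx
        simp [this]
  choose b hb hb' using key
  let B : Matrix (Fin p) (Fin p) ℝ := Matrix.of fun i j => b j i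
  have hB : ∀ i j, σ.symm j ≤ σ.symm i → B i j = 0 := fun i j h => hb j i h
  have hu : IsUnit (1 - B) := by
    rw [Matrix.isUnit_iff_isUnit_det]; simp [(one_sub_triangular σ B hB).2]
  have hD : ((1 - B)ᵀ * S * (1 - B)).PosDef := by
    have := hS.conjTranspose_mul_mul_same (B := 1 - B) (Matrix.mulVec_injective_of_isUnit hu)
    rwa [Matrix.conjTranspose_eq_transpose_of_trivial] at this
  have hz : ∀ j k, σ.symm k < σ.symm j → ((1 - B)ᵀ * S : Matrix (Fin p) (Fin p) ℝ) j k = 0 := by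
    intro j k hk
    rw [Matrix.transpose_sub, Matrix.transpose_one, Matrix.sub_mul, Matrix.one_mul,
      Matrix.sub_apply, Matrix.mul_apply]
    have := hb' j k hk
    simp only [Matrix.transpose_apply, B, Matrix.of_apply]
    linarith
  have hlow : ∀ j l, σ.symm l < σ.symm j → ((1 - B)ᵀ * S * (1 - B) : Matrix (Fin p) (Fin p) ℝ) j l = 0 := by
    intro j l hl
    rw [Matrix.mul_apply]
    refine Finset.sum_eq_zero fun k _ => ?_
    rcases lt_or_ge (σ.symm l) (σ.symm k) with h | h
    · rw [(one_sub_triangular σ B hB).1 h, mul_zero]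
    · rw [hz j k (h.trans_lt hl), zero_mul]
  refine ⟨B, fun j => ((1 - B)ᵀ * S * (1 - B) : Matrix (Fin p) (Fin p) ℝ) j j, ?_⟩
  rw [isModifiedCholesky_iff]
  refine ⟨hB, fun i => hD.diag_pos, ?_⟩
  ext j l
  rcases lt_trichotomy (σ.symm l) (σ.symm j) with h | h | h
  · have : j ≠ l := by rintro rfl; exact lt_irrefl _ h
    rw [hlow j l h, Matrix.diagonal_apply_ne _ this]
  · obtain rfl := σ.symm.injective h
    simp
  · have : j ≠ l := by rintro rfl; exact lt_irrefl _ h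
    rw [Matrix.diagonal_apply_ne _ this]
    have h1 := hD.isHermitian.apply j l
    rw [← h1, hlow l j h]; simp

theorem isModifiedCholesky_unique {p : ℕ} {S : Matrix (Fin p) (Fin p) ℝ} (hS : S.PosDef)
    {σ : Equiv.Perm (Fin p)} {B B' : Matrix (Fin p) (Fin p) ℝ} {ω ω' : Fin p → ℝ}
    (h : IsModifiedCholesky S σ B ω) (h' : IsModifiedCholesky S σ B' ω') :
    B = B' ∧ ω = ω' := by
  have normal : ∀ {B : Matrix (Fin p) (Fin p) ℝ} {ω : Fin p → ℝ}, IsModifiedCholesky S σ B ω →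
      ∀ j k, σ.symm k < σ.symm j → ((1 - B)ᵀ * S : Matrix (Fin p) (Fin p) ℝ) j k = 0 := by
    intro B ω h j k hk
    rw [isModifiedCholesky_iff] at h
    obtain ⟨hB, -, h⟩ := h
    obtain ⟨ht, hd⟩ := one_sub_triangular σ B hB
    have hu : IsUnit (1 - B).det := by simp [hd]
    have := Matrix.invertibleOfIsUnitDet _ hu
    have e : (1 - B)ᵀ * S = Matrix.diagonal ω * (1 - B)⁻¹ := by
      rw [← h, Matrix.mul_nonsing_inv_cancel_right _ _ hu]
    rw [e, Matrix.diagonal_mul,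
      Matrix.blockTriangular_inv_of_blockTriangular ht hk, mul_zero]
  have hBB : B = B' := by
    by_contra hne
    obtain ⟨j, hj⟩ : ∃ j, (B - B').col j ≠ 0 := by
      by_contra hcon
      push Not at hcon
      exact hne (Matrix.ext fun i j => by
        have := congrFun (hcon j) i
        simpa [sub_eq_zero] using this)
    have hpos := hS.dotProduct_mulVec_pos hj
    have h0 : star ((B - B').col j) ⬝ᵥ S *ᵥ (B - B').col j = 0 := by
      rw [Matrix.dotProduct_mulVec, dotProduct]
      refine Finset.sum_eq_zero fun k _ => ?_
      rcases lt_or_ge (σ.symm k) (σ.symm j) with hk | hk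
      · have e1 := normal h j k hk
        have e2 := normal h' j k hk
        have e3 : ((1 - B')ᵀ * S - (1 - B)ᵀ * S : Matrix (Fin p) (Fin p) ℝ) j k = 0 := by
          rw [Matrix.sub_apply, e1, e2, sub_zero]
        rw [← Matrix.sub_mul, ← Matrix.transpose_sub] at e3
        have e4 : (1 - B' - (1 - B) : Matrix (Fin p) (Fin p) ℝ) = B - B' := by abel
        rw [e4, Matrix.mul_apply] at e3
        have e5 : (star ((B - B').col j) ᵥ* S) k = 0 := by
          rw [← e3]; simp [Matrix.vecMul, dotProduct]
        rw [e5, zero_mul]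
      · simp [h.1 k j hk, h'.1 k j hk]
    exact hpos.ne' h0
  refine ⟨hBB, ?_⟩
  subst hBB
  rw [isModifiedCholesky_iff] at h h'
  exact Matrix.diagonal_injective (h.2.2.symm.trans h'.2.2)

open Classical in
/-- The weighted adjacency matrix `B_σ` of the modified Cholesky decomposition of `S`; for `S`
positive definite the decomposition exists and is unique
(`exists_isModifiedCholesky`, `isModifiedCholesky_unique`). -/
def cholWeights {p : ℕ} (S : Matrix (Fin p) (Fin p) ℝ) (σ : Equiv.Perm (Fin p)) :
    Matrix (Fin p) (Fin p) ℝ :=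
  if h : ∃ B ω, IsModifiedCholesky S σ B ω then h.choose else 0

open Classical in
/-- The minimal I-map of `N(0, S)` with ordering `σ`: `i → j` iff `(B_σ) i j ≠ 0`. -/
def minimalIMap {p : ℕ} (S : Matrix (Fin p) (Fin p) ℝ) (σ : Equiv.Perm (Fin p)) : EdgeSet p :=
  Finset.univ.filter fun e => cholWeights S σ e.1 e.2 ≠ 0

/-- `d*_σ`, the maximum degree of the minimal I-map with ordering `σ`. -/
def maxDegIMap {p : ℕ} (S : Matrix (Fin p) (Fin p) ℝ) (σ : Equiv.Perm (Fin p)) : ℕ :=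
  Finset.univ.sup fun j =>
    (parents (minimalIMap S σ) j ∪ children (minimalIMap S σ) j).card

/-- `d*`, the maximum of `d*_σ` over all orderings. -/
def maxDegAllIMaps {p : ℕ} (S : Matrix (Fin p) (Fin p) ℝ) : ℕ :=
  Finset.univ.sup fun σ : Equiv.Perm (Fin p) => maxDegIMap S σ

/-! ### Data and posterior distribution -/

/-- The law of `n` i.i.d. rows with distribution `N_p(0, S)`. -/
def dataLaw (n : ℕ) {p : ℕ} (S : Matrix (Fin p) (Fin p) ℝ) :
    Measure (Fin n → EuclideanSpace ℝ (Fin p)) :=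
  Measure.pi fun _ => multivariateGaussian 0 S

/-- The `n × p` data matrix with the given rows. -/
def dataMatrix {n p : ℕ} (x : Fin n → EuclideanSpace ℝ (Fin p)) : Matrix (Fin n) (Fin p) ℝ :=
  Matrix.of fun i j => x i j

/-- The submatrix of the columns indexed by `T`. -/
def cols {n p : ℕ} (X : Matrix (Fin n) (Fin p) ℝ) (T : Finset (Fin p)) :
    Matrix (Fin n) {i // i ∈ T} ℝ :=
  X.submatrix id Subtype.val

/-- `X_jᵀ (I - X_T (X_Tᵀ X_T)⁻¹ X_Tᵀ) X_j`. -/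
def rss {n p : ℕ} (X : Matrix (Fin n) (Fin p) ℝ) (j : Fin p) (T : Finset (Fin p)) : ℝ :=
  X.col j ⬝ᵥ ((1 - cols X T * ((cols X T)ᵀ * cols X T)⁻¹ * (cols X T)ᵀ) *ᵥ X.col j)

/-- The hyperparameters `c₁, c₂, α, γ, κ` of the empirical prior. -/
structure Hyper where
  c₁ : ℝ
  c₂ : ℝ
  α : ℝ
  γ : ℝ
  κ : ℝ

/-- `exp (ψ_j(T))`, the exponential of the posterior score of the parent set `T` of node `j`. -/
def nodeWeight {n p : ℕ} (h : Hyper) (X : Matrix (Fin n) (Fin p) ℝ) (j : Fin p)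
    (T : Finset (Fin p)) : ℝ :=
  ((h.c₁ * (p : ℝ) ^ h.c₂ * √(1 + h.α / h.γ)) ^ T.card)⁻¹ *
    rss X j T ^ (-(h.α * n + h.κ) / 2)

/-- `exp (ψ(E))`, the exponential of the posterior score of the DAG `E`. -/
def dagWeight {n p : ℕ} (h : Hyper) (X : Matrix (Fin n) (Fin p) ℝ) (E : EdgeSet p) : ℝ :=
  ∏ j, nodeWeight h X j (parents E j)

/-- The posterior distribution on the space of sparse DAGs with ordering `σ`. -/
def posterior {n p : ℕ} (h : Hyper) (X : Matrix (Fin n) (Fin p) ℝ) (σ : Equiv.Perm (Fin p))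
    (din dout : ℕ) (G : {E // E ∈ sparseDAGs σ din dout}) : ℝ :=
  dagWeight h X G.1 / ∑ H ∈ sparseDAGs σ din dout, dagWeight h X H

/-- The minimum posterior probability of a sparse DAG with ordering `σ`. -/
def posteriorMin {n p : ℕ} (h : Hyper) (X : Matrix (Fin n) (Fin p) ℝ) (σ : Equiv.Perm (Fin p))
    (din dout : ℕ) : ℝ :=
  ⨅ G, posterior h X σ din dout G

/-! ### Metropolis–Hastings chains and mixing times -/

/-- Uniform proposal from a neighborhood. -/
def uniformProposal {p : ℕ} (N : EdgeSet p → Finset (EdgeSet p)) (E E' : EdgeSet p) : ℝ :=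
  if E' ∈ N E then 1 / ((N E).card : ℝ) else 0

/-- The Metropolis–Hastings transition matrix with target `π` and proposal `K`. -/
def mhMatrix {Θ : Type} [Fintype Θ] [DecidableEq Θ] (π : Θ → ℝ) (K : Θ → Θ → ℝ) :
    Matrix Θ Θ ℝ :=
  let off : Θ → Θ → ℝ := fun x y => K x y * min 1 (π y * K y x / (π x * K x y))
  Matrix.of fun x y =>
    if x = y then 1 - ∑ z ∈ Finset.univ.erase x, off x z else off x y

/-- Total variation distance of two distributions on a finite set. -/
def tvDist {Θ : Type} [Fintype Θ] (μ ν : Θ → ℝ) : ℝ := (∑ x, |μ x - ν x|) / 2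

/-- `max_x min {k : ‖P^k(x, ·) - π‖_TV ≤ 1/4}`, equal to `⊤` if there is no such `k` for some `x`. -/
def mixingTime {Θ : Type} [Fintype Θ] [DecidableEq Θ] (P : Matrix Θ Θ ℝ) (π : Θ → ℝ) : ℕ∞ :=
  ⨆ x, sInf ((fun k : ℕ => (k : ℕ∞)) '' {k | tvDist ((P ^ k) x) π ≤ 1 / 4})

/-- The mixing time of the add-delete-swap sampler on the sparse DAGs with ordering `σ`, which
proposes uniformly from the neighborhood `N`. -/
def samplerMixingTime {n p : ℕ} (h : Hyper) (X : Matrix (Fin n) (Fin p) ℝ)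
    (σ : Equiv.Perm (Fin p)) (din dout : ℕ) (N : EdgeSet p → Finset (EdgeSet p)) : ℕ∞ :=
  mixingTime
    (mhMatrix (posterior h X σ din dout) fun G G' => uniformProposal N G.1 G'.1)
    (posterior h X σ din dout)

end SparseDAG

end

/-! The minimal I-map `G` with ordering `σ` is a dominant peak of the posterior, reachable by
ascent. On a typical data set every other sparse DAG has an add-delete-swap neighbor, again sparse,
whose posterior is larger by a factor of at least `p ^ t` with `t > 3`. A sparse DAG has at most `3
* din * p ^ 2` neighbors, far fewer than `p ^ t`, so the DAGs that are sent to a given one carry at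
most an eighth of its mass. The proof has three layers.

Markov chains. A map `g` that moves every state but the peak uphill, with such small preimages,
controls both ends of the spectrum in a single step (`mixingTime_mhMatrix_le`): the term containing
`f (g x)` is reabsorbed into the left-hand side, so no sum over whole paths is needed, and the large
holding probability at the peak handles the negative eigenvalues without a lazy chain.
`samplerMixingTime_le` turns this into a bound of order `din * p ^ 2 * log (4 / π_min)`, which is
stronger than the one required.

Uphill moves. The score is a sum over nodes, so moves are found node by node and then made
compatible with the degree bounds. A superfluous parent explains only noise, and deleting it saves a
penalty that exceeds the loss of fit (`NodeRegular.mul_nodeWeight_le_erase`). If a true parent is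
missing, some missing one explains at least an average share of the missing signal; if the parent
set is full, it contains so many superfluous parents that one of them is nearly useless and can be
swapped out (`NodeRegular.exists_mul_nodeWeight_le`). The out-degree bound is respected because
double counting of edges shows that the missing parents cannot all be saturated
(`exists_children_card_le`, `exists_adsNbhd_mul_le`).

Typical data. Two events suffice. The Gram matrices of at most `2 * din` columns are nearly `n`
times the population ones (`measure_not_isometry_le`, by nets and a χ² tail bound). The noise of
each node is nearly orthogonal to residuals of its predecessors, because it is independent of them
(`IsModifiedCholesky.measure_noise_le`). Each event fails with probability at most `1 / p` after a
union bound over small sets of columns. -/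

namespace SparseDAG

/-! ### Mixing of reversible chains -/

section Markov

variable {Θ : Type} [Fintype Θ]

theorem sum_sub_sq_of_reversible {P : Matrix Θ Θ ℝ} {π : Θ → ℝ}
    (hrev : ∀ x y, π x * P x y = π y * P y x) (hrow : ∀ x, ∑ y, P x y = 1) (f : Θ → ℝ) :
    ∑ x, ∑ y, π x * P x y * (f x - f y) ^ 2 =
      2 * (∑ x, π x * f x ^ 2 - ∑ x, π x * f x * (P *ᵥ f) x) := by
  have h1 : ∑ x, ∑ y, π x * P x y * f x ^ 2 = ∑ x, π x * f x ^ 2 := by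
    refine Finset.sum_congr rfl fun x _ => ?_
    rw [← Finset.sum_mul, ← Finset.mul_sum, hrow, mul_one]
  have h2 : ∑ x, ∑ y, π x * P x y * f y ^ 2 = ∑ x, π x * f x ^ 2 := by
    rw [Finset.sum_comm, ← h1]
    exact Finset.sum_congr rfl fun x _ => Finset.sum_congr rfl fun y _ => by rw [hrev]
  have h3 : ∑ x, ∑ y, π x * P x y * (f x * f y) = ∑ x, π x * f x * (P *ᵥ f) x := by
    refine Finset.sum_congr rfl fun x _ => ?_
    simp only [Matrix.mulVec, dotProduct, Finset.mul_sum]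
    exact Finset.sum_congr rfl fun y _ => by ring
  have h4 : ∀ x y, π x * P x y * (f x - f y) ^ 2 =
      π x * P x y * f x ^ 2 + π x * P x y * f y ^ 2 - 2 * (π x * P x y * (f x * f y)) :=
    fun x y => by ring
  simp only [h4, Finset.sum_add_distrib, Finset.sum_sub_distrib, ← Finset.mul_sum, h1, h2, h3]
  ring

theorem sum_add_sq_of_reversible {P : Matrix Θ Θ ℝ} {π : Θ → ℝ}
    (hrev : ∀ x y, π x * P x y = π y * P y x) (hrow : ∀ x, ∑ y, P x y = 1) (f : Θ → ℝ) :
    ∑ x, ∑ y, π x * P x y * (f x + f y) ^ 2 =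
      2 * (∑ x, π x * f x ^ 2 + ∑ x, π x * f x * (P *ᵥ f) x) := by
  have h1 : ∑ x, ∑ y, π x * P x y * f x ^ 2 = ∑ x, π x * f x ^ 2 := by
    refine Finset.sum_congr rfl fun x _ => ?_
    rw [← Finset.sum_mul, ← Finset.mul_sum, hrow, mul_one]
  have h4 : ∀ x y, π x * P x y * (f x + f y) ^ 2 =
      4 * (π x * P x y * (f x * f y)) + π x * P x y * (f x - f y) ^ 2 := fun x y => by ring
  have h3 : ∑ x, ∑ y, π x * P x y * (f x * f y) = ∑ x, π x * f x * (P *ᵥ f) x := by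
    refine Finset.sum_congr rfl fun x _ => ?_
    simp only [Matrix.mulVec, dotProduct, Finset.mul_sum]
    exact Finset.sum_congr rfl fun y _ => by ring
  simp only [h4, Finset.sum_add_distrib, ← Finset.mul_sum, h3]
  rw [sum_sub_sq_of_reversible hrev hrow]
  ring

theorem sum_mul_mulVec_symm {P : Matrix Θ Θ ℝ} {π : Θ → ℝ}
    (hrev : ∀ x y, π x * P x y = π y * P y x) (f h : Θ → ℝ) :
    ∑ x, π x * f x * (P *ᵥ h) x = ∑ x, π x * h x * (P *ᵥ f) x := by
  simp only [Matrix.mulVec, dotProduct, Finset.mul_sum]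
  rw [Finset.sum_comm]
  refine Finset.sum_congr rfl fun x _ => Finset.sum_congr rfl fun y _ => ?_
  linear_combination f y * h x * hrev y x

theorem sum_mulVec_of_reversible {P : Matrix Θ Θ ℝ} {π : Θ → ℝ}
    (hrev : ∀ x y, π x * P x y = π y * P y x) (hrow : ∀ x, ∑ y, P x y = 1) (f : Θ → ℝ) :
    ∑ x, π x * (P *ᵥ f) x = ∑ x, π x * f x := by
  have := sum_mul_mulVec_symm hrev (fun _ => 1) f
  simp only [mul_one] at this
  rw [this]
  refine Finset.sum_congr rfl fun x _ => ?_
  simp [Matrix.mulVec, dotProduct, hrow]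

/-- A reversible chain whose spectrum off the constants lies in `[-(1 - g), 1 - g]` contracts
the variance by `(1 - g) ^ 2`. -/
theorem variance_mulVec_le {P : Matrix Θ Θ ℝ} {π : Θ → ℝ} {g : ℝ} (hg : g < 1)
    (hrev : ∀ x y, π x * P x y = π y * P y x) (hrow : ∀ x, ∑ y, P x y = 1)
    (hsub : ∀ f : Θ → ℝ, ∑ x, π x * f x = 0 →
      2 * g * ∑ x, π x * f x ^ 2 ≤ ∑ x, ∑ y, π x * P x y * (f x - f y) ^ 2)
    (hadd : ∀ f : Θ → ℝ,
      2 * g * ∑ x, π x * f x ^ 2 ≤ ∑ x, ∑ y, π x * P x y * (f x + f y) ^ 2)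
    (f : Θ → ℝ) (hf : ∑ x, π x * f x = 0) :
    ∑ x, π x * (P *ᵥ f) x ^ 2 ≤ (1 - g) ^ 2 * ∑ x, π x * f x ^ 2 := by
  have hc : 0 < 1 - g := by linarith
  set c := 1 - g with hcdef
  -- Polarization replaces the spectral theorem. The two form bounds at `f + h` and `f - h` add up
  -- to `4 ⟨h, P f⟩ ≤ 2 c (‖f‖² + ‖h‖²)`, and this choice of `h` turns it into `‖P f‖² ≤ c² ‖f‖²`.
  set h : Θ → ℝ := c⁻¹ • (P *ᵥ f) with hh
  have hmh : ∑ x, π x * h x = 0 := by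
    have := sum_mulVec_of_reversible hrev hrow f
    simp only [hh, Pi.smul_apply, smul_eq_mul]
    have e : ∀ x, π x * (c⁻¹ * (P *ᵥ f) x) = c⁻¹ * (π x * (P *ᵥ f) x) := fun x => by ring
    simp only [e, ← Finset.mul_sum, this, hf, mul_zero]
  have A := hsub (f + h) (by simp only [Pi.add_apply, mul_add, Finset.sum_add_distrib, hf, hmh, add_zero])
  have B := hadd (f - h)
  rw [sum_sub_sq_of_reversible hrev hrow] at A
  rw [sum_add_sq_of_reversible hrev hrow] at B
  have hP1 : ∀ x, π x * (f + h) x * (P *ᵥ (f + h)) x = π x * f x * (P *ᵥ f) x +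
      π x * f x * (P *ᵥ h) x + π x * h x * (P *ᵥ f) x + π x * h x * (P *ᵥ h) x := fun x => by
    rw [Matrix.mulVec_add]; simp only [Pi.add_apply]; ring
  have hP2 : ∀ x, π x * (f - h) x * (P *ᵥ (f - h)) x = π x * f x * (P *ᵥ f) x -
      π x * f x * (P *ᵥ h) x - π x * h x * (P *ᵥ f) x + π x * h x * (P *ᵥ h) x := fun x => by
    rw [Matrix.mulVec_sub]; simp only [Pi.sub_apply]; ring
  have hS1 : ∀ x, π x * (f + h) x ^ 2 = π x * f x ^ 2 + 2 * (π x * f x * h x) + π x * h x ^ 2 :=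
    fun x => by simp only [Pi.add_apply]; ring
  have hS2 : ∀ x, π x * (f - h) x ^ 2 = π x * f x ^ 2 - 2 * (π x * f x * h x) + π x * h x ^ 2 :=
    fun x => by simp only [Pi.sub_apply]; ring
  simp only [hP1, hS1, Finset.sum_add_distrib, ← Finset.mul_sum] at A
  simp only [hP2, hS2, Finset.sum_add_distrib, Finset.sum_sub_distrib, ← Finset.mul_sum] at B
  rw [sum_mul_mulVec_symm hrev f h] at A B
  have e1 : ∑ x, π x * h x * (P *ᵥ f) x = c⁻¹ * ∑ x, π x * (P *ᵥ f) x ^ 2 := by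
    rw [Finset.mul_sum]
    exact Finset.sum_congr rfl fun x _ => by simp only [hh, Pi.smul_apply, smul_eq_mul]; ring
  have e2 : ∑ x, π x * h x ^ 2 = c⁻¹ ^ 2 * ∑ x, π x * (P *ᵥ f) x ^ 2 := by
    rw [Finset.mul_sum]
    exact Finset.sum_congr rfl fun x _ => by simp only [hh, Pi.smul_apply, smul_eq_mul]; ring
  rw [e1, e2] at A B
  set V := ∑ x, π x * (P *ᵥ f) x ^ 2
  set W := ∑ x, π x * f x ^ 2
  have key : 4 * (c⁻¹ * V) ≤ 2 * c * (W + c⁻¹ ^ 2 * V) := by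
    have : g = 1 - c := by rw [hcdef]; ring
    rw [this] at A B
    linarith
  have e3 : c * (c⁻¹ ^ 2 * V) = c⁻¹ * V := by field_simp
  have : c⁻¹ * V ≤ c * W := by
    have : 2 * c * (W + c⁻¹ ^ 2 * V) = 2 * (c * W) + 2 * (c⁻¹ * V) := by rw [← e3]; ring
    linarith
  calc V = c * (c⁻¹ * V) := by field_simp
    _ ≤ c * (c * W) := by gcongr
    _ = c ^ 2 * W := by ring

variable [DecidableEq Θ]

theorem pow_reversible {P : Matrix Θ Θ ℝ} {π : Θ → ℝ}
    (hrev : ∀ x y, π x * P x y = π y * P y x) (k : ℕ) (x y : Θ) :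
    π x * (P ^ k) x y = π y * (P ^ k) y x := by
  induction k generalizing x y with
  | zero => 
    by_cases h : x = y
    · rw [h]
    · simp [h, Ne.symm h]
  | succ k ih =>
    rw [pow_succ, Matrix.mul_apply, ← pow_succ, pow_succ', Matrix.mul_apply, Finset.mul_sum,
      Finset.mul_sum]
    refine Finset.sum_congr rfl fun z _ => ?_
    rw [← mul_assoc, ih x z, mul_right_comm, hrev z y]; ring

theorem pow_row_sum {P : Matrix Θ Θ ℝ} (hrow : ∀ x, ∑ y, P x y = 1) (k : ℕ) (x : Θ) :
    ∑ y, (P ^ k) x y = 1 := by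
  have h1 : P *ᵥ (fun _ => 1) = fun _ => 1 := by
    ext x; simp [Matrix.mulVec, dotProduct, hrow]
  have : (P ^ k) *ᵥ (fun _ => 1) = fun _ => 1 := by
    induction k with
    | zero => simp
    | succ k ih => rw [pow_succ, ← Matrix.mulVec_mulVec, h1, ih]
  simpa [Matrix.mulVec, dotProduct] using congrFun this x

/-- The `χ²` bound on the total variation distance to stationarity. -/
theorem tvDist_pow_sq_le {P : Matrix Θ Θ ℝ} {π : Θ → ℝ} {g : ℝ} (hg : g < 1)
    (hpos : ∀ x, 0 < π x) (hsum : ∑ x, π x = 1)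
    (hrev : ∀ x y, π x * P x y = π y * P y x) (hrow : ∀ x, ∑ y, P x y = 1)
    (hsub : ∀ f : Θ → ℝ, ∑ x, π x * f x = 0 →
      2 * g * ∑ x, π x * f x ^ 2 ≤ ∑ x, ∑ y, π x * P x y * (f x - f y) ^ 2)
    (hadd : ∀ f : Θ → ℝ,
      2 * g * ∑ x, π x * f x ^ 2 ≤ ∑ x, ∑ y, π x * P x y * (f x + f y) ^ 2)
    (k : ℕ) (x : Θ) :
    (2 * tvDist ((P ^ k) x) π) ^ 2 ≤ ((1 - g) ^ 2) ^ k * (π x)⁻¹ := by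
  -- The density of the point mass at `x` with respect to `π`, centered. By reversibility its image
  -- under `P ^ k` is the centered density of the law after `k` steps, and its variance is `(π x)⁻¹
  -- - 1`.
  set h₀ : Θ → ℝ := fun y => (if y = x then (π x)⁻¹ else 0) - 1 with hh₀
  have hm : ∀ k, ∑ y, π y * ((P ^ k) *ᵥ h₀) y = 0 := by
    intro k
    rw [sum_mulVec_of_reversible (pow_reversible hrev k) (pow_row_sum hrow k)]
    simp only [hh₀, mul_sub, mul_ite, mul_zero, mul_one, Finset.sum_sub_distrib, hsum]
    simp [(hpos x).ne']
  have hv : ∀ k, ∑ y, π y * ((P ^ k) *ᵥ h₀) y ^ 2 ≤ ((1 - g) ^ 2) ^ k * (π x)⁻¹ := by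
    intro k
    induction k with
    | zero =>
      have e : ∀ y, π y * ((P ^ 0) *ᵥ h₀) y ^ 2 =
          (if y = x then (π x)⁻¹ - 2 else 0) + π y := by
        intro y
        simp only [pow_zero, Matrix.one_mulVec, hh₀]
        split_ifs with hy
        · subst hy; have := (hpos y).ne'; field_simp; ring
        · ring
      simp only [e, Finset.sum_add_distrib, hsum]
      simp only [Finset.sum_ite_eq', Finset.mem_univ, if_true]
      simp only [pow_zero, one_mul]; linarith
    | succ k ih =>
      rw [pow_succ' P, ← Matrix.mulVec_mulVec]
      refine (variance_mulVec_le hg hrev hrow hsub hadd _ (hm k)).trans ?_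
      rw [pow_succ _ k, mul_comm (((1 - g) ^ 2) ^ k), mul_assoc]
      gcongr
  have ht : 2 * tvDist ((P ^ k) x) π = ∑ y, π y * |((P ^ k) *ᵥ h₀) y| := by
    rw [tvDist, mul_div_cancel₀ _ two_ne_zero]
    refine Finset.sum_congr rfl fun y _ => ?_
    have e : ((P ^ k) *ᵥ h₀) y = (P ^ k) y x * (π x)⁻¹ - 1 := by
      simp only [Matrix.mulVec, dotProduct, hh₀, mul_sub, mul_ite, mul_zero, mul_one,
        Finset.sum_sub_distrib, pow_row_sum hrow]
      simp
    rw [e, ← abs_of_pos (hpos y), ← abs_mul, abs_of_pos (hpos y), mul_sub, ← mul_assoc,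
      pow_reversible hrev k y x]
    have := (hpos x).ne'
    congr 1; field_simp
  rw [ht]
  refine le_trans ?_ (hv k)
  -- Cauchy–Schwarz with weights `√π`: the L¹ norm is at most the L² norm.
  have := Finset.sum_mul_sq_le_sq_mul_sq Finset.univ (fun y => √(π y))
    (fun y => √(π y) * |((P ^ k) *ᵥ h₀) y|)
  simp only [← mul_assoc, mul_pow, sq_abs, Real.mul_self_sqrt (hpos _).le,
    Real.sq_sqrt (hpos _).le, hsum, one_mul] at this
  exact this

/-- With `g = 1 / (8 * m)` the squared distance decays like `exp (-k / (4 * m))`, so `4 * m * log (4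
/ π_min)` steps compensate the factor `(π x)⁻¹` and leave `(2 * TV) ^ 2 ≤ 1 / 4`. Rounding up costs
at most one further step; as `m` and the logarithm are at least 1, the constant 5 absorbs it. -/
theorem mixingTime_le_of_gap [Nonempty Θ] {P : Matrix Θ Θ ℝ} {π : Θ → ℝ} {m : ℝ} (hm : 1 ≤ m)
    (hpos : ∀ x, 0 < π x) (hsum : ∑ x, π x = 1)
    (hrev : ∀ x y, π x * P x y = π y * P y x) (hrow : ∀ x, ∑ y, P x y = 1)
    (hsub : ∀ f : Θ → ℝ, ∑ x, π x * f x = 0 →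
      2 * (8 * m)⁻¹ * ∑ x, π x * f x ^ 2 ≤ ∑ x, ∑ y, π x * P x y * (f x - f y) ^ 2)
    (hadd : ∀ f : Θ → ℝ,
      2 * (8 * m)⁻¹ * ∑ x, π x * f x ^ 2 ≤ ∑ x, ∑ y, π x * P x y * (f x + f y) ^ 2) :
    (mixingTime P π : ℝ≥0∞) ≤ ENNReal.ofReal (5 * m * Real.log (4 / ⨅ x, π x)) := by
  have hm0 : 0 < m := by linarith
  obtain ⟨x₀, hx₀⟩ := exists_eq_ciInf_of_finite (f := π)
  have hmin : 0 < ⨅ x, π x := hx₀ ▸ hpos x₀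
  have hmin1 : ⨅ x, π x ≤ 1 := by
    rw [← hx₀, ← hsum]
    exact Finset.single_le_sum (fun x _ => (hpos x).le) (Finset.mem_univ x₀)
  set l := Real.log (4 / ⨅ x, π x) with hl
  have hl1 : 1 ≤ l := by
    rw [hl, Real.le_log_iff_exp_le (by positivity)]
    have : Real.exp 1 ≤ 4 := by have := Real.exp_one_lt_d9; linarith
    rw [le_div_iff₀ hmin]
    nlinarith [Real.exp_pos 1]
  set N := ⌈4 * m * l⌉₊ with hN
  have hN1 : 4 * m * l ≤ N := Nat.le_ceil _
  have hN2 : (N : ℝ) ≤ 5 * m * l := by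
    have := (Nat.ceil_lt_add_one (a := 4 * m * l) (by positivity)).le
    nlinarith
  have hle : mixingTime P π ≤ (N : ℕ∞) := by
    refine iSup_le fun x => sInf_le ⟨N, ?_, rfl⟩
    have hg : (8 * m)⁻¹ < 1 := inv_lt_one_of_one_lt₀ (by linarith)
    have h1 := tvDist_pow_sq_le hg hpos hsum hrev hrow hsub hadd N x
    have h2 : ((1 - (8 * m)⁻¹) ^ 2) ^ N * (π x)⁻¹ ≤ (1 / 2) ^ 2 := by
      have h3 : (1 - (8 * m)⁻¹) ^ 2 ≤ Real.exp (-(4 * m)⁻¹) := by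
        have h4 : 1 - (8 * m)⁻¹ ≤ Real.exp (-(8 * m)⁻¹) := by
          have := Real.add_one_le_exp (-(8 * m)⁻¹); linarith
        calc (1 - (8 * m)⁻¹) ^ 2 ≤ Real.exp (-(8 * m)⁻¹) ^ 2 := by
              gcongr
          _ = _ := by rw [← Real.exp_nat_mul]; congr 1; push_cast; field_simp; norm_num
      have h5 : ((1 - (8 * m)⁻¹) ^ 2) ^ N ≤ Real.exp (-l) := by
        calc ((1 - (8 * m)⁻¹) ^ 2) ^ N ≤ Real.exp (-(4 * m)⁻¹) ^ N := by gcongr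
          _ = Real.exp (N * -(4 * m)⁻¹) := by rw [← Real.exp_nat_mul]
          _ ≤ Real.exp (-l) := by
            rw [Real.exp_le_exp, mul_neg, neg_le_neg_iff, ← div_eq_mul_inv,
              le_div_iff₀ (by positivity)]
            linarith
      have h6 : Real.exp (-l) = (⨅ x, π x) / 4 := by
        rw [Real.exp_neg, hl, Real.exp_log (by positivity), inv_div]
      have h7 : (⨅ x, π x) ≤ π x := ciInf_le (Set.finite_range π).bddBelow x
      calc _ ≤ π x / 4 * (π x)⁻¹ := by
            gcongr
            · exact (inv_pos.2 (hpos x)).le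
            · linarith
        _ = (1 / 2) ^ 2 := by have := (hpos x).ne'; field_simp; norm_num
    have h8 := abs_le_of_sq_le_sq (h1.trans h2) (by norm_num)
    change tvDist ((P ^ N) x) π ≤ 1 / 4
    linarith [le_abs_self (2 * tvDist ((P ^ N) x) π)]
  calc (mixingTime P π : ℝ≥0∞) ≤ ((N : ℕ∞) : ℝ≥0∞) := by exact_mod_cast hle
    _ = ENNReal.ofReal N := by simp
    _ ≤ _ := ENNReal.ofReal_le_ofReal hN2

/-! ### Metropolis–Hastings chains -/

/-- The stationary flow along an edge is the smaller of the two proposal flows. This symmetric form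
makes reversibility evident and also covers `K x y = 0`, where the acceptance ratio divides by zero.
-/
theorem mhMatrix_apply_ne {π : Θ → ℝ} {K : Θ → Θ → ℝ} (hpos : ∀ x, 0 < π x)
    (hK : ∀ x y, 0 ≤ K x y) {x y : Θ} (hxy : x ≠ y) :
    π x * mhMatrix π K x y = min (π x * K x y) (π y * K y x) := by
  simp only [mhMatrix, Matrix.of_apply, if_neg hxy]
  rcases (hK x y).eq_or_lt with h | h
  · rw [← h]; simp [mul_nonneg (hpos y).le (hK y x)]
  · have := mul_pos (hpos x) h
    rw [← mul_assoc, mul_min_of_nonneg _ _ this.le, mul_one, mul_div_cancel₀ _ this.ne']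

theorem mhMatrix_reversible {π : Θ → ℝ} {K : Θ → Θ → ℝ} (hpos : ∀ x, 0 < π x)
    (hK : ∀ x y, 0 ≤ K x y) (x y : Θ) :
    π x * mhMatrix π K x y = π y * mhMatrix π K y x := by
  by_cases hxy : x = y
  · rw [hxy]
  · rw [mhMatrix_apply_ne hpos hK hxy, mhMatrix_apply_ne hpos hK (Ne.symm hxy), min_comm]

theorem mhMatrix_row_sum (π : Θ → ℝ) (K : Θ → Θ → ℝ) (x : Θ) :
    ∑ y, mhMatrix π K x y = 1 := by
  rw [← Finset.add_sum_erase _ _ (Finset.mem_univ x)]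
  have : ∑ y ∈ Finset.univ.erase x, mhMatrix π K x y =
      ∑ z ∈ Finset.univ.erase x, K x z * min 1 (π z * K z x / (π x * K x z)) :=
    Finset.sum_congr rfl fun y hy => by
      simp [mhMatrix, (Finset.ne_of_mem_erase hy).symm]
  rw [this]
  simp [mhMatrix]

theorem mhMatrix_nonneg {π : Θ → ℝ} {K : Θ → Θ → ℝ} (hpos : ∀ x, 0 < π x)
    (hK : ∀ x y, 0 ≤ K x y) (hrow : ∀ x, ∑ y, K x y ≤ 1) (x y : Θ) :
    0 ≤ mhMatrix π K x y := by
  by_cases hxy : x = y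
  · subst hxy
    simp only [mhMatrix, Matrix.of_apply, if_true]
    have : ∑ z ∈ Finset.univ.erase x, K x z * min 1 (π z * K z x / (π x * K x z)) ≤
        ∑ z, K x z := by
      refine (Finset.sum_le_sum fun z _ => ?_).trans
        (Finset.sum_le_sum_of_subset_of_nonneg (Finset.erase_subset x _) fun z _ _ => hK x z)
      exact mul_le_of_le_one_right (hK x z) (min_le_left _ _)
    linarith [hrow x]
  · have h := mhMatrix_apply_ne hpos hK hxy
    have h2 : 0 ≤ π x * mhMatrix π K x y := by
      rw [h]; exact le_min (mul_nonneg (hpos x).le (hK x y)) (mul_nonneg (hpos y).le (hK y x))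
    exact nonneg_of_mul_nonneg_right h2 (hpos x)

/-- Mixing of a Metropolis–Hastings chain with a map `g` that moves every state but `r` to a
much more likely one: the mass of the preimage of `y` is at most `π y / 8`. -/
theorem mixingTime_mhMatrix_le {π : Θ → ℝ} {K : Θ → Θ → ℝ} (hpos : ∀ x, 0 < π x)
    (hsum : ∑ x, π x = 1) (hK : ∀ x y, 0 ≤ K x y) (hrow : ∀ x, ∑ y, K x y ≤ 1)
    {m : ℝ} (hm : 1 ≤ m) (r : Θ) (g : Θ → Θ)
    (hg : ∀ x, x ≠ r → g x ≠ x ∧ m⁻¹ ≤ K x (g x) ∧ m⁻¹ ≤ K (g x) x ∧ π x ≤ π (g x))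
    (hpre : ∀ y, ∑ x with x ≠ r ∧ g x = y, π x ≤ 1 / 8 * π y) :
    (mixingTime (mhMatrix π K) π : ℝ≥0∞) ≤
      ENNReal.ofReal (5 * m * Real.log (4 / ⨅ x, π x)) := by
  have : Nonempty Θ := ⟨r⟩
  have hm0 : 0 < m := by linarith
  set P := mhMatrix π K with hP
  have hrev := mhMatrix_reversible hpos hK
  have hPrs := mhMatrix_row_sum π K
  have hP0 := mhMatrix_nonneg hpos hK hrow
  rw [← hP] at hrev hPrs hP0
  -- Pushing `π` forward along `g` costs a factor 1/8. This is what allows terms at `g x` to be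
  -- reabsorbed.
  have hfib : ∀ u : Θ → ℝ, (∀ x, 0 ≤ u x) →
      ∑ x with x ≠ r, π x * u (g x) ≤ 1 / 8 * ∑ y, π y * u y := by
    intro u hu
    rw [← Finset.sum_fiberwise_of_maps_to (g := g) (t := Finset.univ) (fun _ _ => Finset.mem_univ _),
      Finset.mul_sum]
    refine Finset.sum_le_sum fun y _ => ?_
    rw [Finset.filter_filter]
    calc ∑ x with x ≠ r ∧ g x = y, π x * u (g x) = (∑ x with x ≠ r ∧ g x = y, π x) * u y := by
          rw [Finset.sum_mul]
          refine Finset.sum_congr rfl fun x hx => ?_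
          rw [(Finset.mem_filter.1 hx).2.2]
      _ ≤ 1 / 8 * π y * u y := mul_le_mul_of_nonneg_right (hpre y) (hu y)
      _ = _ := by ring
  have hedge : ∀ x, x ≠ r → π x ≤ m * (π x * P x (g x)) := by
    intro x hx
    obtain ⟨h1, h2, h3, h4⟩ := hg x hx
    rw [hP, mhMatrix_apply_ne hpos hK h1.symm, ← div_le_iff₀' hm0, div_eq_mul_inv]
    refine le_min ?_ ?_
    · gcongr; exact (hpos x).le
    · gcongr; exact (hpos _).le
  have hflow : ∀ w : Θ → Θ → ℝ, (∀ x y, 0 ≤ w x y) →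
      ∑ x with x ≠ r, π x * w x (g x) ≤ m * ∑ x with x ≠ r, ∑ y, π x * P x y * w x y := by
    intro w hw
    rw [Finset.mul_sum]
    refine Finset.sum_le_sum fun x hx => ?_
    have h1 := hedge x (Finset.mem_filter.1 hx).2
    calc π x * w x (g x) ≤ m * (π x * P x (g x)) * w x (g x) := by gcongr; exact hw _ _
      _ = m * (π x * P x (g x) * w x (g x)) := by ring
      _ ≤ _ := by
        gcongr
        exact Finset.single_le_sum (f := fun y => π x * P x y * w x y)
          (fun y _ => mul_nonneg (mul_nonneg (hpos x).le (hP0 x y)) (hw x y)) (Finset.mem_univ _)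
  have hsplit : ∀ u : Θ → ℝ, ∑ x, u x = u r + ∑ x with x ≠ r, u x := by
    intro u
    rw [Finset.filter_ne', Finset.add_sum_erase _ _ (Finset.mem_univ r)]
  -- The states other than `r` have mass at most 1/8 in total, by `hfib` with `u = 1`. The flow out
  -- of `r` is at most their mass, so `r` is rarely left.
  have hloop : 1 / 2 ≤ P r r := by
    have h1 := hfib (fun _ => 1) (fun _ => zero_le_one)
    simp only [mul_one, hsum] at h1
    have h2 := hsplit π
    have h3 := hPrs r
    rw [hsplit] at h3
    have h4 : π r * ∑ y with y ≠ r, P r y ≤ ∑ y with y ≠ r, π y := by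
      rw [Finset.mul_sum]
      refine Finset.sum_le_sum fun y hy => ?_
      rw [hP, mhMatrix_apply_ne hpos hK (Finset.mem_filter.1 hy).2.symm]
      refine (min_le_right _ _).trans (mul_le_of_le_one_right (hpos y).le ?_)
      exact (Finset.single_le_sum (fun z _ => hK y z) (Finset.mem_univ r)).trans (hrow y)
    have h5 : π r * P r r = π r - π r * ∑ y with y ≠ r, P r y := by
      rw [← eq_sub_iff_add_eq] at h3; rw [h3]; ring
    have h6 : 7 / 8 ≤ π r := by linarith
    by_contra hcon
    push Not at hcon
    nlinarith
  have hgoal : ∀ {A D : ℝ}, A ≤ 4 * (m * D) → 2 * (8 * m)⁻¹ * A ≤ D := fun {A D} h => by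
    calc 2 * (8 * m)⁻¹ * A ≤ 2 * (8 * m)⁻¹ * (4 * (m * D)) := by gcongr
      _ = D := by field_simp; norm_num
  refine mixingTime_le_of_gap hm hpos hsum hrev hPrs (fun f hf => ?_) fun f => ?_
  -- Centering at the peak instead of the mean only increases the second moment and makes the term
  -- at `r` vanish. With `A` this moment and `D` the Dirichlet sum, `A ≤ A / 4 + 2 * m * D`.
  · set h : Θ → ℝ := fun x => f x - f r with hh
    have h1 : ∑ x, π x * f x ^ 2 ≤ ∑ x, π x * h x ^ 2 := by
      have e : ∀ x, π x * h x ^ 2 = π x * f x ^ 2 - 2 * f r * (π x * f x) + f r ^ 2 * π x :=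
        fun x => by simp only [hh]; ring
      simp only [e, Finset.sum_add_distrib, Finset.sum_sub_distrib, ← Finset.mul_sum, hf, hsum]
      nlinarith [sq_nonneg (f r)]
    have h2 : ∑ x, π x * h x ^ 2 ≤ 2 * ∑ x with x ≠ r, π x * h (g x) ^ 2 +
        2 * ∑ x with x ≠ r, π x * (f x - f (g x)) ^ 2 := by
      rw [hsplit]
      simp only [hh, sub_self, ne_eq, OfNat.ofNat_ne_zero, not_false_eq_true, zero_pow, mul_zero,
        zero_add]
      rw [Finset.mul_sum, Finset.mul_sum, ← Finset.sum_add_distrib]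
      refine Finset.sum_le_sum fun x _ => ?_
      have := mul_nonneg (hpos x).le (sq_nonneg ((f x - f (g x)) - (f (g x) - f r)))
      nlinarith
    have h3 := hfib (fun x => h x ^ 2) (fun x => sq_nonneg _)
    have h4 := hflow (fun x y => (f x - f y) ^ 2) (fun x y => sq_nonneg _)
    have h5 : ∑ x with x ≠ r, ∑ y, π x * P x y * (f x - f y) ^ 2 ≤
        ∑ x, ∑ y, π x * P x y * (f x - f y) ^ 2 := by
      refine Finset.sum_le_sum_of_subset_of_nonneg (Finset.filter_subset _ _) fun x _ _ =>
        Finset.sum_nonneg fun y _ => ?_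
      exact mul_nonneg (mul_nonneg (hpos x).le (hP0 x y)) (sq_nonneg _)
    have h6 := mul_le_mul_of_nonneg_left h5 hm0.le
    refine hgoal ?_
    have : 0 ≤ ∑ x, ∑ y, π x * P x y * (f x - f y) ^ 2 := Finset.sum_nonneg fun x _ =>
      Finset.sum_nonneg fun y _ => mul_nonneg (mul_nonneg (hpos x).le (hP0 x y)) (sq_nonneg _)
    linarith [mul_nonneg hm0.le this]
  -- The same absorption with plus signs. Here the term at `r` survives; the loop at `r` contributes
  -- `4 * π r * P r r * f r ^ 2` to the form and pays for it.
  · have h2 : ∑ x, π x * f x ^ 2 ≤ π r * f r ^ 2 + (2 * ∑ x with x ≠ r, π x * f (g x) ^ 2 +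
        2 * ∑ x with x ≠ r, π x * (f x + f (g x)) ^ 2) := by
      rw [hsplit]
      refine add_le_add le_rfl ?_
      rw [Finset.mul_sum, Finset.mul_sum, ← Finset.sum_add_distrib]
      refine Finset.sum_le_sum fun x _ => ?_
      have := mul_nonneg (hpos x).le (sq_nonneg ((f x + f (g x)) + f (g x)))
      nlinarith
    have h3 := hfib (fun x => f x ^ 2) (fun x => sq_nonneg _)
    have h4 := hflow (fun x y => (f x + f y) ^ 2) (fun x y => sq_nonneg _)
    have h5 : π r * f r ^ 2 ≤ 1 / 2 * ∑ y, π r * P r y * (f r + f y) ^ 2 := by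
      have : π r * P r r * (f r + f r) ^ 2 ≤ ∑ y, π r * P r y * (f r + f y) ^ 2 :=
        Finset.single_le_sum (f := fun y => π r * P r y * (f r + f y) ^ 2)
          (fun y _ => mul_nonneg (mul_nonneg (hpos r).le (hP0 r y)) (sq_nonneg _))
          (Finset.mem_univ r)
      have h6 : π r * (1 / 2) * (f r + f r) ^ 2 ≤ π r * P r r * (f r + f r) ^ 2 := by
        have := (hpos r).le
        gcongr
      nlinarith
    have hnn : ∀ x, 0 ≤ ∑ y, π x * P x y * (f x + f y) ^ 2 := fun x =>
      Finset.sum_nonneg fun y _ => mul_nonneg (mul_nonneg (hpos x).le (hP0 x y)) (sq_nonneg _)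
    rw [hsplit fun x => ∑ y, π x * P x y * (f x + f y) ^ 2]
    set D := ∑ y, π r * P r y * (f r + f y) ^ 2 with hD
    set F := ∑ x with x ≠ r, ∑ y, π x * P x y * (f x + f y) ^ 2 with hF
    have hD0 : 0 ≤ D := hnn r
    have hF0 : 0 ≤ F := Finset.sum_nonneg fun x _ => hnn x
    refine hgoal ?_
    have h6 : D ≤ m * D := le_mul_of_one_le_left hD0 hm
    have h7 : 0 ≤ m * F := mul_nonneg hm0.le hF0
    rw [mul_add]
    linarith

end Markov

/-! ### Neighborhoods of directed graphs -/

section Graphs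

variable {p : ℕ}

@[simp]
theorem mem_parents {E : EdgeSet p} {i j : Fin p} : i ∈ parents E j ↔ (i, j) ∈ E := by
  simp [parents]

@[simp]
theorem mem_children {E : EdgeSet p} {i j : Fin p} : i ∈ children E j ↔ (j, i) ∈ E := by
  simp [children]

theorem eq_of_parents_eq {E F : EdgeSet p} (h : ∀ j, parents E j = parents F j) : E = F := by
  ext ⟨i, j⟩
  rw [← mem_parents, h, mem_parents]

theorem isAcyclic_of_ordered {σ : Equiv.Perm (Fin p)} {E : EdgeSet p}
    (h : ∀ i j, (i, j) ∈ E → σ.symm i < σ.symm j) : IsAcyclic E := by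
  have key : ∀ i j, Relation.TransGen (fun a b => (a, b) ∈ E) i j → σ.symm i < σ.symm j := by
    intro i j hij
    induction hij with
    | single h' => exact h _ _ h'
    | tail _ h' ih => exact ih.trans (h _ _ h')
  exact fun i hi => lt_irrefl _ (key i i hi)

theorem mem_orderedDAGs {σ : Equiv.Perm (Fin p)} {E : EdgeSet p} :
    E ∈ orderedDAGs σ ↔ ∀ i j, (i, j) ∈ E → σ.symm i < σ.symm j := by
  simp only [orderedDAGs, Finset.mem_filter, Finset.mem_univ, true_and]
  constructor
  · rintro ⟨-, h⟩ i j hij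
    exact h _ _ (by simpa using hij)
  · intro h
    exact ⟨isAcyclic_of_ordered h, fun i j hij => by simpa using h _ _ hij⟩

theorem isAcyclic_of_mem_orderedDAGs {σ : Equiv.Perm (Fin p)} {E : EdgeSet p}
    (h : E ∈ orderedDAGs σ) : IsAcyclic E :=
  isAcyclic_of_ordered (mem_orderedDAGs.1 h)

theorem mem_sparseDAGs {σ : Equiv.Perm (Fin p)} {din dout : ℕ} {E : EdgeSet p} :
    E ∈ sparseDAGs σ din dout ↔ E ∈ orderedDAGs σ ∧ (∀ j, (parents E j).card ≤ din) ∧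
      ∀ j, (children E j).card ≤ dout := by
  simp [sparseDAGs]

theorem adsNbhd_symm {E E' : EdgeSet p} (hE : IsAcyclic E) (h : E' ∈ adsNbhd E) :
    E ∈ adsNbhd E' := by
  simp only [adsNbhd, Finset.mem_filter, Finset.mem_univ, true_and] at h ⊢
  refine ⟨hE, ?_⟩
  obtain ⟨-, ⟨i, j, h1, rfl⟩ | ⟨i, j, h1, rfl⟩ | ⟨k, l, j, h1, h2, rfl⟩⟩ := h
  · exact Or.inr (Or.inl ⟨i, j, by simp, by simp [h1]⟩)
  · exact Or.inl ⟨i, j, by simp, by simp [h1]⟩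
  · have hkl : k ≠ l := by rintro rfl; exact h1 h2
    refine Or.inr (Or.inr ⟨l, k, j, by simp, by simp [hkl], ?_⟩)
    rw [Finset.insert_erase (by simp [h2]), Finset.erase_insert h1]

theorem ne_of_mem_adsNbhd {E E' : EdgeSet p} (h : E' ∈ adsNbhd E) : E' ≠ E := by
  simp only [adsNbhd, Finset.mem_filter, Finset.mem_univ, true_and] at h
  obtain ⟨-, ⟨i, j, h1, rfl⟩ | ⟨i, j, h1, rfl⟩ | ⟨k, l, j, h1, h2, rfl⟩⟩ := h
  · exact fun h => h1 (h ▸ Finset.mem_insert_self _ _)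
  · intro h
    have := Finset.notMem_erase (i, j) E
    rw [h] at this
    exact this h1
  · intro h
    have : (l, j) ∉ (insert (k, j) E).erase (l, j) := Finset.notMem_erase _ _
    rw [h] at this
    exact this h2

theorem card_eq_sum_parents (E : EdgeSet p) : E.card = ∑ j, (parents E j).card := by
  rw [Finset.card_eq_sum_card_fiberwise (f := Prod.snd) (t := Finset.univ)
    (fun _ _ => Finset.mem_coe.2 (Finset.mem_univ _))]
  refine Finset.sum_congr rfl fun j _ => ?_
  refine Finset.card_bij (fun e _ => e.1) ?_ ?_ ?_
  · rintro ⟨a, b⟩ h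
    obtain ⟨h1, h2⟩ := Finset.mem_filter.1 h
    simp only at h2; subst h2
    simpa using h1
  · rintro ⟨a, b⟩ h ⟨c, d⟩ h' hac
    have h2 := (Finset.mem_filter.1 h).2
    have h3 := (Finset.mem_filter.1 h').2
    simp only at h2 h3 hac
    rw [h2, h3, hac]
  · intro a ha
    exact ⟨(a, j), by simpa using ha, rfl⟩

/-- There are at most `p ^ 2` additions, `p * din` deletions and `p * (p * din)` swaps, since a swap
is determined by an edge and the new tail at the same head. -/
theorem card_adsNbhd_le {E : EdgeSet p} {din : ℕ} (hdin : 1 ≤ din)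
    (h : ∀ j, (parents E j).card ≤ din) : (adsNbhd E).card ≤ 3 * din * p ^ 2 := by
  classical
  have hE : E.card ≤ p * din := by
    rw [card_eq_sum_parents]
    simpa using Finset.sum_le_card_nsmul Finset.univ _ din fun j _ => h j
  have hsub : adsNbhd E ⊆ (Finset.univ.image fun e => insert e E) ∪ (E.image fun e => E.erase e) ∪
      ((Finset.univ ×ˢ E).image fun a : Fin p × (Fin p × Fin p) =>
        (insert (a.1, a.2.2) E).erase a.2) := by
    intro E' h
    simp only [adsNbhd, Finset.mem_filter, Finset.mem_univ, true_and] at h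
    obtain ⟨-, ⟨i, j, h1, rfl⟩ | ⟨i, j, h1, rfl⟩ | ⟨k, l, j, h1, h2, rfl⟩⟩ := h
    · exact Finset.mem_union_left _ (Finset.mem_union_left _
        (Finset.mem_image_of_mem _ (Finset.mem_univ _)))
    · exact Finset.mem_union_left _ (Finset.mem_union_right _ (Finset.mem_image_of_mem _ h1))
    · exact Finset.mem_union_right _ (Finset.mem_image.2 ⟨(k, (l, j)), by simp [h2], rfl⟩)
  refine (Finset.card_le_card hsub).trans ?_
  refine (Finset.card_union_le _ _).trans ?_
  refine (Nat.add_le_add_right (Finset.card_union_le _ _) _).trans ?_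
  have h1 : (Finset.univ.image fun e => insert e E).card ≤ p * p :=
    Finset.card_image_le.trans (by simp)
  have h2 : (E.image fun e => E.erase e).card ≤ p * din := Finset.card_image_le.trans hE
  have h3 : ((Finset.univ ×ˢ E).image fun a : Fin p × (Fin p × Fin p) =>
        (insert (a.1, a.2.2) E).erase a.2).card ≤ p * (p * din) := by
    refine Finset.card_image_le.trans ?_
    rw [Finset.card_product, Finset.card_univ, Fintype.card_fin]
    gcongr
  have h4 : p ≤ p * p := Nat.le_mul_self p
  calc _ ≤ p * p + p * din + p * (p * din) := by gcongr
    _ ≤ p * p * din + p * p * din + p * (p * din) := by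
      have ha : p * p ≤ p * p * din := Nat.le_mul_of_pos_right _ hdin
      have hb : p * din ≤ p * p * din := Nat.mul_le_mul_right _ h4
      omega
    _ = _ := by ring

/-! ### From score-increasing moves to a mixing time bound -/

theorem uniformProposal_nonneg (N : EdgeSet p → Finset (EdgeSet p)) (E E' : EdgeSet p) :
    0 ≤ uniformProposal N E E' := by
  unfold uniformProposal; split_ifs <;> positivity

theorem sum_uniformProposal_le (N : EdgeSet p → Finset (EdgeSet p)) (A : Finset (EdgeSet p))
    (E : EdgeSet p) : ∑ E' : {F // F ∈ A}, uniformProposal N E E'.1 ≤ 1 := by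
  rw [Finset.sum_coe_sort A (fun E' => uniformProposal N E E')]
  simp only [uniformProposal]
  rw [← Finset.sum_filter, Finset.sum_const, nsmul_eq_mul, mul_one_div]
  refine div_le_one_of_le₀ ?_ (by positivity)
  exact_mod_cast Finset.card_le_card fun x hx => (Finset.mem_filter.1 hx).2

/-- The chain argument is applied with `m = 3 * din * p ^ 2`, the bound on neighborhood sizes. The
threshold for `R` is `8 * m`: a preimage under the move map has at most `m` elements, each of mass
at most `π y / R`. Moves stay inside the state space, hence have positive proposal probability in
both directions for either choice of neighborhood. -/
theorem samplerMixingTime_le {n : ℕ} {h : Hyper} {X : Matrix (Fin n) (Fin p) ℝ}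
    {σ : Equiv.Perm (Fin p)} {din dout : ℕ} {N : EdgeSet p → Finset (EdgeSet p)}
    (hN : N = adsNbhd ∨ N = adsNbhdOrdered σ) (hdin : 1 ≤ din) (hp : 1 ≤ p)
    (hpos : ∀ E ∈ sparseDAGs σ din dout, 0 < dagWeight h X E)
    {G : EdgeSet p} (hG : G ∈ sparseDAGs σ din dout) {R : ℝ} (hR : 24 * din * (p : ℝ) ^ 2 ≤ R)
    (hmove : ∀ E ∈ sparseDAGs σ din dout, E ≠ G →
      ∃ E' ∈ sparseDAGs σ din dout, E' ∈ adsNbhd E ∧ R * dagWeight h X E ≤ dagWeight h X E') :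
    (samplerMixingTime h X σ din dout N : ℝ≥0∞) ≤
      ENNReal.ofReal (15 * din * (p : ℝ) ^ 2 * Real.log (4 / posteriorMin h X σ din dout)) := by
  have hp' : (1 : ℝ) ≤ p := by exact_mod_cast hp
  have hdin' : (1 : ℝ) ≤ din := by exact_mod_cast hdin
  have hp2 : (1 : ℝ) ≤ (p : ℝ) ^ 2 := one_le_pow₀ hp'
  have hdp : (1 : ℝ) ≤ din * (p : ℝ) ^ 2 := one_le_mul_of_one_le_of_one_le hdin' hp2
  have hR1 : 1 ≤ R := by nlinarith
  have hR0 : 0 < R := by linarith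
  set Z := ∑ H ∈ sparseDAGs σ din dout, dagWeight h X H with hZ
  have hZ0 : 0 < Z := Finset.sum_pos hpos ⟨G, hG⟩
  have hcard : ∀ E ∈ sparseDAGs σ din dout, ((N E).card : ℝ) ≤ 3 * din * (p : ℝ) ^ 2 := by
    intro E hE
    have h1 : (N E).card ≤ (adsNbhd E).card := by
      rcases hN with rfl | rfl
      · exact le_rfl
      · exact Finset.card_le_card Finset.inter_subset_left
    have h2 := card_adsNbhd_le hdin (mem_sparseDAGs.1 hE).2.1
    exact_mod_cast h1.trans h2
  have hmem : ∀ E ∈ sparseDAGs σ din dout, ∀ E' ∈ sparseDAGs σ din dout, E' ∈ adsNbhd E →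
      E' ∈ N E := by
    intro E _ E' hE' hEE'
    rcases hN with rfl | rfl
    · exact hEE'
    · exact Finset.mem_inter.2 ⟨hEE', (mem_sparseDAGs.1 hE').1⟩
  have hac : ∀ E ∈ sparseDAGs σ din dout, IsAcyclic E := fun E hE =>
    isAcyclic_of_mem_orderedDAGs (mem_sparseDAGs.1 hE).1
  have hK : ∀ E ∈ sparseDAGs σ din dout, ∀ E' ∈ sparseDAGs σ din dout, E' ∈ adsNbhd E →
      (3 * din * (p : ℝ) ^ 2)⁻¹ ≤ uniformProposal N E E' := by
    intro E hE E' hE' hEE'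
    have h1 := hmem E hE E' hE' hEE'
    rw [uniformProposal, if_pos h1, one_div]
    refine inv_anti₀ ?_ (hcard E hE)
    exact_mod_cast Finset.card_pos.2 ⟨E', h1⟩
  choose! g hg1 hg2 hg3 using hmove
  have hg1' : ∀ x : {E // E ∈ sparseDAGs σ din dout},
      (if x.1 = G then G else g x.1) ∈ sparseDAGs σ din dout := by
    intro x
    split_ifs with hx
    · exact hG
    · exact hg1 x.1 x.2 hx
  have key := mixingTime_mhMatrix_le (π := posterior h X σ din dout)
    (K := fun G G' => uniformProposal N G.1 G'.1) (m := 3 * din * (p : ℝ) ^ 2)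
    (fun x => div_pos (hpos x.1 x.2) hZ0)
    (by
      simp only [posterior]
      rw [← Finset.sum_div, Finset.sum_coe_sort _ (fun E => dagWeight h X E)]
      exact div_self hZ0.ne')
    (fun x y => uniformProposal_nonneg _ _ _)
    (fun x => sum_uniformProposal_le _ _ _) (by nlinarith) ⟨G, hG⟩
    (fun x => ⟨if x.1 = G then G else g x.1, hg1' x⟩)
    (by
      rintro ⟨x, hx⟩ hxG
      have hxG' : x ≠ G := fun h => hxG (Subtype.ext h)
      simp only [hxG', if_false]
      refine ⟨fun h => ne_of_mem_adsNbhd (hg2 x hx hxG') (congrArg Subtype.val h),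
        hK x hx _ (hg1 x hx hxG') (hg2 x hx hxG'),
        hK _ (hg1 x hx hxG') x hx (adsNbhd_symm (hac x hx) (hg2 x hx hxG')), ?_⟩
      refine div_le_div_of_nonneg_right (le_trans ?_ (hg3 x hx hxG')) hZ0.le
      exact le_mul_of_one_le_left (hpos x hx).le hR1)
    (by
      rintro ⟨y, hy⟩
      have hle : ∀ x ∈ (Finset.univ.filter fun x : {E // E ∈ sparseDAGs σ din dout} =>
          x ≠ ⟨G, hG⟩ ∧ (⟨if x.1 = G then G else g x.1, hg1' x⟩ :
            {E // E ∈ sparseDAGs σ din dout}) = ⟨y, hy⟩),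
          posterior h X σ din dout x ≤ R⁻¹ * posterior h X σ din dout ⟨y, hy⟩ ∧
          x.1 ∈ adsNbhd y := by
        rintro ⟨x, hx⟩ hxy
        obtain ⟨hxG, hxy⟩ := (Finset.mem_filter.1 hxy).2
        have hxG' : x ≠ G := fun h => hxG (Subtype.ext h)
        simp only [hxG', if_false, Subtype.mk.injEq] at hxy
        subst hxy
        refine ⟨?_, adsNbhd_symm (hac x hx) (hg2 x hx hxG')⟩
        simp only [posterior]
        rw [← mul_div_assoc]
        refine div_le_div_of_nonneg_right ?_ hZ0.le
        rw [← div_eq_inv_mul, le_div_iff₀' hR0]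
        exact hg3 x hx hxG'
      refine (Finset.sum_le_card_nsmul _ _ _ fun x hx => (hle x hx).1).trans ?_
      -- Every DAG that is moved to `y` is a neighbor of `y`, because the add-delete-swap relation
      -- is symmetric.
      have hc : ((Finset.univ.filter fun x : {E // E ∈ sparseDAGs σ din dout} =>
          x ≠ ⟨G, hG⟩ ∧ (⟨if x.1 = G then G else g x.1, hg1' x⟩ :
            {E // E ∈ sparseDAGs σ din dout}) = ⟨y, hy⟩).card : ℝ) ≤ 3 * din * (p : ℝ) ^ 2 := by
        have h1 := Finset.card_le_card_of_injOn (t := adsNbhd y) Subtype.val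
          (fun x hx => (hle x hx).2) Subtype.val_injective.injOn
        exact_mod_cast h1.trans (card_adsNbhd_le hdin (mem_sparseDAGs.1 hy).2.1)
      rw [nsmul_eq_mul, ← mul_assoc]
      have hpi : 0 < posterior h X σ din dout ⟨y, hy⟩ := div_pos (hpos y hy) hZ0
      refine mul_le_mul_of_nonneg_right ?_ hpi.le
      rw [← div_eq_mul_inv, div_le_iff₀ hR0]
      linarith)
  refine key.trans (le_of_eq ?_)
  congr 2
  ring

/-! ### Existence of score-increasing moves under the degree constraints -/

theorem parents_insert_self (E : EdgeSet p) (k j : Fin p) :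
    parents (insert (k, j) E) j = insert k (parents E j) := by
  ext i; simp

theorem parents_erase_self (E : EdgeSet p) (k j : Fin p) :
    parents (E.erase (k, j)) j = (parents E j).erase k := by
  ext i; simp

theorem parents_insert_ne (E : EdgeSet p) (k : Fin p) {i j : Fin p} (h : i ≠ j) :
    parents (insert (k, j) E) i = parents E i := by
  ext a; simp [h]

theorem parents_erase_ne (E : EdgeSet p) (k : Fin p) {i j : Fin p} (h : i ≠ j) :
    parents (E.erase (k, j)) i = parents E i := by
  ext a; simp [h]

theorem mul_prod_parents_le {w : Fin p → Finset (Fin p) → ℝ} {E E' : EdgeSet p} {j : Fin p}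
    {R : ℝ} (hw : ∀ i, 0 ≤ w i (parents E i)) (h : ∀ i, i ≠ j → parents E' i = parents E i)
    (hj : R * w j (parents E j) ≤ w j (parents E' j)) :
    R * ∏ i, w i (parents E i) ≤ ∏ i, w i (parents E' i) := by
  rw [← Finset.mul_prod_erase _ _ (Finset.mem_univ j),
    ← Finset.mul_prod_erase Finset.univ (fun i => w i (parents E' i)) (Finset.mem_univ j),
    ← mul_assoc]
  have : ∏ x ∈ Finset.univ.erase j, w x (parents E' x) =
      ∏ x ∈ Finset.univ.erase j, w x (parents E x) :=
    Finset.prod_congr rfl fun i hi => by rw [h i (Finset.ne_of_mem_erase hi)]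
  rw [this]
  exact mul_le_mul_of_nonneg_right hj (Finset.prod_nonneg fun i _ => hw i)

theorem sum_card_children (E : EdgeSet p) (A : Finset (Fin p)) :
    ∑ k ∈ A, (children E k).card = ∑ j, (parents E j ∩ A).card := by
  have h1 : ∀ k, (children E k).card = ∑ j, if (k, j) ∈ E then 1 else 0 := fun k => by
    simp [children]
  have h2 : ∀ j, (parents E j ∩ A).card = ∑ k ∈ A, if (k, j) ∈ E then 1 else 0 := fun j => by
    rw [← Finset.card_filter]
    congr 1
    ext k; simp [and_comm]
  simp only [h1, h2]
  rw [Finset.sum_comm]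

/-- If every node with a missing true parent is assigned one of them, and every node without is
in its true state, then some assigned parent has out-degree at most `d * din`. -/
theorem exists_children_card_le {E G : EdgeSet p} {din d : ℕ} (hdin : 1 ≤ din)
    (hE : ∀ j, (parents E j).card ≤ din) (hd : ∀ k, (children G k).card ≤ d)
    {U : Finset (Fin p)} (hU : U.Nonempty) (k : Fin p → Fin p)
    (hk : ∀ j ∈ U, k j ∈ parents G j ∧ k j ∉ parents E j)
    (hV : ∀ j, j ∉ U → parents E j = parents G j) :
    ∃ j ∈ U, (children E (k j)).card ≤ d * din := by
  classical
  by_contra! hcon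
  set A := U.image k with hA
  have hA0 : A.Nonempty := hU.image k
  have h1 : A.card * (d * din) < ∑ a ∈ A, (children E a).card := by
    rw [← smul_eq_mul, ← Finset.sum_const]
    refine Finset.sum_lt_sum_of_nonempty hA0 fun a ha => ?_
    obtain ⟨j, hj, rfl⟩ := Finset.mem_image.1 ha
    exact hcon j hj
  rw [sum_card_children] at h1
  -- The edges out of `A` are counted at their heads. A node in `U` has at most `din` of them in `E`
  -- and at least one in `G`, namely from its assigned parent; at any other node the two graphs
  -- agree.
  have h2 : ∑ j, (parents E j ∩ A).card ≤ ∑ j, din * (parents G j ∩ A).card := by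
    refine Finset.sum_le_sum fun j _ => ?_
    by_cases hj : j ∈ U
    · have : 1 ≤ (parents G j ∩ A).card := Finset.card_pos.2
        ⟨k j, Finset.mem_inter.2 ⟨(hk j hj).1, Finset.mem_image_of_mem k hj⟩⟩
      calc (parents E j ∩ A).card ≤ din :=
            (Finset.card_le_card Finset.inter_subset_left).trans (hE j)
        _ ≤ _ := Nat.le_mul_of_pos_right _ this
    · rw [hV j hj]; exact Nat.le_mul_of_pos_left _ hdin
  rw [← Finset.mul_sum, ← sum_card_children G A] at h2
  have h3 : ∑ a ∈ A, (children G a).card ≤ A.card * d := by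
    simpa using Finset.sum_le_card_nsmul A _ d fun a _ => hd a
  have h4 := Nat.mul_le_mul_left din h3
  have h5 : din * (A.card * d) = A.card * (d * din) := by ring
  omega

theorem children_insert_le (E : EdgeSet p) (k j a : Fin p) :
    (children (insert (k, j) E) a).card ≤ (children E a).card + if a = k then 1 else 0 := by
  split_ifs with h
  · subst h
    have : children (insert (a, j) E) a = insert j (children E a) := by ext i; simp
    rw [this]; exact Finset.card_insert_le _ _
  · have : children (insert (k, j) E) a = children E a := by ext i; simp [h]
    rw [this]; simp

theorem children_mono {E F : EdgeSet p} (h : E ⊆ F) (a : Fin p) :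
    (children E a).card ≤ (children F a).card :=
  Finset.card_le_card fun i hi => by simp only [mem_children] at hi ⊢; exact h hi

/-- Node-wise score-increasing moves (delete a superfluous parent; add a missing parent, deleting
another one if the parent set is saturated) give a score-increasing add-delete-swap move. -/
theorem exists_adsNbhd_mul_le {σ : Equiv.Perm (Fin p)} {din dout d : ℕ} (hdin : 1 ≤ din)
    {G : EdgeSet p} (hG : G ∈ sparseDAGs σ din dout) (hd : ∀ k, (children G k).card ≤ d)
    (hdout : min (d * din + 1) p ≤ dout) {w : Fin p → Finset (Fin p) → ℝ} {R : ℝ}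
    (hw : ∀ j S, (∀ i ∈ S, σ.symm i < σ.symm j) → S.card ≤ din → 0 ≤ w j S)
    (hover : ∀ j S, (∀ i ∈ S, σ.symm i < σ.symm j) → S.card ≤ din → parents G j ⊂ S →
      ∃ l ∈ S, R * w j S ≤ w j (S.erase l))
    (hunder : ∀ j S, (∀ i ∈ S, σ.symm i < σ.symm j) → S.card ≤ din → ¬ parents G j ⊆ S →
      ∃ k ∈ parents G j, k ∉ S ∧ ((S.card < din ∧ R * w j S ≤ w j (insert k S)) ∨
        ∃ l ∈ S, R * w j S ≤ w j ((insert k S).erase l)))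
    {E : EdgeSet p} (hE : E ∈ sparseDAGs σ din dout) (hEG : E ≠ G) :
    ∃ E' ∈ sparseDAGs σ din dout, E' ∈ adsNbhd E ∧
      R * ∏ j, w j (parents E j) ≤ ∏ j, w j (parents E' j) := by
  classical
  obtain ⟨hEo, hEi, hEout⟩ := mem_sparseDAGs.1 hE
  have hord : ∀ j, ∀ i ∈ parents E j, σ.symm i < σ.symm j := fun j i hi =>
    mem_orderedDAGs.1 hEo i j (mem_parents.1 hi)
  have hGo := mem_orderedDAGs.1 (mem_sparseDAGs.1 hG).1
  have hw' : ∀ i, 0 ≤ w i (parents E i) := fun i => hw i _ (hord i) (hEi i)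
  have mem_ads : ∀ {E'}, E' ∈ orderedDAGs σ →
      ((∃ i j, (i, j) ∉ E ∧ E' = insert (i, j) E) ∨
     (∃ i j, (i, j) ∈ E ∧ E' = E.erase (i, j)) ∨
     (∃ k l j, (k, j) ∉ E ∧ (l, j) ∈ E ∧ E' = (insert (k, j) E).erase (l, j))) →
      E' ∈ adsNbhd E := fun h1 h2 => by
    simp only [adsNbhd, Finset.mem_filter, Finset.mem_univ, true_and]
    exact ⟨isAcyclic_of_mem_orderedDAGs h1, h2⟩
  -- Deletions come first: they respect all degree bounds, and once no node is overfitted, each node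
  -- without a missing true parent has exactly its true parents, as the counting lemma requires.
  by_cases hov : ∃ j, parents G j ⊂ parents E j
  · obtain ⟨j, hj⟩ := hov
    obtain ⟨l, hl, hR⟩ := hover j _ (hord j) (hEi j) hj
    have hsub : E.erase (l, j) ⊆ E := Finset.erase_subset _ _
    have ho : E.erase (l, j) ∈ orderedDAGs σ :=
      mem_orderedDAGs.2 fun a b hab => mem_orderedDAGs.1 hEo a b (hsub hab)
    refine ⟨E.erase (l, j), mem_sparseDAGs.2 ⟨ho, fun i => ?_, fun i => ?_⟩,
      mem_ads ho (Or.inr (Or.inl ⟨l, j, mem_parents.1 hl, rfl⟩)), ?_⟩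
    · refine (Finset.card_le_card fun a ha => ?_).trans (hEi i)
      exact mem_parents.2 (hsub (mem_parents.1 ha))
    · exact (children_mono hsub i).trans (hEout i)
    · refine mul_prod_parents_le (j := j) hw' (fun i hi => parents_erase_ne E l hi) ?_
      rwa [parents_erase_self]
  · set U := Finset.univ.filter fun j => ¬ parents G j ⊆ parents E j with hUdef
    have hV : ∀ j, j ∉ U → parents E j = parents G j := by
      intro j hj
      have h1 : parents G j ⊆ parents E j := by simpa [hUdef] using hj
      by_contra hne
      exact hov ⟨j, Finset.ssubset_iff_subset_ne.2 ⟨h1, fun h => hne h.symm⟩⟩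
    have hU : U.Nonempty := by
      by_contra hU
      rw [Finset.not_nonempty_iff_eq_empty] at hU
      exact hEG (eq_of_parents_eq fun j => hV j (by simp [hU]))
    have hun : ∀ j ∈ U, ∃ k ∈ parents G j, k ∉ parents E j ∧
        (((parents E j).card < din ∧ R * w j (parents E j) ≤ w j (insert k (parents E j))) ∨
        ∃ l ∈ parents E j, R * w j (parents E j) ≤ w j ((insert k (parents E j)).erase l)) :=
      fun j hj => hunder j _ (hord j) (hEi j) (Finset.mem_filter.1 hj).2
    choose! k hk1 hk2 hk3 using hun
    obtain ⟨j, hj, hjd⟩ : ∃ j ∈ U, (children E (k j)).card + 1 ≤ dout := by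
      -- If `p` is the smaller term, the out-degree is no constraint: the children of `k j` omit
      -- `j`, so there is room for one more. Otherwise the double count finds a suitable node.
      rcases le_total p (d * din + 1) with hp | hp
      · obtain ⟨j, hj⟩ := hU
        refine ⟨j, hj, ?_⟩
        rw [min_eq_right hp] at hdout
        have hlt : (children E (k j)).card < p := by
          have : (children E (k j)) ⊂ Finset.univ :=
            Finset.ssubset_univ_iff.2 fun h => hk2 j hj (by
              have : j ∈ children E (k j) := h ▸ Finset.mem_univ j
              simpa using this)
          simpa using Finset.card_lt_card this
        omega
      · obtain ⟨j, hj, h⟩ := exists_children_card_le hdin hEi hd hU k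
          (fun j hj => ⟨hk1 j hj, hk2 j hj⟩) hV
        rw [min_eq_left hp] at hdout
        exact ⟨j, hj, by omega⟩
    have hkE : (k j, j) ∉ E := fun h => hk2 j hj (mem_parents.2 h)
    have ho : insert (k j, j) E ∈ orderedDAGs σ := by
      refine mem_orderedDAGs.2 fun a b hab => ?_
      rcases Finset.mem_insert.1 hab with h | h
      · obtain ⟨ha, hb⟩ := Prod.mk.inj h
        rw [ha, hb]
        exact hGo _ _ (mem_parents.1 (hk1 j hj))
      · exact mem_orderedDAGs.1 hEo a b h
    have hc : ∀ i, (children (insert (k j, j) E) i).card ≤ dout := by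
      intro i
      refine (children_insert_le E (k j) j i).trans ?_
      split_ifs with h
      · rw [h]; exact hjd
      · simpa using hEout i
    rcases hk3 j hj with ⟨h1, h2⟩ | ⟨l, hl, h2⟩
    · refine ⟨insert (k j, j) E, mem_sparseDAGs.2 ⟨ho, fun i => ?_, hc⟩,
        mem_ads ho (Or.inl ⟨_, _, hkE, rfl⟩), ?_⟩
      · by_cases hi : i = j
        · subst hi
          rw [parents_insert_self]
          exact (Finset.card_insert_le _ _).trans h1
        · rw [parents_insert_ne E _ hi]; exact hEi i
      · refine mul_prod_parents_le (j := j) hw' (fun i hi => parents_insert_ne E _ hi) ?_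
        rwa [parents_insert_self]
    · have hsub : (insert (k j, j) E).erase (l, j) ⊆ insert (k j, j) E := Finset.erase_subset _ _
      have ho' : (insert (k j, j) E).erase (l, j) ∈ orderedDAGs σ :=
        mem_orderedDAGs.2 fun a b hab => mem_orderedDAGs.1 ho a b (hsub hab)
      refine ⟨(insert (k j, j) E).erase (l, j), mem_sparseDAGs.2 ⟨ho', fun i => ?_, fun i => ?_⟩,
        mem_ads ho' (Or.inr (Or.inr ⟨_, l, j, hkE, mem_parents.1 hl, rfl⟩)), ?_⟩
      · by_cases hi : i = j
        · subst hi
          rw [parents_erase_self, parents_insert_self,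
            Finset.card_erase_of_mem (Finset.mem_insert_of_mem hl),
            Finset.card_insert_of_notMem (hk2 i hj)]
          simpa using hEi i
        · rw [parents_erase_ne _ _ hi, parents_insert_ne E _ hi]; exact hEi i
      · exact (children_mono hsub i).trans (hc i)
      · refine mul_prod_parents_le (j := j) hw' (fun i hi => ?_) ?_
        · rw [parents_erase_ne _ _ hi, parents_insert_ne E _ hi]
        · rwa [parents_erase_self, parents_insert_self]

end Graphs

/-! ### Least-squares residuals -/

section Residuals

open scoped RealInnerProductSpace

variable {V : Type*} [NormedAddCommGroup V] [InnerProductSpace ℝ V] {ι : Type*}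

theorem mem_span_of_mem (x : ι → V) {S : Finset ι} {i : ι} (hi : i ∈ S) :
    x i ∈ Submodule.span ℝ (x '' (S : Set ι)) :=
  Submodule.subset_span ⟨i, hi, rfl⟩

variable [FiniteDimensional ℝ V]

/-- The residual of `y` after projection onto the span of the `x i`, `i ∈ S`. -/
noncomputable def resid (x : ι → V) (S : Finset ι) (y : V) : V :=
  y - (Submodule.span ℝ (x '' (S : Set ι))).starProjection y

theorem inner_resid_of_mem_span (x : ι → V) (S : Finset ι) (y : V) {z : V}
    (hz : z ∈ Submodule.span ℝ (x '' (S : Set ι))) : ⟪resid x S y, z⟫ = 0 :=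
  Submodule.starProjection_inner_eq_zero y z hz

theorem inner_resid_of_mem (x : ι → V) {S : Finset ι} (y : V) {i : ι} (hi : i ∈ S) :
    ⟪resid x S y, x i⟫ = 0 :=
  inner_resid_of_mem_span x S y (mem_span_of_mem x hi)

/-- The characterization by orthogonality through which explicit formulas for residuals are
verified. -/
theorem resid_eq_of_inner_eq_zero (x : ι → V) (S : Finset ι) {y z : V}
    (hz : y - z ∈ Submodule.span ℝ (x '' (S : Set ι))) (h : ∀ i ∈ S, ⟪z, x i⟫ = 0) :
    resid x S y = z := by
  have h2 : ∀ w ∈ Submodule.span ℝ (x '' (S : Set ι)), ⟪y - (y - z), w⟫ = 0 := by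
    intro w hw
    rw [sub_sub_cancel]
    induction hw using Submodule.span_induction with
    | mem w hw => obtain ⟨i, hi, rfl⟩ := hw; exact h i hi
    | zero => simp
    | add a b _ _ ha hb => rw [inner_add_right, ha, hb, add_zero]
    | smul c a _ ha => rw [inner_smul_right, ha, mul_zero]
  rw [resid, Submodule.eq_starProjection_of_mem_of_inner_eq_zero hz h2, sub_sub_cancel]

theorem resid_sum (x : ι → V) (S T : Finset ι) (b : ι → ℝ) :
    resid x S (∑ i ∈ T, b i • x i) = ∑ i ∈ T, b i • resid x S (x i) := by
  simp only [resid, map_sum, map_smul, smul_sub, Finset.sum_sub_distrib]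

theorem inner_resid_comm (x : ι → V) (S : Finset ι) (y z : V) :
    ⟪resid x S y, z⟫ = ⟪y, resid x S z⟫ := by
  rw [resid, resid, inner_sub_left, inner_sub_right, Submodule.inner_starProjection_left_eq_right]

theorem inner_resid_self (x : ι → V) (S : Finset ι) (y : V) :
    ⟪resid x S y, y⟫ = ‖resid x S y‖ ^ 2 := by
  have h : ⟪resid x S y, (Submodule.span ℝ (x '' (S : Set ι))).starProjection y⟫ = 0 :=
    inner_resid_of_mem_span x S y (Submodule.starProjection_apply_mem _ _)
  have h2 : ⟪resid x S y, resid x S y⟫ = ⟪resid x S y, y⟫ -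
      ⟪resid x S y, (Submodule.span ℝ (x '' (S : Set ι))).starProjection y⟫ := inner_sub_right _ _ _
  rw [← real_inner_self_eq_norm_sq, h2, h, sub_zero]

theorem norm_resid_sq_le (x : ι → V) (S : Finset ι) (y : V) : ‖resid x S y‖ ^ 2 ≤ ‖y‖ ^ 2 := by
  have h1 := inner_resid_self x S y
  have h2 := real_inner_le_norm (resid x S y) y
  have h3 : ‖resid x S y‖ ≤ ‖y‖ := by
    by_contra hcon
    push Not at hcon
    nlinarith [norm_nonneg (resid x S y), norm_nonneg y]
  gcongr

theorem exists_sub_resid_eq_sum (x : ι → V) (S : Finset ι) (y : V) :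
    ∃ a : ι → ℝ, (∀ i, i ∉ S → a i = 0) ∧ y - resid x S y = ∑ i ∈ S, a i • x i := by
  classical
  have h : y - resid x S y ∈ Submodule.span ℝ (x '' (S : Set ι)) := by
    rw [resid, sub_sub_cancel]; exact Submodule.starProjection_apply_mem _ _
  obtain ⟨c, hc⟩ := (Submodule.mem_span_image_finset_iff_exists_fun' ℝ).1 h
  refine ⟨fun i => if i ∈ S then c i else 0, fun i hi => by simp [hi], ?_⟩
  rw [← hc]
  exact Finset.sum_congr rfl fun i hi => by simp [hi]

/-- The decrease of the residual sum of squares when a regressor is added. -/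
theorem norm_resid_sq_sub_insert [DecidableEq ι] (x : ι → V) (S : Finset ι) (k : ι) (y : V)
    (hk : resid x S (x k) ≠ 0) :
    ‖resid x S y‖ ^ 2 - ‖resid x (insert k S) y‖ ^ 2 =
      ⟪resid x S (x k), y⟫ ^ 2 / ‖resid x S (x k)‖ ^ 2 := by
  set r := resid x S (x k) with hr
  have hr0 : ‖r‖ ^ 2 ≠ 0 := by positivity
  have hmono : Submodule.span ℝ (x '' (S : Set ι)) ≤
      Submodule.span ℝ (x '' ((insert k S : Finset ι) : Set ι)) :=
    Submodule.span_mono (Set.image_mono (by simp))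
  have hrk : r ∈ Submodule.span ℝ (x '' ((insert k S : Finset ι) : Set ι)) := by
    rw [hr, resid]
    exact Submodule.sub_mem _ (mem_span_of_mem x (Finset.mem_insert_self k S))
      (hmono (Submodule.starProjection_apply_mem _ _))
  set c := ⟪r, y⟫ / ‖r‖ ^ 2 with hc
  have hry : ⟪resid x S y, x k⟫ = ⟪r, y⟫ := by rw [inner_resid_comm, real_inner_comm]
  have hrr : ⟪r, x k⟫ = ‖r‖ ^ 2 := inner_resid_self x S (x k)
  -- One Gram–Schmidt step: the new residual is the old one minus its component along `r`, the part
  -- of `x k` orthogonal to the old span.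
  have h1 : resid x (insert k S) y = resid x S y - c • r := by
    refine resid_eq_of_inner_eq_zero x _ ?_ fun i hi => ?_
    · rw [← sub_add]
      refine Submodule.add_mem _ (hmono ?_) (Submodule.smul_mem _ _ hrk)
      rw [resid, sub_sub_cancel]; exact Submodule.starProjection_apply_mem _ _
    · rw [inner_sub_left, inner_smul_left]
      rcases Finset.mem_insert.1 hi with rfl | hi
      · rw [hry, hrr, hc, conj_trivial, div_mul_cancel₀ _ hr0, sub_self]
      · rw [inner_resid_of_mem x y hi, hr, inner_resid_of_mem x (x k) hi]; simp
  have h2 : ⟪resid x S y, r⟫ = ⟪r, y⟫ := by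
    have : ⟪resid x S y, (Submodule.span ℝ (x '' (S : Set ι))).starProjection (x k)⟫ = 0 :=
      inner_resid_of_mem_span x S y (Submodule.starProjection_apply_mem _ _)
    have h2 : ⟪resid x S y, r⟫ = ⟪resid x S y, x k⟫ -
      ⟪resid x S y, (Submodule.span ℝ (x '' (S : Set ι))).starProjection (x k)⟫ :=
        inner_sub_right _ _ _
    rw [h2, this, sub_zero, hry]
  rw [h1, norm_sub_sq_real, inner_smul_right, h2, norm_smul, mul_pow, Real.norm_eq_abs, sq_abs, hc]
  field_simp
  ring

end Residuals

/-! ### The residual sum of squares of the data -/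

section Rss

open scoped RealInnerProductSpace

variable {n p : ℕ}

/-- The columns of the data matrix as vectors of the Euclidean space. -/
noncomputable def colVec (X : Matrix (Fin n) (Fin p) ℝ) (i : Fin p) : EuclideanSpace ℝ (Fin n) :=
  WithLp.toLp 2 (X.col i)

theorem sum_smul_colVec (X : Matrix (Fin n) (Fin p) ℝ) (v : Fin p → ℝ) :
    ∑ i, v i • colVec X i = WithLp.toLp 2 (X *ᵥ v) := by
  ext a
  simp [colVec, Matrix.mulVec, dotProduct, mul_comm]

theorem inner_colVec (X : Matrix (Fin n) (Fin p) ℝ) (i : Fin p) (z : Fin n → ℝ) :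
    ⟪WithLp.toLp 2 z, colVec X i⟫ = X.col i ⬝ᵥ z := by
  simp [colVec, EuclideanSpace.inner_eq_star_dotProduct]

theorem resid_colVec {X : Matrix (Fin n) (Fin p) ℝ} {T : Finset (Fin p)}
    (h : IsUnit ((cols X T)ᵀ * cols X T).det) (j : Fin p) :
    resid (colVec X) T (colVec X j) = WithLp.toLp 2
      ((1 - cols X T * ((cols X T)ᵀ * cols X T)⁻¹ * (cols X T)ᵀ) *ᵥ X.col j) := by
  set M := cols X T with hM
  refine resid_eq_of_inner_eq_zero _ _ ?_ fun i hi => ?_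
  · set v := ((Mᵀ * M)⁻¹ * Mᵀ) *ᵥ X.col j with hv
    have e : colVec X j - WithLp.toLp 2 ((1 - M * (Mᵀ * M)⁻¹ * Mᵀ) *ᵥ X.col j) =
        ∑ i : {i // i ∈ T}, v i • colVec X i.1 := by
      rw [Matrix.sub_mulVec, Matrix.one_mulVec, WithLp.toLp_sub]
      change colVec X j - (colVec X j - _) = _
      rw [sub_sub_cancel, Matrix.mul_assoc, ← Matrix.mulVec_mulVec, ← hv]
      ext a
      simp [colVec, Matrix.mulVec, dotProduct, hM, cols, mul_comm]
    rw [e]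
    exact Submodule.sum_mem _ fun i _ => Submodule.smul_mem _ _ (mem_span_of_mem _ i.2)
  · rw [inner_colVec]
    have e : Mᵀ *ᵥ ((1 - M * (Mᵀ * M)⁻¹ * Mᵀ) *ᵥ X.col j) = 0 := by
      rw [Matrix.mulVec_mulVec, Matrix.mul_sub, Matrix.mul_one, ← Matrix.mul_assoc,
        ← Matrix.mul_assoc, Matrix.mul_nonsing_inv _ h, Matrix.one_mul, sub_self,
        Matrix.zero_mulVec]
    exact congrFun e ⟨i, hi⟩

theorem rss_eq_norm_resid_sq {X : Matrix (Fin n) (Fin p) ℝ} {T : Finset (Fin p)}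
    (h : IsUnit ((cols X T)ᵀ * cols X T).det) (j : Fin p) :
    rss X j T = ‖resid (colVec X) T (colVec X j)‖ ^ 2 := by
  rw [← inner_resid_self, resid_colVec h, inner_colVec, rss]

/-- Clearing the determinant gives an expression polynomial in the data, hence continuous even where
the Gram matrix is singular. The factor is harmless because the noise bound is homogeneous in the
residual. -/
theorem det_smul_resid_colVec {X : Matrix (Fin n) (Fin p) ℝ} {T : Finset (Fin p)}
    (h : IsUnit ((cols X T)ᵀ * cols X T).det) (j : Fin p) :
    ((cols X T)ᵀ * cols X T).det • resid (colVec X) T (colVec X j) = WithLp.toLp 2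
      (((cols X T)ᵀ * cols X T).det • X.col j -
        (cols X T * ((cols X T)ᵀ * cols X T).adjugate * (cols X T)ᵀ) *ᵥ X.col j) := by
  rw [resid_colVec h, ← WithLp.toLp_smul, ← Matrix.smul_mulVec, smul_sub, Matrix.sub_mulVec,
    Matrix.smul_mulVec, Matrix.one_mulVec, Matrix.inv_def, Matrix.mul_smul, Matrix.smul_mul,
    smul_smul, Ring.mul_inverse_cancel _ h, one_smul]

/-- If the columns in `T` are linearly independent, the Gram matrix is invertible. -/
theorem isUnit_det_gram {X : Matrix (Fin n) (Fin p) ℝ} {T : Finset (Fin p)}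
    (h : ∀ v : Fin p → ℝ, (∀ i, i ∉ T → v i = 0) → ∑ i, v i • colVec X i = 0 → v = 0) :
    IsUnit ((cols X T)ᵀ * cols X T).det := by
  classical
  have hinj : Function.Injective (cols X T).mulVec := by
    rw [← Matrix.coe_mulVecLin, injective_iff_map_eq_zero]
    intro u hu
    have := h (fun i => if hi : i ∈ T then u ⟨i, hi⟩ else 0) (fun i hi => by simp [hi]) (by
      rw [← Finset.sum_subset (Finset.subset_univ T) (fun i _ hi => by simp [hi]),
        ← Finset.sum_attach]
      have : ∑ i ∈ T.attach, (if hi : i.1 ∈ T then u ⟨i.1, hi⟩ else 0) • colVec X i.1 =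
          WithLp.toLp 2 (cols X T *ᵥ u) := by
        ext a
        simp [colVec, Matrix.mulVec, dotProduct, cols, mul_comm]
      rw [this]
      rw [Matrix.mulVecLin_apply] at hu
      rw [hu]; rfl)
    ext ⟨i, hi⟩
    simpa [hi] using congrFun this i
  have := Matrix.PosDef.conjTranspose_mul_self (cols X T) hinj
  rw [Matrix.conjTranspose_eq_transpose_of_trivial] at this
  exact (Matrix.isUnit_iff_isUnit_det _).1 this.isUnit

end Rss

/-! ### Greedy selection of regressors under restricted eigenvalue bounds -/

section Selection

open scoped RealInnerProductSpace

variable {V : Type*} [NormedAddCommGroup V] [InnerProductSpace ℝ V]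
  {ι : Type*} [Fintype ι]

/-- The eigenvalues of the Gram matrix of the `x i`, `i ∈ W`, lie in `[a, b]`. -/
def GramBounds (x : ι → V) (W : Finset ι) (a b : ℝ) : Prop :=
  ∀ v : ι → ℝ, (∀ i, i ∉ W → v i = 0) →
    a * ∑ i, v i ^ 2 ≤ ‖∑ i, v i • x i‖ ^ 2 ∧ ‖∑ i, v i • x i‖ ^ 2 ≤ b * ∑ i, v i ^ 2

theorem GramBounds.norm_sq_le {x : ι → V} {W : Finset ι} {a b : ℝ}
    (h : GramBounds x W a b) {i : ι} (hi : i ∈ W) : ‖x i‖ ^ 2 ≤ b := by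
  classical
  have := (h (Pi.single i 1) fun j hj => by
    rw [Pi.single_apply, if_neg]; rintro rfl; exact hj hi).2
  simpa [Pi.single_apply] using this

/-- For coefficient vectors with disjoint supports the inner product is at most
`(b - a) / 2` times the product of the norms. -/
theorem GramBounds.inner_le {x : ι → V} {W : Finset ι} {a b : ℝ} (h : GramBounds x W a b)
    {u v : ι → ℝ} (hu : ∀ i, i ∉ W → u i = 0) (hv : ∀ i, i ∉ W → v i = 0)
    (huv : ∀ i, u i * v i = 0) :
    2 * ⟪∑ i, u i • x i, ∑ i, v i • x i⟫ ≤
      (b - a) * (√(∑ i, u i ^ 2) * √(∑ i, v i ^ 2)) := by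
  set A := √(∑ i, u i ^ 2) with hA
  set B := √(∑ i, v i ^ 2) with hB
  have hA2 : ∑ i, u i ^ 2 = A ^ 2 := (Real.sq_sqrt (Finset.sum_nonneg fun i _ => sq_nonneg _)).symm
  have hB2 : ∑ i, v i ^ 2 = B ^ 2 := (Real.sq_sqrt (Finset.sum_nonneg fun i _ => sq_nonneg _)).symm
  have hA0 : 0 ≤ A := Real.sqrt_nonneg _
  have hB0 : 0 ≤ B := Real.sqrt_nonneg _
  set y := ∑ i, u i • x i with hy
  set z := ∑ i, v i • x i with hz
  -- Polarization at vectors of equal length: since the supports are disjoint, `B u + A v` and `B u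
  -- - A v` both have squared norm `2 (A B)²`, so the difference of their quadratic forms is at most
  -- `(b - a) * 2 (A B)²`.
  have e1 : ∑ i, (B * u i + A * v i) • x i = B • y + A • z := by
    simp only [add_smul, mul_smul, Finset.sum_add_distrib, ← Finset.smul_sum, hy, hz]
  have e2 : ∑ i, (B * u i - A * v i) • x i = B • y - A • z := by
    simp only [sub_smul, mul_smul, Finset.sum_sub_distrib, ← Finset.smul_sum, hy, hz]
  have s1 : ∑ i, (B * u i + A * v i) ^ 2 = 2 * (A * B) ^ 2 := by
    have : ∀ i, (B * u i + A * v i) ^ 2 = B ^ 2 * u i ^ 2 + A ^ 2 * v i ^ 2 := fun i => by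
      linear_combination 2 * A * B * huv i
    simp only [this, Finset.sum_add_distrib, ← Finset.mul_sum, hA2, hB2]; ring
  have s2 : ∑ i, (B * u i - A * v i) ^ 2 = 2 * (A * B) ^ 2 := by
    have : ∀ i, (B * u i - A * v i) ^ 2 = B ^ 2 * u i ^ 2 + A ^ 2 * v i ^ 2 := fun i => by
      linear_combination -2 * A * B * huv i
    simp only [this, Finset.sum_add_distrib, ← Finset.mul_sum, hA2, hB2]; ring
  have h1 := (h (fun i => B * u i + A * v i) fun i hi => by simp [hu i hi, hv i hi]).2
  have h2 := (h (fun i => B * u i - A * v i) fun i hi => by simp [hu i hi, hv i hi]).1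
  rw [e1, s1, norm_add_sq_real, inner_smul_left, inner_smul_right, conj_trivial] at h1
  rw [e2, s2, norm_sub_sq_real, inner_smul_left, inner_smul_right, conj_trivial] at h2
  rcases (mul_nonneg hA0 hB0).eq_or_lt with h0 | h0
  · rw [← h0, mul_zero]
    rcases mul_eq_zero.1 h0.symm with h0 | h0
    · have : y = 0 := by
        have hu0 : ∀ i, u i = 0 := fun i => by
          have : ∑ i, u i ^ 2 = 0 := by rw [hA2, h0]; ring
          exact pow_eq_zero_iff two_ne_zero |>.1
            ((Finset.sum_eq_zero_iff_of_nonneg fun i _ => sq_nonneg _).1 this i (Finset.mem_univ i))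
        simp [hy, hu0]
      simp [this]
    · have : z = 0 := by
        have hu0 : ∀ i, v i = 0 := fun i => by
          have : ∑ i, v i ^ 2 = 0 := by rw [hB2, h0]; ring
          exact pow_eq_zero_iff two_ne_zero |>.1
            ((Finset.sum_eq_zero_iff_of_nonneg fun i _ => sq_nonneg _).1 this i (Finset.mem_univ i))
        simp [hz, hu0]
      simp [this]
  · refine le_of_mul_le_mul_left ?_ h0
    nlinarith

variable [FiniteDimensional ℝ V]

/-- The residual is a combination of the regressors in which `x k` has coefficient 1, so the
coefficient vector has norm at least one. -/
theorem GramBounds.le_norm_resid_sq {x : ι → V} {S W : Finset ι} {a b : ℝ} (ha : 0 < a)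
    (h : GramBounds x W a b) (hS : S ⊆ W) {k : ι} (hk : k ∈ W) (hkS : k ∉ S) :
    a ≤ ‖resid x S (x k)‖ ^ 2 := by
  classical
  obtain ⟨c, hc, hr⟩ := exists_sub_resid_eq_sum x S (x k)
  have e : resid x S (x k) = ∑ i, ((Pi.single k 1 : ι → ℝ) i - c i) • x i := by
    have : ∑ i, c i • x i = ∑ i ∈ S, c i • x i :=
      (Finset.sum_subset (Finset.subset_univ S) fun i _ hi => by simp [hc i hi]).symm
    simp only [sub_smul, Finset.sum_sub_distrib, this, ← hr]
    simp [Pi.single_apply]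
  have h1 := (h (fun i => (Pi.single k 1 : ι → ℝ) i - c i) fun i hi => by
    have hik : i ≠ k := by rintro rfl; exact hi hk
    simp [hik, hc i (fun h => hi (hS h))]).1
  rw [e]
  refine le_trans ?_ h1
  have : 1 ≤ ∑ i, ((Pi.single k 1 : ι → ℝ) i - c i) ^ 2 := by
    refine le_trans ?_ (Finset.single_le_sum
      (f := fun i => ((Pi.single k 1 : ι → ℝ) i - c i) ^ 2)
      (fun i _ => sq_nonneg _) (Finset.mem_univ k))
    simp [hc k hkS]
  nlinarith

/-- Some missing regressor explains a fixed part of the missing signal. -/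
theorem GramBounds.exists_mem_le_inner_resid {x : ι → V} {S M W : Finset ι} {a b : ℝ}
    (ha : 0 < a) (h : GramBounds x W a b) (hS : S ⊆ W) (hM : M ⊆ W) (hSM : Disjoint S M)
    {β : ι → ℝ} (hβ : ∀ i ∈ M, β i ≠ 0) (hM0 : M.Nonempty) :
    ∃ k ∈ M, a ^ 2 * (∑ i ∈ M, β i ^ 2) / (b * M.card) ≤
      ⟪resid x S (x k), ∑ i ∈ M, β i • x i⟫ ^ 2 / ‖resid x S (x k)‖ ^ 2 := by
  classical
  have hrk : ∀ k ∈ M, 0 < ‖resid x S (x k)‖ ^ 2 := fun k hk =>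
    ha.trans_le (h.le_norm_resid_sq ha hS (hM hk) (Finset.disjoint_right.1 hSM hk))
  obtain ⟨k₀, hk₀⟩ := hM0
  have hb : 0 < b := by
    have h1 := (hrk k₀ hk₀).trans_le (norm_resid_sq_le x S (x k₀))
    exact h1.trans_le (h.norm_sq_le (hM hk₀))
  by_contra! hcon
  set q := ∑ i ∈ M, β i • x i with hq
  set B := ∑ i ∈ M, β i ^ 2 with hB
  have hB0 : 0 < B := Finset.sum_pos (fun i hi => by have := hβ i hi; positivity) ⟨k₀, hk₀⟩
  have hc0 : (0 : ℝ) < M.card := by exact_mod_cast Finset.card_pos.2 ⟨k₀, hk₀⟩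
  set D := a ^ 2 * B / (b * M.card) with hD
  -- Expanding the residual of the missing signal over `M` and applying Cauchy–Schwarz bounds the
  -- sum of the squared correlations from below; the best regressor attains at least the average.
  have h1 : ‖resid x S q‖ ^ 2 = ∑ i ∈ M, β i * ⟪resid x S (x i), q⟫ := by
    rw [← inner_resid_self, hq, resid_sum, sum_inner]
    exact Finset.sum_congr rfl fun i _ => by rw [inner_smul_left, conj_trivial]
  have h2 : a * B ≤ ‖resid x S q‖ ^ 2 := by
    obtain ⟨c, hc, hr⟩ := exists_sub_resid_eq_sum x S q
    have e : resid x S q = ∑ i, ((if i ∈ M then β i else 0) - c i) • x i := by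
      have e1 : ∑ i, c i • x i = ∑ i ∈ S, c i • x i :=
        (Finset.sum_subset (Finset.subset_univ S) fun i _ hi => by simp [hc i hi]).symm
      simp only [sub_smul, Finset.sum_sub_distrib, e1, ← hr]
      simp [hq, ite_smul]
    rw [e]
    refine le_trans ?_ (h _ fun i hi => ?_).1
    · gcongr
      rw [hB]
      refine le_trans (Finset.sum_le_sum fun i hi => ?_)
        (Finset.sum_le_sum_of_subset_of_nonneg (Finset.subset_univ M) fun i _ _ => sq_nonneg _)
      simp [hi, hc i (Finset.disjoint_right.1 hSM hi)]
    · rw [if_neg fun h => hi (hM h), hc i fun h => hi (hS h), sub_zero]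
  have h3 : (‖resid x S q‖ ^ 2) ^ 2 ≤ B * ∑ i ∈ M, ⟪resid x S (x i), q⟫ ^ 2 := by
    rw [h1]; exact Finset.sum_mul_sq_le_sq_mul_sq M β _
  have h4 : ∑ i ∈ M, ⟪resid x S (x i), q⟫ ^ 2 < M.card * (D * b) := by
    rw [← nsmul_eq_mul, ← Finset.sum_const]
    refine Finset.sum_lt_sum_of_nonempty ⟨k₀, hk₀⟩ fun i hi => ?_
    have h5 := hcon i hi
    rw [div_lt_iff₀ (hrk i hi)] at h5
    refine h5.trans_le ?_
    have hD0 : 0 ≤ D := by positivity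
    exact mul_le_mul_of_nonneg_left
      ((norm_resid_sq_le x S (x i)).trans (h.norm_sq_le (hM hi))) hD0
  have h6 : (a * B) ^ 2 ≤ (‖resid x S q‖ ^ 2) ^ 2 := by gcongr
  have h7 : B * (M.card * (D * b)) = (a * B) ^ 2 := by
    rw [hD]; field_simp
  have h8 := mul_lt_mul_of_pos_left h4 hB0
  linarith

/-- Some regressor in `L` is nearly useless for explaining the signal from outside `S`. -/
theorem GramBounds.exists_mem_inner_resid_le [DecidableEq ι] {x : ι → V} {S M W L : Finset ι}
    {a b : ℝ} (ha : 0 < a) (hab : a ≤ b) (h : GramBounds x W a b) (hS : S ⊆ W) (hM : M ⊆ W)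
    (hSM : Disjoint S M) (hL : L ⊆ S) (hL0 : L.Nonempty) (β : ι → ℝ) :
    ∃ l ∈ L, ⟪resid x (S.erase l) (x l), ∑ i ∈ M, β i • x i⟫ ^ 2 /
        ‖resid x (S.erase l) (x l)‖ ^ 2 ≤
      b * (b - a) ^ 2 / (4 * a ^ 2) * (∑ i ∈ M, β i ^ 2) / L.card := by
  set q := ∑ i ∈ M, β i • x i with hq
  obtain ⟨c, hc, hr⟩ := exists_sub_resid_eq_sum x S q
  have hrl : ∀ l ∈ L, 0 < ‖resid x (S.erase l) (x l)‖ ^ 2 := fun l hl =>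
    ha.trans_le (h.le_norm_resid_sq ha ((Finset.erase_subset _ _).trans hS) (hS (hL hl)) (by simp))
  have hc0 : (0 : ℝ) < L.card := by exact_mod_cast Finset.card_pos.2 hL0
  have hcS : ∑ i ∈ S, c i • x i = ∑ i, c i • x i :=
    Finset.sum_subset (Finset.subset_univ S) fun i _ hi => by simp [hc i hi]
  -- The part of `x l` orthogonal to the rest of `S` sees the projection of `q` only through the
  -- coefficient `c l`. Deleting `l` therefore costs `c l ^ 2 * ‖resid‖ ^ 2`, and it remains to
  -- bound `∑ c ^ 2` and choose the smallest coefficient in `L`.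
  have h1 : ∀ l ∈ L, ⟪resid x (S.erase l) (x l), q⟫ =
      c l * ‖resid x (S.erase l) (x l)‖ ^ 2 := by
    intro l hl
    have hlS := hL hl
    have e : q = ∑ i ∈ S, c i • x i + resid x S q := by rw [← hr]; abel
    have hmem : resid x (S.erase l) (x l) ∈ Submodule.span ℝ (x '' (S : Set ι)) := by
      rw [resid]
      refine Submodule.sub_mem _ (mem_span_of_mem x hlS) ?_
      exact Submodule.span_mono (Set.image_mono (by simp))
        (Submodule.starProjection_apply_mem _ _)
    have e2 : ⟪resid x (S.erase l) (x l), resid x S q⟫ = 0 := by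
      rw [real_inner_comm]; exact inner_resid_of_mem_span x S q hmem
    rw [e, inner_add_right, e2, add_zero, inner_sum, ← Finset.add_sum_erase _ _ hlS,
      Finset.sum_eq_zero, add_zero, inner_smul_right, inner_resid_self]
    intro i hi
    rw [inner_smul_right, inner_resid_of_mem x _ hi, mul_zero]
  set B := ∑ i ∈ M, β i ^ 2 with hB
  have hB0 : 0 ≤ B := Finset.sum_nonneg fun i _ => sq_nonneg _
  have h2 : 4 * a ^ 2 * ∑ i, c i ^ 2 ≤ (b - a) ^ 2 * B := by
    set C := ∑ i, c i ^ 2 with hC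
    have hC0 : 0 ≤ C := Finset.sum_nonneg fun i _ => sq_nonneg _
    have hcW : ∀ i, i ∉ W → c i = 0 := fun i hi => hc i fun h => hi (hS h)
    have h3 := (h c hcW).1
    set v : ι → ℝ := fun i => if i ∈ M then β i else 0 with hv
    have hvq : ∑ i, v i • x i = q := by simp [hv, hq, ite_smul]
    have hvB : ∑ i, v i ^ 2 = B := by simp [hv, hB, ite_pow]
    have h4 := h.inner_le hcW (v := v)
      (fun i hi => by simp only [hv]; rw [if_neg fun h => hi (hM h)])
      (fun i => by
        by_cases hi : i ∈ S
        · simp [hv, Finset.disjoint_left.1 hSM hi]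
        · simp [hc i hi])
    rw [hvq, hvB, ← hC] at h4
    -- The projection of `q` has inner product with `q` equal to its own squared norm. As `c` and
    -- `β` live on the disjoint sets `S` and `M`, this is of size `(b - a) / 2`, which makes the
    -- coefficients small when the Gram matrix is close to a multiple of the identity.
    have h5 : ⟪∑ i, c i • x i, q⟫ = ‖∑ i, c i • x i‖ ^ 2 := by
      rw [← hcS, ← hr, ← real_inner_self_eq_norm_sq]
      have : ⟪q - resid x S q, resid x S q⟫ = 0 := by
        rw [real_inner_comm, hr]
        exact inner_resid_of_mem_span x S q (Submodule.sum_mem _ fun i hi =>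
          Submodule.smul_mem _ _ (mem_span_of_mem x hi))
      rw [inner_sub_right, this, sub_zero]
    rw [h5] at h4
    have hs : √C ^ 2 = C := Real.sq_sqrt hC0
    have hs' : √B ^ 2 = B := Real.sq_sqrt hB0
    have hsC := Real.sqrt_nonneg C
    have hsB := Real.sqrt_nonneg B
    have h6 : 2 * a * √C ≤ (b - a) * √B := by
      rcases hsC.eq_or_lt with h0 | h0
      · rw [← h0]; have := sub_nonneg.2 hab; simp; positivity
      · refine le_of_mul_le_mul_left ?_ h0
        nlinarith
    calc 4 * a ^ 2 * C = (2 * a * √C) ^ 2 := by rw [mul_pow, hs]; ring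
      _ ≤ ((b - a) * √B) ^ 2 := by gcongr
      _ = _ := by rw [mul_pow, hs']
  obtain ⟨l, hl, hmin⟩ := Finset.exists_min_image L (fun l => c l ^ 2) hL0
  refine ⟨l, hl, ?_⟩
  have h3 : L.card * c l ^ 2 ≤ ∑ i, c i ^ 2 := by
    rw [← nsmul_eq_mul]
    exact (Finset.card_nsmul_le_sum L _ _ hmin).trans
      (Finset.sum_le_sum_of_subset_of_nonneg (Finset.subset_univ L) fun i _ _ => sq_nonneg _)
  have h4 : ‖resid x (S.erase l) (x l)‖ ^ 2 ≤ b :=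
    (norm_resid_sq_le _ _ _).trans (h.norm_sq_le (hS (hL hl)))
  rw [h1 l hl, le_div_iff₀ hc0]
  have hb : 0 < b := ha.trans_le hab
  calc _ = L.card * c l ^ 2 * ‖resid x (S.erase l) (x l)‖ ^ 2 := by
        have := (hrl l hl).ne'
        rw [mul_pow, sq (‖resid x (S.erase l) (x l)‖ ^ 2), ← mul_assoc, mul_div_cancel_right₀ _ this]
        ring
    _ ≤ (∑ i, c i ^ 2) * b := by gcongr
    _ ≤ _ := by
      rw [div_mul_eq_mul_div, le_div_iff₀ (by positivity)]
      nlinarith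

end Selection

/-! ### Addition, deletion and swap of regressors in the presence of noise -/

section NodeMoves

open scoped RealInnerProductSpace

variable {V : Type*} [NormedAddCommGroup V] [InnerProductSpace ℝ V] [FiniteDimensional ℝ V]
  {ι : Type*} [DecidableEq ι]

theorem inner_resid_add_noise {x : ι → V} {S T : Finset ι} {β : ι → ℝ} {y ε : V}
    (hy : y = ∑ i ∈ T, β i • x i + ε) {k : ι} :
    ⟪resid x S (x k), y⟫ = ⟪resid x S (x k), ∑ i ∈ T \ S, β i • x i⟫ + ⟪resid x S (x k), ε⟫ := by
  have h0 : ⟪resid x S (x k), ∑ i ∈ T ∩ S, β i • x i⟫ = 0 := by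
    rw [inner_sum]
    refine Finset.sum_eq_zero fun i hi => ?_
    rw [inner_smul_right, inner_resid_of_mem x _ (Finset.mem_inter.1 hi).2, mul_zero]
  rw [hy, inner_add_right, ← Finset.sum_sdiff (Finset.inter_subset_left : T ∩ S ⊆ T),
    Finset.sdiff_inter_self_left, inner_add_right, h0, add_zero]

/-- Deleting a superfluous regressor increases the residual sum of squares by noise only. -/
theorem norm_resid_sq_erase_le {x : ι → V} {S T : Finset ι} {β : ι → ℝ} {y ε : V}
    (hy : y = ∑ i ∈ T, β i • x i + ε) {l : ι} (hl : l ∈ S) (hT : T ⊆ S) (hlT : l ∉ T) {τ : ℝ}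
    (h0 : resid x (S.erase l) (x l) ≠ 0)
    (hτ : ⟪resid x (S.erase l) (x l), ε⟫ ^ 2 ≤ τ * ‖resid x (S.erase l) (x l)‖ ^ 2) :
    ‖resid x (S.erase l) y‖ ^ 2 ≤ ‖resid x S y‖ ^ 2 + τ := by
  have h1 := norm_resid_sq_sub_insert x (S.erase l) l y h0
  have hT' : T \ S.erase l = ∅ := by
    rw [Finset.sdiff_eq_empty_iff_subset]
    exact fun i hi => Finset.mem_erase.2 ⟨fun h => hlT (h ▸ hi), hT hi⟩
  rw [Finset.insert_erase hl, inner_resid_add_noise hy, hT'] at h1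
  simp only [Finset.sum_empty, inner_zero_right, zero_add] at h1
  have h2 : ⟪resid x (S.erase l) (x l), ε⟫ ^ 2 / ‖resid x (S.erase l) (x l)‖ ^ 2 ≤ τ := by
    rwa [div_le_iff₀ (by positivity)]
  linarith

/-- Numerically `(1 - 1 / √20) ^ 2 > 3 / 5`: noise of relative size `1 / √20` cannot destroy more of
the gain. -/
theorem add_sq_ge_of_sq_ge {A e D : ℝ} (hA : D ≤ A ^ 2) (he : 20 * e ^ 2 ≤ D) :
    3 / 5 * D ≤ (A + e) ^ 2 := by
  nlinarith [sq_nonneg (0.22 * A + e)]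

/-- Numerically `(1 / 4 + 1 / √20) ^ 2 < 1 / 4`. -/
theorem add_sq_le_of_sq_le {A e D : ℝ} (hA : 16 * A ^ 2 ≤ D) (he : 20 * e ^ 2 ≤ D) :
    (A + e) ^ 2 ≤ D / 4 := by
  nlinarith [sq_nonneg (0.9 * A - e)]

theorem add_sq_div {A e r : ℝ} (hr : 0 < r) :
    (A + e) ^ 2 / r = (A / √r + e / √r) ^ 2 := by
  rw [← add_div, div_pow, Real.sq_sqrt hr.le]

/-- If a true regressor is missing, then adding a suitable one decreases the residual sum of
squares substantially; if there are enough superfluous regressors, one of these can be deleted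
afterwards without losing more than half of the gain. -/
theorem exists_norm_resid_sq_le [Fintype ι] {x : ι → V} {S T A : Finset ι} {β : ι → ℝ} {y ε : V}
    (hy : y = ∑ i ∈ T, β i • x i + ε) {a b τ D : ℝ} (ha : 0 < a) (hab : a ≤ b)
    (hG : GramBounds x (S ∪ T) a b) (hSA : S ⊆ A) (hTA : T ⊆ A) (hTS : ¬ T ⊆ S)
    (hβ : ∀ i ∈ T, β i ≠ 0) (hD : ∀ i ∈ T, D ≤ a ^ 2 / b * β i ^ 2) (hτD : 20 * τ ≤ D)
    (hτ : ∀ S' ⊆ A, S'.card ≤ S.card → ∀ k ∈ A, k ∉ S' →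
      ⟪resid x S' (x k), ε⟫ ^ 2 ≤ τ * ‖resid x S' (x k)‖ ^ 2) :
    ∃ k ∈ T, k ∉ S ∧ ‖resid x (insert k S) y‖ ^ 2 ≤ ‖resid x S y‖ ^ 2 - 3 / 5 * D ∧
      (4 * b ^ 2 * (b - a) ^ 2 / a ^ 4 * T.card < (S \ T).card →
        ∃ l ∈ S, ‖resid x ((insert k S).erase l) y‖ ^ 2 ≤ ‖resid x S y‖ ^ 2 - 7 / 20 * D) := by
  have hb : 0 < b := ha.trans_le hab
  set M := T \ S with hM
  have hM0 : M.Nonempty := Finset.sdiff_nonempty.2 hTS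
  have hMT : M ⊆ T := Finset.sdiff_subset
  have hMc : (0 : ℝ) < M.card := by exact_mod_cast Finset.card_pos.2 hM0
  obtain ⟨k, hkM, hk⟩ := hG.exists_mem_le_inner_resid ha Finset.subset_union_left
    (hMT.trans Finset.subset_union_right) Finset.disjoint_sdiff (fun i hi => hβ i (hMT hi)) hM0
  set B := ∑ i ∈ M, β i ^ 2 with hB
  set D' := a ^ 2 * B / (b * M.card) with hD'
  -- `D'` is built from the average of `β i ^ 2` over the missing regressors, and `D` lies below
  -- every single term.
  have hDD' : D ≤ D' := by
    have h1 : M.card * D ≤ a ^ 2 / b * B := by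
      rw [hB, Finset.mul_sum, ← nsmul_eq_mul]
      exact Finset.card_nsmul_le_sum _ _ _ fun i hi => hD i (hMT hi)
    rw [hD', ← div_div, le_div_iff₀ hMc, mul_comm D]
    calc _ ≤ _ := h1
      _ = _ := by ring
  have hτD' : 20 * τ ≤ D' := hτD.trans hDD'
  have hkT := hMT hkM
  have hkS : k ∉ S := (Finset.mem_sdiff.1 hkM).2
  have hr : 0 < ‖resid x S (x k)‖ ^ 2 := ha.trans_le (hG.le_norm_resid_sq ha
    Finset.subset_union_left (Finset.mem_union_right _ hkT) hkS)
  have hr0 : resid x S (x k) ≠ 0 := fun h => by simp [h] at hr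
  have hnoise := hτ S hSA le_rfl k (hTA hkT) hkS
  have h1 : ‖resid x (insert k S) y‖ ^ 2 ≤ ‖resid x S y‖ ^ 2 - 3 / 5 * D' := by
    have h2 := norm_resid_sq_sub_insert x S k y hr0
    rw [inner_resid_add_noise hy, add_sq_div hr] at h2
    have h3 : 3 / 5 * D' ≤ _ := add_sq_ge_of_sq_ge
      (A := ⟪resid x S (x k), ∑ i ∈ T \ S, β i • x i⟫ / √(‖resid x S (x k)‖ ^ 2))
      (e := ⟪resid x S (x k), ε⟫ / √(‖resid x S (x k)‖ ^ 2))
      (by rw [div_pow, Real.sq_sqrt hr.le]; exact hk)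
      (by
        rw [div_pow, Real.sq_sqrt hr.le]
        have := (div_le_iff₀ hr).2 hnoise
        linarith)
    linarith
  refine ⟨k, hkT, hkS, by linarith, fun hL => ?_⟩
  have hL0 : (S \ T).Nonempty := by
    rw [← Finset.card_pos]
    have : (0 : ℝ) < (S \ T).card := lt_of_le_of_lt (by positivity) hL
    exact_mod_cast this
  have hS' : insert k S ⊆ S ∪ T := Finset.insert_subset (Finset.mem_union_right _ hkT)
    Finset.subset_union_left
  obtain ⟨l, hl, hlq⟩ := hG.exists_mem_inner_resid_le ha hab hS'
    (M := T \ insert k S) (Finset.sdiff_subset.trans Finset.subset_union_right)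
    Finset.disjoint_sdiff (L := S \ T) (Finset.sdiff_subset.trans (Finset.subset_insert k S)) hL0 β
  obtain ⟨hlS, hlT⟩ := Finset.mem_sdiff.1 hl
  refine ⟨l, hlS, ?_⟩
  have hlk : l ≠ k := fun h => hkS (h ▸ hlS)
  have hlS' : l ∈ insert k S := Finset.mem_insert_of_mem hlS
  have hr' : 0 < ‖resid x ((insert k S).erase l) (x l)‖ ^ 2 :=
    ha.trans_le (hG.le_norm_resid_sq ha ((Finset.erase_subset _ _).trans hS')
      (Finset.mem_union_left _ hlS) (by simp))
  have hr0' : resid x ((insert k S).erase l) (x l) ≠ 0 := fun h => by simp [h] at hr'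
  -- The set left after the swap has the size of `S`, so the noise bound still applies to it.
  have hnoise' := hτ ((insert k S).erase l)
    ((Finset.erase_subset _ _).trans (Finset.insert_subset (hTA hkT) hSA))
    (by rw [Finset.card_erase_of_mem hlS', Finset.card_insert_of_notMem hkS]; simp)
    l (hSA hlS) (by simp)
  have h2 := norm_resid_sq_sub_insert x ((insert k S).erase l) l y hr0'
  have hTS' : T \ (insert k S).erase l = T \ insert k S := by
    ext i
    simp only [Finset.mem_sdiff, Finset.mem_erase, not_and]
    refine and_congr_right fun hi => ⟨fun h => h fun h' => hlT (h' ▸ hi), fun h _ => h⟩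
  rw [Finset.insert_erase hlS', inner_resid_add_noise hy, hTS', add_sq_div hr'] at h2
  have h3 : _ ≤ D' / 4 := add_sq_le_of_sq_le
    (A := ⟪resid x ((insert k S).erase l) (x l), ∑ i ∈ T \ insert k S, β i • x i⟫ /
      √(‖resid x ((insert k S).erase l) (x l)‖ ^ 2))
    (e := ⟪resid x ((insert k S).erase l) (x l), ε⟫ /
      √(‖resid x ((insert k S).erase l) (x l)‖ ^ 2))
    (by
      rw [div_pow, Real.sq_sqrt hr'.le]
      have hBB : ∑ i ∈ T \ insert k S, β i ^ 2 ≤ B :=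
        Finset.sum_le_sum_of_subset_of_nonneg
          (Finset.sdiff_subset_sdiff le_rfl (Finset.subset_insert k S)) fun i _ _ => sq_nonneg _
      have hLc : (0 : ℝ) < (S \ T).card := by exact_mod_cast Finset.card_pos.2 hL0
      have hB0 : 0 ≤ B := Finset.sum_nonneg fun i _ => sq_nonneg _
      have hMTc : (M.card : ℝ) ≤ T.card := by exact_mod_cast Finset.card_le_card hMT
      have h4 : 4 * b ^ 2 * (b - a) ^ 2 / a ^ 4 * M.card ≤ (S \ T).card :=
        le_trans (by gcongr) hL.le
      have h5 : b * (b - a) ^ 2 / (4 * a ^ 2) * (∑ i ∈ T \ insert k S, β i ^ 2) / (S \ T).card ≤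
          b * (b - a) ^ 2 / (4 * a ^ 2) * B / (S \ T).card := by gcongr
      -- The count of superfluous regressors required by `hL` is exactly what makes the signal lost
      -- with `l` at most `D' / 16`. With noise the deletion costs at most `D' / 4`, so the swap
      -- gains at least `(3 / 5 - 1 / 4) * D' = 7 / 20 * D'`.
      have h6 : 16 * (b * (b - a) ^ 2 / (4 * a ^ 2) * B / (S \ T).card) ≤ D' := by
        rw [hD', ← mul_div_assoc, div_le_div_iff₀ hLc (by positivity)]
        calc 16 * (b * (b - a) ^ 2 / (4 * a ^ 2) * B) * (b * M.card)
            = a ^ 2 * B * (4 * b ^ 2 * (b - a) ^ 2 / a ^ 4 * M.card) := by field_simp; ring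
          _ ≤ _ := by gcongr
      linarith)
    (by
      rw [div_pow, Real.sq_sqrt hr'.le]
      have := (div_le_iff₀ hr').2 hnoise'
      linarith)
  linarith

end NodeMoves

/-! ### Posterior scores -/

section Scores

variable {n p : ℕ}

theorem nodeWeight_eq_exp {h : Hyper} {X : Matrix (Fin n) (Fin p) ℝ} {j : Fin p}
    {T : Finset (Fin p)} (hp : 0 < p) (hc : 1 ≤ h.c₁ * √(1 + h.α / h.γ)) (hR : 0 < rss X j T) :
    nodeWeight h X j T = Real.exp (-(T.card *
      (Real.log (h.c₁ * √(1 + h.α / h.γ)) + h.c₂ * Real.log p)) -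
        (h.α * n + h.κ) / 2 * Real.log (rss X j T)) := by
  have hp' : (0 : ℝ) < p := by exact_mod_cast hp
  have hc' : (0 : ℝ) < h.c₁ * √(1 + h.α / h.γ) := by linarith
  have e : h.c₁ * (p : ℝ) ^ h.c₂ * √(1 + h.α / h.γ) =
      Real.exp (Real.log (h.c₁ * √(1 + h.α / h.γ)) + h.c₂ * Real.log p) := by
    rw [Real.exp_add, Real.exp_log hc', mul_comm h.c₂, ← Real.rpow_def_of_pos hp']; ring
  rw [nodeWeight, e, ← Real.exp_nat_mul, ← Real.exp_neg, Real.rpow_def_of_pos hR, ← Real.exp_add]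
  congr 1
  ring

/-- By concavity of the logarithm; it converts changes of the residual sum of squares into changes
of the score in both directions. -/
theorem log_sub_log_le {R R' : ℝ} (hR : 0 < R) (hR' : 0 < R') :
    Real.log R' - Real.log R ≤ (R' - R) / R := by
  rw [← Real.log_div hR'.ne' hR.ne', sub_div, div_self hR.ne']
  exact Real.log_le_sub_one_of_pos (div_pos hR' hR)

open scoped RealInnerProductSpace

/-- The regularity of the data at the node `j` with predecessors `A`, true parents `T`, true
coefficients `β` and noise variance `ω` that makes greedy moves increase the posterior score. -/
structure NodeRegular (X : Matrix (Fin n) (Fin p) ℝ) (j : Fin p) (A T : Finset (Fin p))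
    (β : Fin p → ℝ) (ω u νlo νhi : ℝ) (din : ℕ) : Prop where
  gram : ∀ W : Finset (Fin p), W.card ≤ 2 * din → GramBounds (colVec X) W (n * νlo) (n * νhi)
  le_resid : ∀ S ⊆ A, S.card ≤ din → n * ω / 2 ≤ ‖resid (colVec X) S (colVec X j)‖ ^ 2
  noise : ∀ S ⊆ A, S.card ≤ din → ∀ k ∈ A, k ∉ S →
    ⟪resid (colVec X) S (colVec X k), colVec X j - ∑ i ∈ T, β i • colVec X i⟫ ^ 2 ≤
      ω * u * ‖resid (colVec X) S (colVec X k)‖ ^ 2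

namespace NodeRegular

variable {X : Matrix (Fin n) (Fin p) ℝ} {j : Fin p} {A T : Finset (Fin p)} {β : Fin p → ℝ}
  {ω u νlo νhi : ℝ} {din : ℕ}

theorem rss_eq (H : NodeRegular X j A T β ω u νlo νhi din) (hn : 0 < n) (hνlo : 0 < νlo)
    {S : Finset (Fin p)} (hS : S.card ≤ din) :
    rss X j S = ‖resid (colVec X) S (colVec X j)‖ ^ 2 := by
  refine rss_eq_norm_resid_sq (isUnit_det_gram fun v hv h0 => ?_) j
  have h1 := (H.gram S (by omega) v hv).1
  rw [h0, norm_zero, zero_pow two_ne_zero] at h1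
  have hn' : (0 : ℝ) < n := by exact_mod_cast hn
  have h2 : ∑ i, v i ^ 2 = 0 := le_antisymm (nonpos_of_mul_nonpos_right h1 (by positivity))
    (Finset.sum_nonneg fun i _ => sq_nonneg _)
  ext i
  exact pow_eq_zero_iff two_ne_zero |>.1
    ((Finset.sum_eq_zero_iff_of_nonneg fun i _ => sq_nonneg _).1 h2 i (Finset.mem_univ i))

theorem rss_pos (H : NodeRegular X j A T β ω u νlo νhi din) (hn : 0 < n) (hνlo : 0 < νlo)
    (hω : 0 < ω) {S : Finset (Fin p)} (hSA : S ⊆ A) (hS : S.card ≤ din) : 0 < rss X j S := by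
  rw [H.rss_eq hn hνlo hS]
  have hn' : (0 : ℝ) < n := by exact_mod_cast hn
  exact lt_of_lt_of_le (by positivity) (H.le_resid S hSA hS)

/-- Deleting a superfluous parent increases the posterior score. -/
theorem mul_nodeWeight_le_erase {h : Hyper} {t : ℝ}
    (H : NodeRegular X j A T β ω ((4 * din + 6) * Real.log p) νlo νhi din)
    (hn : 0 < n) (hp : 2 ≤ p) (hνlo : 0 < νlo) (hω : 0 < ω) (hα : 0 < h.α) (hκ : 0 ≤ h.κ)
    (hκn : h.κ ≤ n) (hc : 1 ≤ h.c₁ * √(1 + h.α / h.γ))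
    (hc₂ : (h.α + 1) * (4 * din + 6) + t ≤ h.c₂)
    {S : Finset (Fin p)} (hSA : S ⊆ A) (hS : S.card ≤ din) (hTS : T ⊂ S) :
    ∃ l ∈ S, (p : ℝ) ^ t * nodeWeight h X j S ≤ nodeWeight h X j (S.erase l) := by
  obtain ⟨l, hlS, hlT⟩ := Finset.exists_of_ssubset hTS
  refine ⟨l, hlS, ?_⟩
  have hn' : (0 : ℝ) < n := by exact_mod_cast hn
  have hp' : (0 : ℝ) < p := by positivity
  have hlp : 0 < Real.log p := Real.log_pos (by exact_mod_cast hp)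
  have hSA' : S.erase l ⊆ A := (Finset.erase_subset _ _).trans hSA
  have hS' : (S.erase l).card ≤ din := (Finset.card_le_card (Finset.erase_subset _ _)).trans hS
  have h1 := norm_resid_sq_erase_le (x := colVec X) (y := colVec X j)
    (ε := colVec X j - ∑ i ∈ T, β i • colVec X i) (T := T) (β := β) (by abel) hlS hTS.1 hlT
    (τ := ω * ((4 * din + 6) * Real.log p))
    (by
      intro h0
      have := (H.gram S (by omega)).le_norm_resid_sq (by positivity) (Finset.erase_subset l S) hlS
        (by simp)
      rw [h0, norm_zero, zero_pow two_ne_zero] at this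
      have : 0 < n * νlo := by positivity
      linarith)
    (H.noise _ hSA' hS' l (hSA hlS) (by simp))
  have hR := H.rss_pos hn hνlo hω hSA hS
  have hR' := H.rss_pos hn hνlo hω hSA' hS'
  have hRω := H.le_resid S hSA hS
  rw [← H.rss_eq hn hνlo hS] at h1 hRω
  rw [← H.rss_eq hn hνlo hS'] at h1
  rw [nodeWeight_eq_exp (by omega) hc hR, nodeWeight_eq_exp (by omega) hc hR',
    Real.rpow_def_of_pos hp', ← Real.exp_add, Real.exp_le_exp,
    Finset.card_erase_of_mem hlS, Nat.cast_sub (Finset.card_pos.2 ⟨l, hlS⟩)]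
  set u := (4 * (din : ℝ) + 6) * Real.log p with hu
  have hu0 : 0 ≤ u := by positivity
  -- The increase of at most `ω * u` is compared with the noise floor `n * ω / 2`, so `ω` cancels.
  -- After multiplication by `(α n + κ) / 2 ≤ (α + 1) n / 2` the loss is `(α + 1) * u`, which the
  -- penalty `c₂ log p` covers with `t log p` to spare.
  have h2 : Real.log (rss X j (S.erase l)) - Real.log (rss X j S) ≤ 2 * u / n := by
    refine (log_sub_log_le hR hR').trans ?_
    rw [div_le_div_iff₀ hR hn']
    calc (rss X j (S.erase l) - rss X j S) * n ≤ ω * u * n := by gcongr; linarith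
      _ = 2 * u * (n * ω / 2) := by ring
      _ ≤ _ := by gcongr
  have h3 : (h.α * n + h.κ) / 2 * (Real.log (rss X j (S.erase l)) - Real.log (rss X j S)) ≤
      (h.α + 1) * u := by
    calc _ ≤ (h.α * n + h.κ) / 2 * (2 * u / n) := by gcongr
      _ ≤ (h.α * n + n) / 2 * (2 * u / n) := by gcongr
      _ = _ := by field_simp
  have h4 : 0 ≤ Real.log (h.c₁ * √(1 + h.α / h.γ)) := Real.log_nonneg hc
  have h5 := mul_le_mul_of_nonneg_right hc₂ hlp.le
  have h6 : ((h.α + 1) * (4 * din + 6) + t) * Real.log p = (h.α + 1) * u + t * Real.log p := by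
    rw [hu]; ring
  push_cast
  linarith

set_option maxHeartbeats 400000 in
/-- If a true parent is missing, then adding one increases the posterior score, if necessary
together with the deletion of another parent. -/
theorem exists_mul_nodeWeight_le {h : Hyper} {t Cβ d : ℝ}
    (H : NodeRegular X j A T β ω ((4 * din + 6) * Real.log p) νlo νhi din)
    (hn : 0 < n) (hp : 2 ≤ p) (hνlo : 0 < νlo) (hν : νlo ≤ νhi) (hω : 0 < ω) (hωνhi : ω ≤ νhi)
    (hα : 0 < h.α) (hα1 : h.α < 1) (hκ : 0 ≤ h.κ)
    (hc : 1 ≤ h.c₁ * √(1 + h.α / h.γ)) (hcp : h.c₁ * √(1 + h.α / h.γ) ≤ p)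
    (ht : 3 < t) (hCβ : 8 * t / 3 ≤ Cβ)
    (hc₂ : (h.α + 1) * (4 * din + 6) + t ≤ h.c₂) (hTA : T ⊆ A)
    (hTd : (T.card : ℝ) ≤ d)
    (hd : (4 * νhi ^ 2 * (νlo ^ 4)⁻¹ * (νhi - νlo) ^ 2 + 1) * d ≤ din)
    (hβ0 : ∀ i ∈ T, β i ≠ 0)
    (hβ : ∀ i ∈ T, 5 * (Cβ + 4 * h.c₂) * (νhi ^ 2 * Real.log p / (h.α * νlo ^ 2 * n)) ≤ β i ^ 2)
    {S : Finset (Fin p)} (hSA : S ⊆ A) (hS : S.card ≤ din) (hTS : ¬ T ⊆ S) :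
    ∃ k ∈ T, k ∉ S ∧
      ((S.card < din ∧ (p : ℝ) ^ t * nodeWeight h X j S ≤ nodeWeight h X j (insert k S)) ∨
        ∃ l ∈ S, (p : ℝ) ^ t * nodeWeight h X j S ≤ nodeWeight h X j ((insert k S).erase l)) := by
  have hn' : (0 : ℝ) < n := by exact_mod_cast hn
  have hp' : (0 : ℝ) < p := by positivity
  have hlp : 0 < Real.log p := Real.log_pos (by exact_mod_cast hp)
  have hνhi : 0 < νhi := hνlo.trans_le hν
  have hTne : T.Nonempty := by
    by_contra h0
    rw [Finset.not_nonempty_iff_eq_empty] at h0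
    exact hTS (by simp [h0])
  have hd1 : 1 ≤ d := le_trans (by exact_mod_cast Finset.card_pos.2 hTne) hTd
  have hK0 : 0 ≤ 4 * νhi ^ 2 * (νlo ^ 4)⁻¹ * (νhi - νlo) ^ 2 := by positivity
  have hTdin : T.card ≤ din := by
    have : (T.card : ℝ) ≤ din := by nlinarith
    exact_mod_cast this
  have hdin : 1 ≤ din := (Finset.card_pos.2 hTne).trans_le hTdin
  have hc₂4 : 4 * (din : ℝ) + 6 ≤ h.c₂ := by nlinarith
  have hc₂0 : 0 < h.c₂ := by linarith [(Nat.cast_nonneg din : (0 : ℝ) ≤ din)]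
  set u := (4 * (din : ℝ) + 6) * Real.log p with hu
  -- The beta-min condition multiplied by `a ^ 2 / b` for the Gram bounds `a = n * νlo` and `b = n *
  -- νhi`. These are needed on `S ∪ T`, hence on sets of size up to `2 * din`.
  set D := 5 * (Cβ + 4 * h.c₂) * (νhi * Real.log p / h.α) with hD
  have hCβ0 : 0 < Cβ := by linarith
  have hD0 : 0 < D := by positivity
  obtain ⟨k, hkT, hkS, hk1, hk2⟩ := exists_norm_resid_sq_le (x := colVec X) (y := colVec X j)
    (ε := colVec X j - ∑ i ∈ T, β i • colVec X i) (T := T) (β := β) (S := S) (A := A) (by abel)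
    (a := n * νlo) (b := n * νhi) (τ := ω * u) (D := D) (by positivity) (by gcongr)
    (H.gram _ ((Finset.card_union_le _ _).trans (by omega))) hSA hTA hTS hβ0
    (by
      intro i hi
      calc D = (n * νlo) ^ 2 / (n * νhi) *
            (5 * (Cβ + 4 * h.c₂) * (νhi ^ 2 * Real.log p / (h.α * νlo ^ 2 * n))) := by
            rw [hD]; field_simp
        _ ≤ _ := by gcongr; exact hβ i hi)
    (by
      have h1 : ω * u ≤ νhi * (h.c₂ * Real.log p) := by rw [hu]; gcongr
      have h2 : νhi * Real.log p ≤ νhi * Real.log p / h.α := by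
        rw [le_div_iff₀ hα]; nlinarith [mul_pos hνhi hlp]
      have h3 : 20 * h.c₂ * (νhi * Real.log p) ≤ 20 * h.c₂ * (νhi * Real.log p / h.α) := by gcongr
      have h4 : 0 ≤ 5 * Cβ * (νhi * Real.log p / h.α) := by positivity
      rw [hD]
      linarith)
    (fun S' hS'A hS' => H.noise S' hS'A (hS'.trans hS))
  have hR := H.rss_pos hn hνlo hω hSA hS
  have hRle : rss X j S ≤ n * νhi := by
    rw [H.rss_eq hn hνlo hS]
    exact (norm_resid_sq_le _ _ _).trans
      ((H.gram {j} (by rw [Finset.card_singleton]; omega)).norm_sq_le (by simp))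
  have hlc : Real.log (h.c₁ * √(1 + h.α / h.γ)) ≤ Real.log p :=
    Real.log_le_log (by linarith) hcp
  -- Since the residual sum of squares is at most `n * νhi`, a decrease by `ρ * D` raises the score
  -- by at least `α n / 2 * ρ * D / (n * νhi)`, where `n`, `νhi` and `α` cancel.
  have hgain : ∀ R' : ℝ, 0 < R' → ∀ ρ : ℝ, 0 ≤ ρ → R' ≤ rss X j S - ρ * D →
      ρ * (5 / 2 * (Cβ + 4 * h.c₂) * Real.log p) ≤
        (h.α * n + h.κ) / 2 * (Real.log (rss X j S) - Real.log R') := by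
    intro R' hR' ρ hρ hle
    have h1 : ρ * D / (n * νhi) ≤ Real.log (rss X j S) - Real.log R' := by
      have h2 := log_sub_log_le hR hR'
      have h3 : ρ * D / (n * νhi) ≤ (rss X j S - R') / rss X j S :=
        (div_le_div_of_nonneg_left (by positivity) hR hRle).trans
          (div_le_div_of_nonneg_right (by linarith) hR.le)
      have h4 : (rss X j S - R') / rss X j S = -((R' - rss X j S) / rss X j S) := by
        rw [← neg_div]; ring
      linarith
    calc _ = h.α * n / 2 * (ρ * D / (n * νhi)) := by rw [hD]; field_simp
      _ ≤ (h.α * n + h.κ) / 2 * (ρ * D / (n * νhi)) := by gcongr; linarith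
      _ ≤ _ := by gcongr
  refine ⟨k, hkT, hkS, ?_⟩
  rcases hS.lt_or_eq with hlt | heq
  · left
    refine ⟨hlt, ?_⟩
    have hS' : (insert k S).card ≤ din := (Finset.card_insert_le _ _).trans hlt
    have hR' := H.rss_pos hn hνlo hω (Finset.insert_subset (hTA hkT) hSA) hS'
    rw [← H.rss_eq hn hνlo hS, ← H.rss_eq hn hνlo hS'] at hk1
    have h1 := hgain _ hR' (3 / 5) (by norm_num) hk1
    rw [nodeWeight_eq_exp (by omega) hc hR, nodeWeight_eq_exp (by omega) hc hR',
      Real.rpow_def_of_pos hp', ← Real.exp_add, Real.exp_le_exp,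
      Finset.card_insert_of_notMem hkS]
    push_cast
    -- An addition has to pay the penalty of one more parent, at most `(c₂ + 1) log p`, besides the
    -- factor `p ^ t`.
    have h2 : Real.log p * t + h.c₂ * Real.log p + Real.log p ≤
        3 / 5 * (5 / 2 * (Cβ + 4 * h.c₂) * Real.log p) := by
      have : 0 ≤ (3 / 5 * (5 / 2 * (Cβ + 4 * h.c₂)) - t - h.c₂ - 1) * Real.log p :=
        mul_nonneg (by linarith) hlp.le
      linarith
    linarith
  · right
    -- The set is full and misses an element of `T`, so more than `din - |T|` of its elements are
    -- superfluous, and the sparsity condition makes this number large enough. The swap keeps the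
    -- cardinality, so no penalty is due.
    obtain ⟨l, hlS, hl⟩ := hk2 (by
      have hcard : ((S \ T).card : ℝ) = din - (S ∩ T).card := by
        have := Finset.card_sdiff_add_card_inter S T
        rw [heq] at this
        rw [eq_sub_iff_add_eq]
        exact_mod_cast this
      have hlt : ((S ∩ T).card : ℝ) < T.card := by
        have : S ∩ T ⊂ T := Finset.ssubset_iff_subset_ne.2
          ⟨Finset.inter_subset_right, fun h => hTS (Finset.inter_eq_right.1 h)⟩
        exact_mod_cast Finset.card_lt_card this
      have e : 4 * ((n : ℝ) * νhi) ^ 2 * (n * νhi - n * νlo) ^ 2 / (n * νlo) ^ 4 =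
          4 * νhi ^ 2 * (νlo ^ 4)⁻¹ * (νhi - νlo) ^ 2 := by field_simp
      have h2 := mul_le_mul_of_nonneg_left hTd hK0
      rw [add_mul, one_mul] at hd
      rw [e, hcard]
      linarith)
    refine ⟨l, hlS, ?_⟩
    have hlS' : l ∈ insert k S := Finset.mem_insert_of_mem hlS
    have hcard : ((insert k S).erase l).card = S.card := by
      rw [Finset.card_erase_of_mem hlS', Finset.card_insert_of_notMem hkS]; simp
    have hS' : ((insert k S).erase l).card ≤ din := hcard.le.trans hS
    have hR' := H.rss_pos hn hνlo hω
      ((Finset.erase_subset l _).trans (Finset.insert_subset (hTA hkT) hSA)) hS'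
    rw [← H.rss_eq hn hνlo hS, ← H.rss_eq hn hνlo hS'] at hl
    have h1 := hgain _ hR' (7 / 20) (by norm_num) hl
    rw [nodeWeight_eq_exp (by omega) hc hR, nodeWeight_eq_exp (by omega) hc hR',
      Real.rpow_def_of_pos hp', ← Real.exp_add, Real.exp_le_exp, hcard]
    have h2 : Real.log p * t ≤ 7 / 20 * (5 / 2 * (Cβ + 4 * h.c₂) * Real.log p) := by
      have : 0 ≤ (7 / 20 * (5 / 2 * (Cβ + 4 * h.c₂)) - t) * Real.log p :=
        mul_nonneg (by linarith) hlp.le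
      linarith
    linarith

theorem nodeWeight_pos {h : Hyper} (H : NodeRegular X j A T β ω u νlo νhi din) (hn : 0 < n)
    (hp : 0 < p) (hνlo : 0 < νlo) (hω : 0 < ω) (hc : 1 ≤ h.c₁ * √(1 + h.α / h.γ))
    {S : Finset (Fin p)} (hSA : S ⊆ A) (hS : S.card ≤ din) : 0 < nodeWeight h X j S := by
  rw [nodeWeight_eq_exp hp hc (H.rss_pos hn hνlo hω hSA hS)]
  exact Real.exp_pos _

end NodeRegular

end Scores

/-! ### The modified Cholesky decomposition and quadratic forms -/

section Cholesky

variable {p : ℕ} {S : Matrix (Fin p) (Fin p) ℝ} {σ : Equiv.Perm (Fin p)}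

theorem cholWeights_spec (hS : S.PosDef) (σ : Equiv.Perm (Fin p)) :
    ∃ ω, IsModifiedCholesky S σ (cholWeights S σ) ω := by
  have h := exists_isModifiedCholesky hS σ
  rw [cholWeights, dif_pos h]
  exact h.choose_spec

theorem mem_minimalIMap {i j : Fin p} : (i, j) ∈ minimalIMap S σ ↔ cholWeights S σ i j ≠ 0 := by
  simp [minimalIMap]

theorem mem_parents_minimalIMap {i j : Fin p} :
    i ∈ parents (minimalIMap S σ) j ↔ cholWeights S σ i j ≠ 0 := by
  rw [mem_parents, mem_minimalIMap]

theorem card_parents_le_maxDegIMap (j : Fin p) :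
    (parents (minimalIMap S σ) j).card ≤ maxDegIMap S σ :=
  (Finset.card_le_card Finset.subset_union_left).trans
    (Finset.le_sup (f := fun j => (parents (minimalIMap S σ) j ∪ children (minimalIMap S σ) j).card)
      (Finset.mem_univ j))

theorem card_children_le_maxDegIMap (j : Fin p) :
    (children (minimalIMap S σ) j).card ≤ maxDegIMap S σ :=
  (Finset.card_le_card Finset.subset_union_right).trans
    (Finset.le_sup (f := fun j => (parents (minimalIMap S σ) j ∪ children (minimalIMap S σ) j).card)
      (Finset.mem_univ j))

theorem maxDegIMap_le_maxDegAllIMaps : maxDegIMap S σ ≤ maxDegAllIMaps S :=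
  Finset.le_sup (f := fun σ : Equiv.Perm (Fin p) => maxDegIMap S σ) (Finset.mem_univ σ)

namespace IsModifiedCholesky

variable {B : Matrix (Fin p) (Fin p) ℝ} {ω : Fin p → ℝ}

/-- The noise of node `j` is uncorrelated with the predecessors of `j`. -/
theorem mulVec_col_eq_zero (hS : S.PosDef) (h : IsModifiedCholesky S σ B ω) {j k : Fin p}
    (hk : σ.symm k < σ.symm j) : (S *ᵥ (1 - B).col j) k = 0 := by
  rw [isModifiedCholesky_iff] at h
  obtain ⟨hB, -, h⟩ := h
  obtain ⟨ht, hd⟩ := one_sub_triangular σ B hB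
  have hu : IsUnit (1 - B).det := by simp [hd]
  have := Matrix.invertibleOfIsUnitDet _ hu
  have e : (1 - B)ᵀ * S = Matrix.diagonal ω * (1 - B)⁻¹ := by
    rw [← h, Matrix.mul_nonsing_inv_cancel_right _ _ hu]
  have e2 : ((1 - B)ᵀ * S : Matrix (Fin p) (Fin p) ℝ) j k = 0 := by
    rw [e, Matrix.diagonal_mul, Matrix.blockTriangular_inv_of_blockTriangular ht hk, mul_zero]
  rw [← e2, Matrix.mul_apply, Matrix.mulVec, dotProduct]
  refine Finset.sum_congr rfl fun i _ => ?_
  have := hS.isHermitian.apply k i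
  simp only [star_trivial] at this
  rw [Matrix.transpose_apply, Matrix.col_apply, this, mul_comm]

theorem col_quadForm (h : IsModifiedCholesky S σ B ω) (j : Fin p) :
    (1 - B).col j ⬝ᵥ S *ᵥ (1 - B).col j = ω j := by
  rw [isModifiedCholesky_iff] at h
  have := congrFun (congrFun h.2.2 j) j
  rw [Matrix.diagonal_apply_eq] at this
  rw [← this, Matrix.dotProduct_mulVec]
  rfl

/-- Pythagoras for the covariance inner product: the noise of `j` is orthogonal to combinations of
predecessors. -/
theorem quadForm_add (hS : S.PosDef) (h : IsModifiedCholesky S σ B ω) {j : Fin p}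
    {d : Fin p → ℝ} (hd : ∀ i, σ.symm j ≤ σ.symm i → d i = 0) :
    ((1 - B).col j + d) ⬝ᵥ S *ᵥ ((1 - B).col j + d) = ω j + d ⬝ᵥ S *ᵥ d := by
  have h1 : d ⬝ᵥ S *ᵥ (1 - B).col j = 0 := by
    rw [dotProduct]
    refine Finset.sum_eq_zero fun i _ => ?_
    rcases lt_or_ge (σ.symm i) (σ.symm j) with hi | hi
    · rw [h.mulVec_col_eq_zero hS hi, mul_zero]
    · rw [hd i hi, zero_mul]
  have h2 : (1 - B).col j ⬝ᵥ S *ᵥ d = 0 := by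
    have hT : Sᵀ = S := by
      rw [← Matrix.conjTranspose_eq_transpose_of_trivial]; exact hS.isHermitian
    rw [Matrix.dotProduct_mulVec, ← Matrix.mulVec_transpose, hT, dotProduct_comm, h1]
  rw [Matrix.mulVec_add, add_dotProduct, dotProduct_add, dotProduct_add, h1, h2, h.col_quadForm]
  ring

/-- No linear prediction from the predecessors beats the true coefficients, so `ω j` is the least
error variance. It bounds the empirical residuals from below, and at a unit vector it bounds `ω j`
by a diagonal entry of `S`. -/
theorem le_quadForm (hS : S.PosDef) (h : IsModifiedCholesky S σ B ω) {j : Fin p}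
    {v : Fin p → ℝ} (hj : v j = 1) (hv : ∀ i, σ.symm j < σ.symm i → v i = 0) :
    ω j ≤ v ⬝ᵥ S *ᵥ v := by
  have h1 := h.quadForm_add hS (j := j) (d := v - (1 - B).col j) (fun i hi => by
    rcases hi.eq_or_lt with he | hlt
    · obtain rfl := σ.symm.injective he
      simp [hj, h.1 j j le_rfl]
    · have : i ≠ j := by rintro rfl; exact lt_irrefl _ hlt
      simp [hv i hlt, h.1 i j hlt.le, this])
  rw [add_sub_cancel] at h1
  rw [h1]
  have := hS.posSemidef.dotProduct_mulVec_nonneg (v - (1 - B).col j)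
  simp only [star_trivial] at this
  linarith

end IsModifiedCholesky

theorem minimalIMap_mem_orderedDAGs (hS : S.PosDef) : minimalIMap S σ ∈ orderedDAGs σ := by
  obtain ⟨ω, h⟩ := cholWeights_spec hS σ
  refine mem_orderedDAGs.2 fun i j hij => ?_
  by_contra hcon
  exact mem_minimalIMap.1 hij (h.1 i j (not_lt.1 hcon))

theorem quadForm_bounds (hS : S.IsHermitian) {a b : ℝ}
    (h : ∀ i, a ≤ hS.eigenvalues i ∧ hS.eigenvalues i ≤ b) (v : Fin p → ℝ) :
    a * ∑ i, v i ^ 2 ≤ v ⬝ᵥ S *ᵥ v ∧ v ⬝ᵥ S *ᵥ v ≤ b * ∑ i, v i ^ 2 := by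
  set w : EuclideanSpace ℝ (Fin p) := WithLp.toLp 2 v with hw
  set c : Fin p → ℝ := fun i => inner ℝ (hS.eigenvectorBasis i) w with hc
  have h1 : ∑ i, v i ^ 2 = ∑ i, c i ^ 2 := by
    have := hS.eigenvectorBasis.sum_sq_inner_right w
    rw [hc, this, EuclideanSpace.norm_sq_eq]
    simp [hw]
  have h2 : v ⬝ᵥ S *ᵥ v = ∑ i, hS.eigenvalues i * c i ^ 2 := by
    have e1 : v ⬝ᵥ S *ᵥ v = inner ℝ (WithLp.toLp 2 (S *ᵥ v)) w := by
      simp [hw, EuclideanSpace.inner_eq_star_dotProduct]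
    rw [e1, ← hS.eigenvectorBasis.sum_inner_mul_inner]
    refine Finset.sum_congr rfl fun i _ => ?_
    have e2 : inner ℝ (WithLp.toLp 2 (S *ᵥ v)) (hS.eigenvectorBasis i) = hS.eigenvalues i * c i := by
      have e3 := hS.mulVec_eigenvectorBasis i
      have hT : Sᵀ = S := by
        rw [← Matrix.conjTranspose_eq_transpose_of_trivial]; exact hS
      rw [EuclideanSpace.inner_eq_star_dotProduct]
      simp only [star_trivial]
      rw [Matrix.dotProduct_mulVec, ← Matrix.mulVec_transpose, hT, e3, smul_dotProduct, smul_eq_mul,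
        hc]
      congr 1
      simp only
      rw [real_inner_comm, EuclideanSpace.inner_eq_star_dotProduct]
      simp [hw]
    rw [e2]; ring
  rw [h1, h2, Finset.mul_sum, Finset.mul_sum]
  exact ⟨Finset.sum_le_sum fun i _ => mul_le_mul_of_nonneg_right (h i).1 (sq_nonneg _),
    Finset.sum_le_sum fun i _ => mul_le_mul_of_nonneg_right (h i).2 (sq_nonneg _)⟩

end Cholesky

/-! ### Concentration of Gaussian sums of squares -/

section Gaussian

theorem gaussianPDFReal_mul_exp_sq (s x : ℝ) :
    gaussianPDFReal 0 1 x • Real.exp (s * (x ^ 2 - 1)) =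
      (√(2 * Real.pi))⁻¹ * Real.exp (-s) * Real.exp (-((1 - 2 * s) / 2) * x ^ 2) := by
  simp only [gaussianPDFReal, NNReal.coe_one, mul_one, sub_zero, smul_eq_mul]
  rw [mul_assoc, mul_assoc, ← Real.exp_add, ← Real.exp_add]
  congr 2
  ring

theorem integrable_exp_sq_gaussianReal {s : ℝ} (hs : s < 1 / 2) :
    Integrable (fun x => Real.exp (s * (x ^ 2 - 1))) (gaussianReal 0 1) := by
  rw [gaussianReal_of_var_ne_zero _ one_ne_zero, gaussianPDF_def,
    integrable_withDensity_iff_integrable_smul₀' (by fun_prop) (by simp)]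
  simp only [ENNReal.toReal_ofReal (gaussianPDFReal_nonneg 0 1 _), gaussianPDFReal_mul_exp_sq]
  exact (integrable_exp_neg_mul_sq (by linarith)).const_mul _

/-- The integral equals `exp (-s) / √(1 - 2 s)`. The inequality `log y ≥ 1 - 1 / y` at `y = 1 - 2 s`
bounds the exponent by `4 s²` in the stated range. -/
theorem integral_exp_sq_gaussianReal_le {s : ℝ} (hs : |s| ≤ 1 / 4) :
    ∫ x, Real.exp (s * (x ^ 2 - 1)) ∂(gaussianReal 0 1) ≤ Real.exp (4 * s ^ 2) := by
  obtain ⟨h1, h2⟩ := abs_le.1 hs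
  have hy : 0 < 1 - 2 * s := by linarith
  rw [integral_gaussianReal_eq_integral_smul one_ne_zero]
  simp only [gaussianPDFReal_mul_exp_sq]
  rw [integral_const_mul, integral_gaussian]
  have e : (√(2 * Real.pi))⁻¹ * Real.exp (-s) * √(Real.pi / ((1 - 2 * s) / 2)) =
      Real.exp (-s - Real.log (1 - 2 * s) / 2) := by
    have hpi := Real.pi_pos
    have e1 : Real.pi / ((1 - 2 * s) / 2) = 2 * Real.pi * (1 - 2 * s)⁻¹ := by field_simp
    have e2 : √((1 - 2 * s)⁻¹) = Real.exp (- Real.log (1 - 2 * s) / 2) := by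
      rw [Real.sqrt_eq_rpow, Real.rpow_def_of_pos (by positivity), Real.log_inv]
      congr 1; ring
    rw [e1, Real.sqrt_mul (by positivity : (0 : ℝ) ≤ 2 * Real.pi), e2, sub_eq_add_neg (-s), Real.exp_add, ← neg_div]
    have : √(2 * Real.pi) ≠ 0 := by positivity
    field_simp
  rw [e, Real.exp_le_exp]
  have h3 := Real.one_sub_inv_le_log_of_pos hy
  have h4 : (1 - 2 * s)⁻¹ ≤ 1 + 2 * s + 8 * s ^ 2 := by
    rw [inv_le_iff_one_le_mul₀ hy]
    nlinarith [mul_nonneg (sq_nonneg s) (by linarith : (0 : ℝ) ≤ 1 - 4 * s)]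
  nlinarith

variable {E : Type*} [MeasurableSpace E]

/-- Concentration of the sum of squares of independent standard Gaussian variables. -/
theorem measure_pi_le_abs_sum_sq_sub (ν : Measure E) [IsProbabilityMeasure ν] {f : E → ℝ}
    (hf : Measurable f) (hmap : ν.map f = gaussianReal 0 1) {η : ℝ} (hη0 : 0 < η) (hη1 : η ≤ 1)
    (n : ℕ) :
    (Measure.pi fun _ : Fin n => ν).real {x | η * n ≤ |∑ i, f (x i) ^ 2 - n|} ≤
      2 * Real.exp (-(η ^ 2 / 16 * n)) := by
  set μ := Measure.pi fun _ : Fin n => ν with hμ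
  set Y : (Fin n → E) → ℝ := fun x => ∑ i, (f (x i) ^ 2 - 1) with hY
  have hexp : ∀ s x, Real.exp (s * Y x) = ∏ i, Real.exp (s * (f (x i) ^ 2 - 1)) := fun s x => by
    rw [hY, Finset.mul_sum, Real.exp_sum]
  have hrow : ∀ s < 1 / 2, Integrable (fun z => Real.exp (s * (f z ^ 2 - 1))) ν := fun s hs => by
    have := integrable_exp_sq_gaussianReal hs
    rw [← hmap] at this
    exact this.comp_measurable hf
  have hint : ∀ s < 1 / 2, Integrable (fun x => Real.exp (s * Y x)) μ := fun s hs => by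
    simp only [hexp]
    exact Integrable.fintype_prod (f := fun _ z => Real.exp (s * (f z ^ 2 - 1))) fun _ => hrow s hs
  have hmgf : ∀ s, |s| ≤ 1 / 4 → mgf Y μ s ≤ Real.exp (4 * s ^ 2 * n) := fun s hs => by
    simp only [mgf, hexp]
    rw [hμ, integral_fintype_prod_eq_pow (fun z => Real.exp (s * (f z ^ 2 - 1))), Fintype.card_fin]
    have : ∫ z, Real.exp (s * (f z ^ 2 - 1)) ∂ν ≤ Real.exp (4 * s ^ 2) := by
      refine le_trans (le_of_eq ?_) (integral_exp_sq_gaussianReal_le hs)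
      rw [← hmap, integral_map hf.aemeasurable (by fun_prop)]
    calc _ ≤ Real.exp (4 * s ^ 2) ^ n :=
          pow_le_pow_left₀ (integral_nonneg fun _ => (Real.exp_pos _).le) this n
      _ = _ := by rw [← Real.exp_nat_mul]; congr 1; ring
  have h8 : |η / 8| ≤ 1 / 4 := by rw [abs_of_pos (by positivity)]; linarith
  have h8' : |-(η / 8)| ≤ 1 / 4 := by rwa [abs_neg]
  -- Chernoff at `±η / 8`, which minimizes `-s η + 4 s²` and its mirror image; the exponent is `-η²
  -- n / 16`.
  have hup := measure_ge_le_exp_mul_mgf (μ := μ) (X := Y) (η * n) (t := η / 8) (by positivity)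
    (hint _ (by linarith))
  have hlo := measure_le_le_exp_mul_mgf (μ := μ) (X := Y) (-(η * n)) (t := -(η / 8))
    (by linarith) (hint _ (by linarith))
  have hval : Real.exp (-(η / 8) * (η * n)) * Real.exp (4 * (η / 8) ^ 2 * n) =
      Real.exp (-(η ^ 2 / 16 * n)) := by
    rw [← Real.exp_add]; congr 1; ring
  have hup' : μ.real {x | η * n ≤ Y x} ≤ Real.exp (-(η ^ 2 / 16 * n)) := by
    rw [← hval]; refine hup.trans ?_
    gcongr; exact hmgf _ h8
  have hlo' : μ.real {x | Y x ≤ -(η * n)} ≤ Real.exp (-(η ^ 2 / 16 * n)) := by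
    rw [← hval]; refine hlo.trans ?_
    have e : - -(η / 8) * -(η * n) = -(η / 8) * (η * n) := by ring
    rw [e]
    have := hmgf _ h8'
    rw [neg_sq] at this
    gcongr
  have hsub : {x : Fin n → E | η * n ≤ |∑ i, f (x i) ^ 2 - n|} ⊆
      {x | η * n ≤ Y x} ∪ {x | Y x ≤ -(η * n)} := by
    intro x hx
    have e : Y x = ∑ i, f (x i) ^ 2 - n := by simp [hY, Finset.sum_sub_distrib]
    simp only [Set.mem_ofPred_eq] at hx
    rw [← e] at hx
    rcases le_abs.1 hx with h | h
    · exact Or.inl h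
    · exact Or.inr (by simp only [Set.mem_ofPred_eq]; linarith)
  calc μ.real _ ≤ μ.real ({x | η * n ≤ Y x} ∪ {x | Y x ≤ -(η * n)}) := measureReal_mono hsub
    _ ≤ _ := measureReal_union_le _ _
    _ ≤ _ := by linarith

/-! ### Gaussian noise in a random direction -/

/-- For a fixed direction the projection is Gaussian with variance `ω * ∑ y i ^ 2`, and both tails
are bounded by Chernoff. The strict inequality makes the event empty when `y = 0`, which is why no
nondegeneracy of the direction is needed. -/
theorem measure_pi_gaussianReal_lt_sq_sum {n : ℕ} (ω : NNReal) (hω : 0 < ω) {u : ℝ} (hu : 0 ≤ u)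
    (y : Fin n → ℝ) :
    (Measure.pi fun _ : Fin n => gaussianReal 0 ω).real
      {e | ω * u * ∑ i, y i ^ 2 < (∑ i, y i * e i) ^ 2} ≤ 2 * Real.exp (-(u / 2)) := by
  set μ := Measure.pi fun _ : Fin n => gaussianReal 0 ω with hμ
  set N := ∑ i, y i ^ 2 with hN
  have hN0 : 0 ≤ N := Finset.sum_nonneg fun i _ => sq_nonneg _
  rcases hN0.eq_or_lt with h0 | hNpos
  · have hy : ∀ i, y i = 0 := fun i => pow_eq_zero_iff two_ne_zero |>.1
      ((Finset.sum_eq_zero_iff_of_nonneg fun i _ => sq_nonneg _).1 h0.symm i (Finset.mem_univ i))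
    have : {e : Fin n → ℝ | ω * u * N < (∑ i, y i * e i) ^ 2} = ∅ := by
      ext e; simp [hy, ← h0]
    rw [this]; simp; positivity
  have hω' : (0 : ℝ) < ω := hω
  set Y : (Fin n → ℝ) → ℝ := fun e => ∑ i, y i * e i with hY
  have hexp : ∀ s e, Real.exp (s * Y e) = ∏ i, Real.exp (s * y i * e i) := fun s e => by
    rw [hY, Finset.mul_sum, Real.exp_sum]
    exact Finset.prod_congr rfl fun i _ => by rw [mul_assoc]
  have hint : ∀ s, Integrable (fun x => Real.exp (s * Y x)) μ := fun s => by
    simp only [hexp]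
    exact Integrable.fintype_prod (f := fun i z => Real.exp (s * y i * z))
      fun i => integrable_exp_mul_gaussianReal _
  have hmgf : ∀ s, mgf Y μ s = Real.exp (ω * s ^ 2 * N / 2) := fun s => by
    simp only [mgf, hexp]
    rw [hμ, integral_fintype_prod_eq_prod (fun i z => Real.exp (s * y i * z))]
    have : ∀ i, ∫ z, Real.exp (s * y i * z) ∂(gaussianReal 0 ω) =
        Real.exp (ω * (s * y i) ^ 2 / 2) := fun i => by
      have := congrFun (mgf_id_gaussianReal (μ := 0) (v := ω)) (s * y i)
      simpa [mgf] using this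
    simp only [this]
    rw [← Real.exp_sum]
    congr 1
    rw [hN, Finset.mul_sum, Finset.sum_div]
    exact Finset.sum_congr rfl fun i _ => by ring
  set c := √(ω * u * N) with hc
  have hc2 : c ^ 2 = ω * u * N := Real.sq_sqrt (by positivity)
  have hc0 : 0 ≤ c := Real.sqrt_nonneg _
  have hval : Real.exp (-(c / (ω * N)) * c) * Real.exp (ω * (c / (ω * N)) ^ 2 * N / 2) =
      Real.exp (-(u / 2)) := by
    rw [← Real.exp_add]; congr 1
    rw [div_pow, hc2, neg_mul, div_mul_eq_mul_div, ← sq, hc2]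
    field_simp; ring
  have hup := measure_ge_le_exp_mul_mgf (μ := μ) (X := Y) c (t := c / (ω * N)) (by positivity)
    (hint _)
  have hlo := measure_le_le_exp_mul_mgf (μ := μ) (X := Y) (-c) (t := -(c / (ω * N)))
    (neg_nonpos.2 (by positivity)) (hint _)
  rw [hmgf, hval] at hup
  rw [hmgf, neg_sq, neg_mul_neg, hval] at hlo
  have hsub : {e : Fin n → ℝ | ω * u * N < (∑ i, y i * e i) ^ 2} ⊆
      {x | c ≤ Y x} ∪ {x | Y x ≤ -c} := by
    intro e he
    simp only [Set.mem_ofPred_eq] at he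
    rw [← hc2] at he
    rcases le_abs.1 ((abs_of_nonneg hc0 ▸ sq_lt_sq.1 he).le) with h | h
    · exact Or.inl h
    · exact Or.inr (by simp only [Set.mem_ofPred_eq, hY]; linarith)
  calc μ.real _ ≤ μ.real ({x | c ≤ Y x} ∪ {x | Y x ≤ -c}) := measureReal_mono hsub
    _ ≤ _ := measureReal_union_le _ _
    _ ≤ _ := by linarith

/-- Gaussian noise that is independent of the direction `y` onto which it is projected. -/
theorem measure_pi_lt_sq_sum_of_indepFun {F : Type*} [MeasurableSpace F] {ν : Measure E}
    [IsProbabilityMeasure ν] {f : E → F} {e : E → ℝ} (hf : Measurable f) (he : Measurable e)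
    (hind : IndepFun f e ν) {ω : NNReal} (hω : 0 < ω) (hmap : ν.map e = gaussianReal 0 ω)
    {n : ℕ} {y : (Fin n → F) → Fin n → ℝ} (hy : Measurable y) {u : ℝ} (hu : 0 ≤ u) :
    (Measure.pi fun _ : Fin n => ν).real
      {x | ω * u * ∑ i, y (fun a => f (x a)) i ^ 2 <
        (∑ i, y (fun a => f (x a)) i * e (x i)) ^ 2} ≤ 2 * Real.exp (-(u / 2)) := by
  have : IsProbabilityMeasure (ν.map f) := Measure.isProbabilityMeasure_map hf.aemeasurable
  set D : Set ((Fin n → F) × (Fin n → ℝ)) :=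
    {z | ω * u * ∑ i, y z.1 i ^ 2 < (∑ i, y z.1 i * z.2 i) ^ 2} with hD
  have hy' : ∀ i, Measurable fun z : (Fin n → F) × (Fin n → ℝ) => y z.1 i := fun i =>
    (measurable_pi_apply i).comp (hy.comp measurable_fst)
  have hDm : MeasurableSet D := by
    refine measurableSet_lt ?_ ?_
    · exact Measurable.const_mul (Finset.measurable_sum _ fun i _ => (hy' i).pow_const 2) _
    · exact (Finset.measurable_sum _ fun i _ =>
        (hy' i).mul ((measurable_pi_apply i).comp measurable_snd)).pow_const 2
  -- The rows factor into the data that determine the direction and the noise; by Fubini the bound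
  -- for fixed directions applies on each slice.
  have hlaw : MeasurePreserving (fun x : Fin n → E => (fun a => f (x a), fun a => e (x a)))
      (Measure.pi fun _ : Fin n => ν)
      ((Measure.pi fun _ : Fin n => ν.map f).prod (Measure.pi fun _ : Fin n => gaussianReal 0 ω)) := by
    have h1 : MeasurePreserving (fun z : E => (f z, e z)) ν ((ν.map f).prod (gaussianReal 0 ω)) :=
      ⟨hf.prodMk he, by
        rw [(indepFun_iff_map_prod_eq_prod_map_map hf.aemeasurable he.aemeasurable).1 hind, hmap]⟩
    have h2 := measurePreserving_pi (fun _ : Fin n => ν)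
      (fun _ : Fin n => (ν.map f).prod (gaussianReal 0 ω)) (fun _ => h1)
    exact (measurePreserving_arrowProdEquivProdArrow F ℝ (Fin n) (fun _ => ν.map f)
      (fun _ => gaussianReal 0 ω)).comp h2
  have h1 := hlaw.measure_preimage hDm.nullMeasurableSet
  have h2 : ((Measure.pi fun _ : Fin n => ν.map f).prod
      (Measure.pi fun _ : Fin n => gaussianReal 0 ω)) D ≤
        ENNReal.ofReal (2 * Real.exp (-(u / 2))) := by
    rw [Measure.prod_apply hDm]
    calc _ ≤ ∫⁻ _, ENNReal.ofReal (2 * Real.exp (-(u / 2)))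
          ∂(Measure.pi fun _ : Fin n => ν.map f) := by
          refine lintegral_mono fun a => ?_
          have := measure_pi_gaussianReal_lt_sq_sum ω hω hu (y a)
          rw [measureReal_def] at this
          exact (ENNReal.le_ofReal_iff_toReal_le (measure_ne_top _ _) (by positivity)).2 this
      _ = _ := by simp
  rw [← h1] at h2
  exact ENNReal.toReal_le_of_le_ofReal (by positivity) h2

end Gaussian

/-! ### Linear functionals of a row of the data -/

section Rows

open scoped RealInnerProductSpace

variable {p : ℕ} {S : Matrix (Fin p) (Fin p) ℝ}

theorem inner_toLp_eq_sum (v : Fin p → ℝ) (x : EuclideanSpace ℝ (Fin p)) :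
    ⟪WithLp.toLp 2 v, x⟫ = ∑ i, v i * x i := by
  simp [PiLp.inner_apply, mul_comm]

theorem measurable_sum_mul (v : Fin p → ℝ) :
    Measurable fun x : EuclideanSpace ℝ (Fin p) => ∑ i, v i * x i := by
  fun_prop

theorem map_sum_mul_multivariateGaussian (hS : S.PosSemidef) (v : Fin p → ℝ) :
    (multivariateGaussian 0 S).map (fun x => ∑ i, v i * x i) =
      gaussianReal 0 (v ⬝ᵥ S *ᵥ v).toNNReal := by
  have h1 := IsGaussian.map_eq_gaussianReal (μ := multivariateGaussian 0 S)
    (innerSL ℝ (WithLp.toLp 2 v))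
  have e : (innerSL ℝ (WithLp.toLp 2 v) : EuclideanSpace ℝ (Fin p) → ℝ) =
      fun x => ∑ i, v i * x i := by
    ext x; rw [innerSL_apply_apply, inner_toLp_eq_sum]
  have h2 : Var[innerSL ℝ (WithLp.toLp 2 v); multivariateGaussian 0 S] = v ⬝ᵥ S *ᵥ v := by
    have := covarianceBilin_self (μ := multivariateGaussian 0 S) IsGaussian.memLp_two_id
      (WithLp.toLp 2 v)
    rw [covarianceBilin_multivariateGaussian hS] at this
    exact this.symm
  have h3 : ∫ x, innerSL ℝ (WithLp.toLp 2 v) x ∂(multivariateGaussian 0 S) = 0 := by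
    rw [ContinuousLinearMap.integral_comp_comm _ IsGaussian.integrable_fun_id]
    simp
  rw [h2, h3, e] at h1
  exact h1

theorem covariance_sum_mul_multivariateGaussian (hS : S.PosSemidef) (v w : Fin p → ℝ) :
    cov[fun x => ∑ i, v i * x i, fun x => ∑ i, w i * x i; multivariateGaussian 0 S] =
      v ⬝ᵥ S *ᵥ w := by
  have := covarianceBilin_apply_eq_cov (μ := multivariateGaussian 0 S) IsGaussian.memLp_two_id
    (WithLp.toLp 2 v) (WithLp.toLp 2 w)
  rw [covarianceBilin_multivariateGaussian hS] at this
  simp only [inner_toLp_eq_sum] at this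
  exact this.symm

/-- The noise of node `j` is independent of the predecessors of `j`. -/
theorem IsModifiedCholesky.indepFun {σ : Equiv.Perm (Fin p)} {B : Matrix (Fin p) (Fin p) ℝ}
    {ω : Fin p → ℝ} (hS : S.PosDef) (h : IsModifiedCholesky S σ B ω) (j : Fin p) :
    IndepFun (fun (x : EuclideanSpace ℝ (Fin p)) a => if σ.symm a < σ.symm j then x a else 0)
      (fun x => ∑ i, (1 - B).col j i * x i) (multivariateGaussian 0 S) := by
  have hproj : ∀ a, (fun x : EuclideanSpace ℝ (Fin p) => if σ.symm a < σ.symm j then x a else 0) =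
      fun x => ∑ i, (if σ.symm a < σ.symm j then (Pi.single a 1 : Fin p → ℝ) else 0) i * x i := by
    intro a; ext x
    split_ifs
    · simp [Pi.single_apply]
    · simp
  -- The predecessors and the noise are a joint linear image of a Gaussian vector, so vanishing
  -- covariances give independence.
  have key := HasGaussianLaw.indepFun_of_covariance_eval (P := multivariateGaussian 0 S)
    (X := fun a (x : EuclideanSpace ℝ (Fin p)) => if σ.symm a < σ.symm j then x a else 0)
    (Y := fun (_ : Unit) (x : EuclideanSpace ℝ (Fin p)) => ∑ i, (1 - B).col j i * x i) ?_ ?_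
  · exact key.comp (φ := id) (ψ := fun y : Unit → ℝ => y ()) measurable_id (measurable_pi_apply ())
  · have hL : IsLinearMap ℝ (fun x : EuclideanSpace ℝ (Fin p) =>
        ((fun a => if σ.symm a < σ.symm j then x a else 0 : Fin p → ℝ),
          (fun _ => ∑ i, (1 - B).col j i * x i : Unit → ℝ))) := by
      constructor
      · intro x y
        ext a
        · simp only [Prod.fst_add, Pi.add_apply, PiLp.add_apply]; split_ifs <;> simp
        · simp [mul_add, Finset.sum_add_distrib]
      · intro c x
        ext a
        · simp only [Prod.smul_fst, Pi.smul_apply, PiLp.smul_apply]; split_ifs <;> simp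
        · simp only [Prod.smul_snd, Pi.smul_apply, PiLp.smul_apply, smul_eq_mul, Finset.mul_sum]
          exact Finset.sum_congr rfl fun i _ => by ring
    exact (IsGaussian.hasGaussianLaw_id (μ := multivariateGaussian 0 S)).map_fun
      (LinearMap.toContinuousLinearMap (hL.mk' _))
  · intro a _
    rw [hproj, covariance_sum_mul_multivariateGaussian hS.posSemidef]
    split_ifs with ha
    · rw [single_one_dotProduct]
      exact h.mulVec_col_eq_zero hS ha
    · rw [zero_dotProduct]

end Rows

/-! ### The noise event -/

section Noise

open scoped RealInnerProductSpace

variable {n p : ℕ} {S : Matrix (Fin p) (Fin p) ℝ}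

instance isProbabilityMeasure_dataLaw (n : ℕ) (S : Matrix (Fin p) (Fin p) ℝ) :
    IsProbabilityMeasure (dataLaw n S) := by
  unfold dataLaw; infer_instance

theorem continuous_det_gram_resid (T : Finset (Fin p)) (k : Fin p) :
    Continuous fun X : Fin n → Fin p → ℝ =>
      ((cols (Matrix.of X) T)ᵀ * cols (Matrix.of X) T).det • (Matrix.of X).col k -
        (cols (Matrix.of X) T * ((cols (Matrix.of X) T)ᵀ * cols (Matrix.of X) T).adjugate *
          (cols (Matrix.of X) T)ᵀ) *ᵥ (Matrix.of X).col k := by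
  have h1 : Continuous fun X : Fin n → Fin p → ℝ => cols (Matrix.of X) T :=
    (continuous_id : Continuous fun X : Matrix (Fin n) (Fin p) ℝ => X).matrix_submatrix _ _
  have h2 : Continuous fun X : Fin n → Fin p → ℝ => (Matrix.of X).col k := by
    refine continuous_pi fun i => ?_
    simp only [Matrix.col_apply, Matrix.of_apply]
    fun_prop
  have h3 := h1.matrix_transpose.matrix_mul h1
  exact (h3.matrix_det.smul h2).sub
    (((h1.matrix_mul h3.matrix_adjugate).matrix_mul h1.matrix_transpose).matrix_mulVec h2)

/-- The residual of column `k` on `T` depends only on columns that precede `j`, and these are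
independent of the noise of `j`. Restricting to invertible Gram matrices allows the residual to be
replaced by its polynomial multiple, which is measurable; the factor `g ^ 2` cancels. -/
theorem IsModifiedCholesky.measure_noise_le {σ : Equiv.Perm (Fin p)}
    {B : Matrix (Fin p) (Fin p) ℝ} {ω : Fin p → ℝ} (hS : S.PosDef)
    (h : IsModifiedCholesky S σ B ω) {j k : Fin p} {T : Finset (Fin p)}
    (hT : ∀ i ∈ T, σ.symm i < σ.symm j) (hk : σ.symm k < σ.symm j) {u : ℝ} (hu : 0 ≤ u) :
    (dataLaw n S).real {x | IsUnit ((cols (dataMatrix x) T)ᵀ * cols (dataMatrix x) T).det ∧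
      ω j * u * ‖resid (colVec (dataMatrix x)) T (colVec (dataMatrix x) k)‖ ^ 2 <
        ⟪resid (colVec (dataMatrix x)) T (colVec (dataMatrix x) k),
          ∑ i, (1 - B).col j i • colVec (dataMatrix x) i⟫ ^ 2} ≤ 2 * Real.exp (-(u / 2)) := by
  have hω : 0 < ω j := h.2.1 j
  have key := measure_pi_lt_sq_sum_of_indepFun (ν := multivariateGaussian 0 S)
    (f := fun (x : EuclideanSpace ℝ (Fin p)) a => if σ.symm a < σ.symm j then x a else 0)
    (e := fun x => ∑ i, (1 - B).col j i * x i)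
    (measurable_pi_lambda _ fun a => by split_ifs <;> fun_prop) (measurable_sum_mul _)
    (h.indepFun hS j) (ω := (ω j).toNNReal) (Real.toNNReal_pos.2 hω)
    (by rw [map_sum_mul_multivariateGaussian hS.posSemidef, h.col_quadForm])
    (continuous_det_gram_resid (n := n) T k).measurable hu
  refine le_trans (measureReal_mono ?_) key
  rintro x ⟨hunit, hx⟩
  simp only [Set.mem_ofPred_eq]
  -- Masking the columns that do not precede `j` leaves those in `T` and column `k` intact, so the
  -- direction is a function of the masked data.
  set X' : Matrix (Fin n) (Fin p) ℝ :=
    Matrix.of fun a b => if σ.symm b < σ.symm j then x a b else 0 with hX'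
  have e1 : cols X' T = cols (dataMatrix x) T := by
    ext a ⟨b, hb⟩
    simp [cols, hX', dataMatrix, hT b hb]
  have e2 : X'.col k = (dataMatrix x).col k := by
    ext a
    simp [hX', dataMatrix, hk]
  rw [e1, e2]
  set g := ((cols (dataMatrix x) T)ᵀ * cols (dataMatrix x) T).det with hg
  have e3 := det_smul_resid_colVec hunit k
  rw [← hg] at e3
  set y := g • (dataMatrix x).col k - (cols (dataMatrix x) T *
    ((cols (dataMatrix x) T)ᵀ * cols (dataMatrix x) T).adjugate * (cols (dataMatrix x) T)ᵀ) *ᵥ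
      (dataMatrix x).col k with hy
  set r := resid (colVec (dataMatrix x)) T (colVec (dataMatrix x) k) with hr
  have hg0 : 0 < g ^ 2 := by have := hunit.ne_zero; positivity
  have e4 : ∑ i, y i ^ 2 = g ^ 2 * ‖r‖ ^ 2 := by
    have : ‖WithLp.toLp 2 y‖ ^ 2 = ∑ i, y i ^ 2 := by simp [EuclideanSpace.norm_sq_eq]
    rw [← this, ← e3, norm_smul, mul_pow, Real.norm_eq_abs, sq_abs]
  have e5 : ∑ i, y i * ∑ a, (1 - B).col j a * x i a =
      g * ⟪r, ∑ i, (1 - B).col j i • colVec (dataMatrix x) i⟫ := by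
    have : ⟪WithLp.toLp 2 y, ∑ i, (1 - B).col j i • colVec (dataMatrix x) i⟫ =
        ∑ i, y i * ∑ a, (1 - B).col j a * x i a := by
      rw [sum_smul_colVec, PiLp.inner_apply]
      refine Finset.sum_congr rfl fun i _ => ?_
      simp [Matrix.mulVec, dotProduct, dataMatrix, mul_comm]
    rw [← this, ← e3, inner_smul_left, conj_trivial]
  rw [e4, e5, Real.coe_toNNReal _ hω.le, mul_pow]
  calc ω j * u * (g ^ 2 * ‖r‖ ^ 2) = g ^ 2 * (ω j * u * ‖r‖ ^ 2) := by ring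
    _ < _ := mul_lt_mul_of_pos_left hx hg0

end Noise

/-! ### Nets and bilinear forms -/

section Nets

variable {E : Type*} [NormedAddCommGroup E] [NormedSpace ℝ E] [FiniteDimensional ℝ E]

/-- A maximal 1-separated subset of the ball of radius 2 is a net, and the packing bound limits its
size by `5 ^ dim`. -/
theorem exists_net (E : Type*) [NormedAddCommGroup E] [NormedSpace ℝ E] [FiniteDimensional ℝ E] :
    ∃ N : Finset E, N.card ≤ 5 ^ Module.finrank ℝ E ∧ (∀ c ∈ N, ‖c‖ ≤ 2) ∧
      ∀ y : E, ‖y‖ ≤ 2 → ∃ c ∈ N, ‖y - c‖ ≤ 1 := by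
  classical
  set P : ℕ → Prop := fun k => ∃ s : Finset E, (∀ c ∈ s, ‖c‖ ≤ 2) ∧
    (∀ c ∈ s, ∀ d ∈ s, c ≠ d → 1 ≤ ‖c - d‖) ∧ s.card = k with hP
  have hP0 : P 0 := ⟨∅, by simp, by simp, rfl⟩
  have hbd : ∀ k, P k → k ≤ 5 ^ Module.finrank ℝ E := by
    rintro k ⟨s, h1, h2, rfl⟩
    exact Besicovitch.card_le_of_separated s h1 h2
  obtain ⟨N, h1, h2, h3⟩ := Nat.findGreatest_spec (P := P) (Nat.zero_le (5 ^ Module.finrank ℝ E)) hP0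
  refine ⟨N, hbd _ ⟨N, h1, h2, rfl⟩, h1, fun y hy => ?_⟩
  by_contra! hcon
  have hyN : y ∉ N := fun h => by have := hcon y h; simp at this; linarith
  have hnew : P (N.card + 1) := by
    refine ⟨insert y N, fun c hc => ?_, fun c hc d hd hcd => ?_, Finset.card_insert_of_notMem hyN⟩
    · rcases Finset.mem_insert.1 hc with rfl | hc
      · exact hy
      · exact h1 c hc
    · rcases Finset.mem_insert.1 hc with hc | hc <;> rcases Finset.mem_insert.1 hd with hd | hd
      · exact absurd (hc.trans hd.symm) hcd
      · rw [hc]; exact (hcon d hd).le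
      · rw [hd, norm_sub_rev]; exact (hcon c hc).le
      · exact h2 c hc d hd hcd
  have := Nat.le_findGreatest (hbd _ hnew) hnew
  omega

theorem abs_le_of_abs_le_on_net {N : Finset E} (hN : ∀ y : E, ‖y‖ ≤ 2 → ∃ c ∈ N, ‖y - c‖ ≤ 1)
    (f : E →ₗ[ℝ] ℝ) {c : ℝ} (hc : 0 ≤ c) (h : ∀ x ∈ N, |f x| ≤ c) (x : E) : |f x| ≤ c * ‖x‖ := by
  set F := LinearMap.toContinuousLinearMap f with hF
  have hFx : ∀ x, F x = f x := fun x => rfl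
  -- A vector rescaled to norm 2 is a net point plus an error of norm at most 1, so `2 ‖F‖ ≤ c +
  -- ‖F‖`. Radius 2 with mesh 1 makes the final constant exactly `c`.
  have h1 : ‖F‖ ≤ (c + ‖F‖) / 2 := by
    refine F.opNorm_le_bound (by positivity) fun x => ?_
    rcases eq_or_ne x 0 with rfl | hx
    · simp
    have hx' : 0 < ‖x‖ := norm_pos_iff.2 hx
    set y := (2 / ‖x‖) • x with hy
    have hy2 : ‖y‖ ≤ 2 := by
      rw [hy, norm_smul, Real.norm_eq_abs, abs_of_pos (by positivity), div_mul_cancel₀ _ hx'.ne']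
    obtain ⟨z, hz, hyz⟩ := hN y hy2
    have h2 : ‖F y‖ ≤ c + ‖F‖ := by
      have e : F y = F z + F (y - z) := by rw [map_sub]; ring
      rw [e]
      refine (norm_add_le _ _).trans (add_le_add (h z hz) ?_)
      exact (F.le_opNorm _).trans (mul_le_of_le_one_right (norm_nonneg _) hyz)
    have e2 : F x = (‖x‖ / 2) * F y := by
      rw [hy, map_smul, smul_eq_mul]; field_simp
    rw [e2, norm_mul, Real.norm_eq_abs (‖x‖ / 2), abs_of_pos (by positivity)]
    calc ‖x‖ / 2 * ‖F y‖ ≤ ‖x‖ / 2 * (c + ‖F‖) := by gcongr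
      _ = _ := by ring
  have h2 : ‖F‖ ≤ c := by linarith
  calc |f x| = ‖F x‖ := rfl
    _ ≤ ‖F‖ * ‖x‖ := F.le_opNorm x
    _ ≤ c * ‖x‖ := by gcongr

theorem bilin_abs_le_of_abs_le_on_net {N : Finset E}
    (hN : ∀ y : E, ‖y‖ ≤ 2 → ∃ c ∈ N, ‖y - c‖ ≤ 1) (β : E →ₗ[ℝ] E →ₗ[ℝ] ℝ) {c : ℝ} (hc : 0 ≤ c)
    (h : ∀ x ∈ N, ∀ y ∈ N, |β x y| ≤ c) (x y : E) : |β x y| ≤ c * ‖x‖ * ‖y‖ := by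
  have h1 : ∀ x ∈ N, ∀ y, |β.flip y x| ≤ c * ‖y‖ := fun x hx y =>
    abs_le_of_abs_le_on_net hN (β x) hc (h x hx) y
  have := abs_le_of_abs_le_on_net hN (β.flip y) (by positivity : 0 ≤ c * ‖y‖)
    (fun x hx => h1 x hx y) x
  rw [LinearMap.flip_apply] at this
  linarith

end Nets

/-! ### Restricted isometry of Gaussian data -/

section Isometry

open scoped RealInnerProductSpace

variable {n p : ℕ} {S : Matrix (Fin p) (Fin p) ℝ}

/-- In the coordinates `C v` the quadratic form of `S` is the Euclidean norm. Nets taken there give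
a deviation bound relative to `S`, with no condition number in it. -/
theorem exists_transpose_mul_self_eq (hS : S.PosDef) :
    ∃ C : Matrix (Fin p) (Fin p) ℝ, IsUnit C.det ∧ Cᵀ * C = S := by
  obtain ⟨B, ω, hB, hω, h⟩ := exists_isModifiedCholesky hS (Equiv.refl _)
  have hC : (Matrix.diagonal (fun i => √(ω i)) * (1 - B)⁻¹)ᵀ *
      (Matrix.diagonal (fun i => √(ω i)) * (1 - B)⁻¹) = S := by
    rw [← h, Matrix.transpose_mul, Matrix.diagonal_transpose, Matrix.transpose_nonsing_inv,
      Matrix.transpose_sub, Matrix.transpose_one, Matrix.mul_assoc,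
      ← Matrix.mul_assoc (Matrix.diagonal _), Matrix.diagonal_mul_diagonal, ← Matrix.mul_assoc]
    simp only [Real.mul_self_sqrt (hω _).le]
  refine ⟨_, ?_, hC⟩
  have h1 := hS.det_pos
  rw [← hC, Matrix.det_mul, Matrix.det_transpose] at h1
  exact isUnit_iff_ne_zero.2 fun h0 => by rw [h0] at h1; simp at h1

theorem sum_sq_eq_norm_sq (x : Fin n → EuclideanSpace ℝ (Fin p)) (v : Fin p → ℝ) :
    ∑ a, (∑ i, v i * x a i) ^ 2 = ‖∑ i, v i • colVec (dataMatrix x) i‖ ^ 2 := by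
  rw [sum_smul_colVec, EuclideanSpace.norm_sq_eq]
  refine Finset.sum_congr rfl fun a _ => ?_
  simp [Matrix.mulVec, dotProduct, dataMatrix, mul_comm]

/-- Scaling `v` to unit variance makes its product with each row standard normal. For `v = 0` the
event is empty since the inequality is strict. -/
theorem measure_quadForm_deviation_le (hS : S.PosDef) (v : Fin p → ℝ) {η : ℝ} (hη0 : 0 < η)
    (hη1 : η ≤ 1) :
    (dataLaw n S).real {x | η * (n * (v ⬝ᵥ S *ᵥ v)) <
      |‖∑ i, v i • colVec (dataMatrix x) i‖ ^ 2 - n * (v ⬝ᵥ S *ᵥ v)|} ≤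
        2 * Real.exp (-(η ^ 2 / 16 * n)) := by
  rcases eq_or_ne v 0 with rfl | hv
  · have : {x : Fin n → EuclideanSpace ℝ (Fin p) | η * (n * ((0 : Fin p → ℝ) ⬝ᵥ S *ᵥ 0)) <
      |‖∑ i, (0 : Fin p → ℝ) i • colVec (dataMatrix x) i‖ ^ 2 -
        n * ((0 : Fin p → ℝ) ⬝ᵥ S *ᵥ 0)|} = ∅ := by
      ext x; simp
    rw [this, measureReal_empty]; positivity
  have hs : 0 < v ⬝ᵥ S *ᵥ v := by simpa using hS.dotProduct_mulVec_pos hv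
  set s := v ⬝ᵥ S *ᵥ v with hsdef
  set w : Fin p → ℝ := (√s)⁻¹ • v with hw
  have hws : w ⬝ᵥ S *ᵥ w = 1 := by
    rw [hw, Matrix.mulVec_smul, smul_dotProduct, dotProduct_smul, ← hsdef, smul_eq_mul, smul_eq_mul,
      ← mul_assoc, ← mul_inv, Real.mul_self_sqrt hs.le, inv_mul_cancel₀ hs.ne']
  have key := measure_pi_le_abs_sum_sq_sub (multivariateGaussian 0 S)
    (f := fun x => ∑ i, w i * x i) (measurable_sum_mul w)
    (by rw [map_sum_mul_multivariateGaussian hS.posSemidef, hws]; simp) hη0 hη1 n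
  refine le_trans (measureReal_mono (μ := dataLaw n S) ?_) key
  intro x hx
  simp only [Set.mem_ofPred_eq] at hx ⊢
  have e : ∑ a, (∑ i, w i * x a i) ^ 2 =
      s⁻¹ * ‖∑ i, v i • colVec (dataMatrix x) i‖ ^ 2 := by
    rw [← sum_sq_eq_norm_sq, Finset.mul_sum]
    refine Finset.sum_congr rfl fun a _ => ?_
    have : ∑ i, w i * x a i = (√s)⁻¹ * ∑ i, v i * x a i := by
      rw [Finset.mul_sum]
      exact Finset.sum_congr rfl fun i _ => by simp [hw, mul_assoc]
    rw [this, mul_pow, inv_pow, Real.sq_sqrt hs.le]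
  have e2 : s⁻¹ * ‖∑ i, v i • colVec (dataMatrix x) i‖ ^ 2 - n =
      s⁻¹ * (‖∑ i, v i • colVec (dataMatrix x) i‖ ^ 2 - n * s) := by
    field_simp
  rw [e, e2, abs_mul, abs_of_pos (inv_pos.2 hs), ← div_eq_inv_mul, le_div_iff₀ hs]
  linarith

/-- Restricted isometry on the coefficient vectors supported in `W`. -/
theorem measure_not_isometry_le (hS : S.PosDef) (W : Finset (Fin p)) {η : ℝ} (hη0 : 0 < η)
    (hη1 : η ≤ 1) :
    (dataLaw n S).real {x | ¬ ∀ v : Fin p → ℝ, (∀ i, i ∉ W → v i = 0) →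
      |‖∑ i, v i • colVec (dataMatrix x) i‖ ^ 2 - n * (v ⬝ᵥ S *ᵥ v)| ≤
        4 * η * (n * (v ⬝ᵥ S *ᵥ v))} ≤
      4 * 25 ^ W.card * Real.exp (-(η ^ 2 / 16 * n)) := by
  classical
  obtain ⟨C, hCu, hC⟩ := exists_transpose_mul_self_eq hS
  set U : Submodule ℝ (EuclideanSpace ℝ (Fin p)) :=
    Submodule.span ℝ ((W.image fun i => (WithLp.toLp 2 (C.col i) : EuclideanSpace ℝ (Fin p)) :
      Finset (EuclideanSpace ℝ (Fin p))) : Set (EuclideanSpace ℝ (Fin p))) with hU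
  have hrank : Module.finrank ℝ U ≤ W.card :=
    (finrank_span_finset_le_card _).trans Finset.card_image_le
  set T : U →ₗ[ℝ] (Fin p → ℝ) :=
    (Matrix.toLin' C⁻¹) ∘ₗ (WithLp.linearEquiv 2 ℝ (Fin p → ℝ)).toLinearMap ∘ₗ U.subtype with hT
  have hTapp : ∀ y : U, T y = C⁻¹ *ᵥ (y.1 : EuclideanSpace ℝ (Fin p)).ofLp := fun y => rfl
  have hq : ∀ v : Fin p → ℝ, v ⬝ᵥ S *ᵥ v = (C *ᵥ v) ⬝ᵥ (C *ᵥ v) := fun v => by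
    rw [← hC, ← Matrix.mulVec_mulVec, Matrix.dotProduct_mulVec, Matrix.vecMul_transpose]
  have hTq : ∀ y : U, T y ⬝ᵥ S *ᵥ T y = ‖y‖ ^ 2 := fun y => by
    rw [hq, hTapp, Matrix.mulVec_mulVec, Matrix.mul_nonsing_inv _ hCu, Matrix.one_mulVec,
      Submodule.coe_norm, EuclideanSpace.norm_sq_eq]
    simp [dotProduct, sq]
  have hsurj : ∀ v : Fin p → ℝ, (∀ i, i ∉ W → v i = 0) → ∃ y, T y = v := by
    intro v hv
    have hmem : (WithLp.toLp 2 (C *ᵥ v) : EuclideanSpace ℝ (Fin p)) ∈ U := by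
      have e : (WithLp.toLp 2 (C *ᵥ v) : EuclideanSpace ℝ (Fin p)) =
          ∑ i ∈ W, v i • WithLp.toLp 2 (C.col i) := by
        rw [Finset.sum_subset (Finset.subset_univ W) fun i _ hi => by simp [hv i hi]]
        exact (sum_smul_colVec C v).symm
      rw [e]
      exact Submodule.sum_mem _ fun i hi => Submodule.smul_mem _ _
        (Submodule.subset_span (by simpa using ⟨i, hi, rfl⟩))
    refine ⟨⟨_, hmem⟩, ?_⟩
    rw [hTapp, Matrix.mulVec_mulVec, Matrix.nonsing_inv_mul _ hCu, Matrix.one_mulVec]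
  obtain ⟨N, hNc, hN2, hN⟩ := exists_net U
  -- Only quadratic forms are controlled by concentration. Testing sums and differences of net
  -- points yields, by polarization, the bilinear form on all pairs from the net.
  set Z : Finset U := (N ×ˢ N).image (fun z => z.1 + z.2) ∪ (N ×ˢ N).image (fun z => z.1 - z.2)
    with hZ
  have hZc : Z.card ≤ 2 * 25 ^ W.card := by
    have hNN : (N ×ˢ N).card ≤ 25 ^ W.card := by
      rw [Finset.card_product]
      calc N.card * N.card ≤ 5 ^ W.card * 5 ^ W.card := by
            have := hNc.trans (Nat.pow_le_pow_right (by norm_num) hrank)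
            exact Nat.mul_le_mul this this
        _ = 25 ^ W.card := by rw [← mul_pow]; norm_num
    refine (Finset.card_union_le _ _).trans ?_
    have h1 := (Finset.card_image_le (s := N ×ˢ N) (f := fun z : U × U => z.1 + z.2)).trans hNN
    have h2 := (Finset.card_image_le (s := N ×ˢ N) (f := fun z : U × U => z.1 - z.2)).trans hNN
    omega
  set bad : U → Set (Fin n → EuclideanSpace ℝ (Fin p)) := fun z =>
    {x | η * (n * (T z ⬝ᵥ S *ᵥ T z)) <
      |‖∑ i, T z i • colVec (dataMatrix x) i‖ ^ 2 - n * (T z ⬝ᵥ S *ᵥ T z)|} with hbad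
  have hsub : {x : Fin n → EuclideanSpace ℝ (Fin p) |
      ¬ ∀ v : Fin p → ℝ, (∀ i, i ∉ W → v i = 0) →
      |‖∑ i, v i • colVec (dataMatrix x) i‖ ^ 2 - n * (v ⬝ᵥ S *ᵥ v)| ≤
        4 * η * (n * (v ⬝ᵥ S *ᵥ v))} ⊆ ⋃ z ∈ Z, bad z := by
    intro x hx
    by_contra hcon
    refine hx fun v hv => ?_
    have hgood : ∀ z ∈ Z, |‖∑ i, T z i • colVec (dataMatrix x) i‖ ^ 2 - n * ‖z‖ ^ 2| ≤
        η * (n * ‖z‖ ^ 2) := by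
      intro z hz
      by_contra h
      refine hcon (Set.mem_biUnion hz ?_)
      simp only [hbad, Set.mem_ofPred_eq, hTq]
      exact not_le.1 h
    set Q : U →ₗ[ℝ] EuclideanSpace ℝ (Fin n) :=
      (WithLp.linearEquiv 2 ℝ (Fin n → ℝ)).symm.toLinearMap ∘ₗ
        (Matrix.toLin' (dataMatrix x)) ∘ₗ T with hQ
    have hQapp : ∀ y, Q y = ∑ i, T y i • colVec (dataMatrix x) i := fun y => by
      rw [sum_smul_colVec]; rfl
    set β : U →ₗ[ℝ] U →ₗ[ℝ] ℝ :=
      (innerₗ (EuclideanSpace ℝ (Fin n))).compl₁₂ Q Q - (n : ℝ) • innerₗ U with hβ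
    have hβapp : ∀ y z, β y z = ⟪Q y, Q z⟫ - n * ⟪y, z⟫ := fun y z => by simp [hβ]
    -- Polarization and the parallelogram law bound this by `η n (2 ‖y‖² + 2 ‖z‖²) / 4`, and net
    -- points have norm at most 2.
    have hβN : ∀ y ∈ N, ∀ z ∈ N, |β y z| ≤ 4 * η * n := by
      intro y hy z hz
      have hp := hgood (y + z) (Finset.mem_union_left _
        (Finset.mem_image.2 ⟨(y, z), Finset.mem_product.2 ⟨hy, hz⟩, rfl⟩))
      have hm := hgood (y - z) (Finset.mem_union_right _
        (Finset.mem_image.2 ⟨(y, z), Finset.mem_product.2 ⟨hy, hz⟩, rfl⟩))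
      rw [← hQapp, map_add, norm_add_sq_real, norm_add_sq_real] at hp
      rw [← hQapp, map_sub, norm_sub_sq_real, norm_sub_sq_real] at hm
      have hy2 : ‖y‖ ^ 2 ≤ 4 := by have := hN2 y hy; nlinarith [norm_nonneg y]
      have hz2 : ‖z‖ ^ 2 ≤ 4 := by have := hN2 z hz; nlinarith [norm_nonneg z]
      have hηn : 0 ≤ η * n := by positivity
      have h1 := mul_le_mul_of_nonneg_left hy2 hηn
      have h2 := mul_le_mul_of_nonneg_left hz2 hηn
      rw [hβapp]
      rw [abs_le] at hp hm ⊢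
      constructor
      · linarith [hp.1, hm.2]
      · linarith [hp.2, hm.1]
    obtain ⟨y, rfl⟩ := hsurj v hv
    have h1 := bilin_abs_le_of_abs_le_on_net hN β (by positivity) hβN y y
    rw [hβapp, real_inner_self_eq_norm_sq, real_inner_self_eq_norm_sq, hQapp] at h1
    rw [hTq]
    calc _ ≤ _ := h1
      _ = _ := by ring
  calc _ ≤ (dataLaw n S).real (⋃ z ∈ Z, bad z) :=
      measureReal_mono hsub (measure_ne_top _ _)
    _ ≤ ∑ z ∈ Z, (dataLaw n S).real (bad z) := measureReal_biUnion_finset_le _ _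
    _ ≤ ∑ z ∈ Z, 2 * Real.exp (-(η ^ 2 / 16 * n)) :=
      Finset.sum_le_sum fun z _ => measure_quadForm_deviation_le hS (T z) hη0 hη1
    _ = Z.card * (2 * Real.exp (-(η ^ 2 / 16 * n))) := by rw [Finset.sum_const, nsmul_eq_mul]
    _ ≤ (2 * 25 ^ W.card : ℕ) * (2 * Real.exp (-(η ^ 2 / 16 * n))) := by gcongr
    _ = _ := by push_cast; ring

theorem card_filter_card_le (s : ℕ) :
    (Finset.univ.filter fun W : Finset (Fin p) => W.card ≤ s).card ≤ (p + 1) ^ s := by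
  classical
  induction s with
  | zero =>
    have : (Finset.univ.filter fun W : Finset (Fin p) => W.card ≤ 0) = {∅} := by
      ext W; simp
    rw [this]; simp
  | succ s ih =>
    -- Each step inserts one of the `p` elements or, with `none`, nothing; the extra option accounts
    -- for `p + 1`.
    have hsub : (Finset.univ.filter fun W : Finset (Fin p) => W.card ≤ s + 1) ⊆
        (Finset.univ ×ˢ (Finset.univ.filter fun W : Finset (Fin p) => W.card ≤ s)).image
          fun z : Option (Fin p) × Finset (Fin p) => z.1.elim z.2 fun a => insert a z.2 := by
      intro W hW
      have hW' : W.card ≤ s + 1 := by simpa using hW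
      rcases W.eq_empty_or_nonempty with rfl | ⟨a, ha⟩
      · exact Finset.mem_image.2 ⟨(none, ∅), by simp, rfl⟩
      · refine Finset.mem_image.2 ⟨(some a, W.erase a), ?_, Finset.insert_erase ha⟩
        simp [Finset.card_erase_of_mem ha]; omega
    refine (Finset.card_le_card hsub).trans (Finset.card_image_le.trans ?_)
    rw [Finset.card_product, pow_succ, mul_comm]
    gcongr
    simp

end Isometry

/-! ### Rapid mixing on a typical data set -/

section GoodEvent

open scoped RealInnerProductSpace

variable {n p : ℕ} {S : Matrix (Fin p) (Fin p) ℝ} {σ : Equiv.Perm (Fin p)}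

/-- The data matrix `X` acts as a near isometry for the quadratic form of `S` on vectors with at most
`s` nonzero entries. -/
def RestrictedIsometry (X : Matrix (Fin n) (Fin p) ℝ) (S : Matrix (Fin p) (Fin p) ℝ) (s : ℕ)
    (η : ℝ) : Prop :=
  ∀ W : Finset (Fin p), W.card ≤ s → ∀ v : Fin p → ℝ, (∀ i, i ∉ W → v i = 0) →
    |‖∑ i, v i • colVec X i‖ ^ 2 - n * (v ⬝ᵥ S *ᵥ v)| ≤ η * (n * (v ⬝ᵥ S *ᵥ v))

/-- The noise of every node is nearly orthogonal to the residuals of its predecessors. -/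
def SmallNoise (X : Matrix (Fin n) (Fin p) ℝ) (σ : Equiv.Perm (Fin p))
    (B : Matrix (Fin p) (Fin p) ℝ) (ω : Fin p → ℝ) (u : ℝ) (s : ℕ) : Prop :=
  ∀ j k : Fin p, ∀ T : Finset (Fin p), T.card ≤ s → (∀ i ∈ T, σ.symm i < σ.symm j) →
    σ.symm k < σ.symm j → IsUnit ((cols X T)ᵀ * cols X T).det →
    ⟪resid (colVec X) T (colVec X k), ∑ i, (1 - B).col j i • colVec X i⟫ ^ 2 ≤
      ω j * u * ‖resid (colVec X) T (colVec X k)‖ ^ 2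

theorem RestrictedIsometry.gramBounds {X : Matrix (Fin n) (Fin p) ℝ} {s : ℕ} {η a b νlo νhi : ℝ}
    (hX : RestrictedIsometry X S s η) (hη0 : 0 ≤ η) (hη1 : η ≤ 1)
    (hq : ∀ v : Fin p → ℝ, a * ∑ i, v i ^ 2 ≤ v ⬝ᵥ S *ᵥ v ∧ v ⬝ᵥ S *ᵥ v ≤ b * ∑ i, v i ^ 2)
    (hlo : νlo ≤ (1 - η) * a) (hhi : (1 + η) * b ≤ νhi) {W : Finset (Fin p)} (hW : W.card ≤ s) :
    GramBounds (colVec X) W (n * νlo) (n * νhi) := by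
  intro v hv
  have h1 := abs_le.1 (hX W hW v hv)
  have hs : 0 ≤ ∑ i, v i ^ 2 := Finset.sum_nonneg fun i _ => sq_nonneg _
  constructor
  · calc n * νlo * ∑ i, v i ^ 2 ≤ n * ((1 - η) * a) * ∑ i, v i ^ 2 := by gcongr
      _ = n * (1 - η) * (a * ∑ i, v i ^ 2) := by ring
      _ ≤ n * (1 - η) * (v ⬝ᵥ S *ᵥ v) :=
        mul_le_mul_of_nonneg_left (hq v).1 (mul_nonneg n.cast_nonneg (by linarith))
      _ ≤ _ := by linarith [h1.1]
  · calc _ ≤ n * (1 + η) * (v ⬝ᵥ S *ᵥ v) := by linarith [h1.2]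
      _ ≤ n * (1 + η) * (b * ∑ i, v i ^ 2) :=
        mul_le_mul_of_nonneg_left (hq v).2 (by positivity)
      _ = n * ((1 + η) * b) * ∑ i, v i ^ 2 := by ring
      _ ≤ _ := by gcongr

/-- The residual of column `j` on `W` is a combination of columns with coefficient 1 at `j` and no
successor of `j`, so its population variance is at least `ω j`. The isometry with `η ≤ 1 / 2` keeps
half of it; the support `insert j W` has at most `din + 1 ≤ 2 * din` elements. -/
theorem nodeRegular_of_restrictedIsometry (hS : S.PosDef) {B : Matrix (Fin p) (Fin p) ℝ}
    {ω : Fin p → ℝ} (h : IsModifiedCholesky S σ B ω) {X : Matrix (Fin n) (Fin p) ℝ} {din : ℕ}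
    {η a b νlo νhi u : ℝ} (hn : 0 < n) (hdin : 1 ≤ din)
    (hX : RestrictedIsometry X S (2 * din) η) (hnoise : SmallNoise X σ B ω u din)
    (hη0 : 0 ≤ η) (hη1 : η ≤ 1 / 2)
    (hq : ∀ v : Fin p → ℝ, a * ∑ i, v i ^ 2 ≤ v ⬝ᵥ S *ᵥ v ∧ v ⬝ᵥ S *ᵥ v ≤ b * ∑ i, v i ^ 2)
    (hνlo : 0 < νlo) (hlo : νlo ≤ (1 - η) * a) (hhi : (1 + η) * b ≤ νhi)
    (j : Fin p) {T : Finset (Fin p)} (hT : ∀ i, i ∈ T ↔ B i j ≠ 0) :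
    NodeRegular X j (Finset.univ.filter fun i => σ.symm i < σ.symm j) T (fun i => B i j) (ω j) u
      νlo νhi din := by
  have hn' : (0 : ℝ) < n := by exact_mod_cast hn
  have hgram : ∀ W : Finset (Fin p), W.card ≤ 2 * din →
      GramBounds (colVec X) W (n * νlo) (n * νhi) := fun W hW =>
    hX.gramBounds hη0 (by linarith) hq hlo hhi hW
  refine ⟨hgram, fun W hWA hW => ?_, fun W hWA hW k hk _ => ?_⟩
  · obtain ⟨c, hc0, hc⟩ := exists_sub_resid_eq_sum (colVec X) W (colVec X j)
    have hWj : ∀ i ∈ W, σ.symm i < σ.symm j := fun i hi => by simpa using hWA hi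
    have hjW : j ∉ W := fun hj => lt_irrefl _ (hWj j hj)
    set v : Fin p → ℝ := Pi.single j 1 - c with hv
    have hsum : ∑ i, v i • colVec X i = resid (colVec X) W (colVec X j) := by
      have h1 : ∑ i, c i • colVec X i = ∑ i ∈ W, c i • colVec X i :=
        (Finset.sum_subset (Finset.subset_univ _) fun i _ hi => by rw [hc0 i hi, zero_smul]).symm
      have h2 : ∑ i, (Pi.single j (1 : ℝ) : Fin p → ℝ) i • colVec X i = colVec X j := by
        simp [Pi.single_apply, ite_smul]
      simp only [hv, Pi.sub_apply, sub_smul, Finset.sum_sub_distrib]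
      rw [h1, h2, ← hc, sub_sub_cancel]
    have h1 := (abs_le.1 (hX (insert j W) ((Finset.card_insert_le _ _).trans (by omega)) v
      (fun i hi => by
        have hi' : i ≠ j ∧ i ∉ W := by simpa [not_or] using hi
        simp [hv, hi'.1, hc0 i hi'.2]))).1
    have h2 : ω j ≤ v ⬝ᵥ S *ᵥ v := h.le_quadForm hS (by simp [hv, hc0 j hjW]) (fun i hi => by
      have h3 : i ≠ j := by rintro rfl; exact lt_irrefl _ hi
      have h4 : i ∉ W := fun hiW => lt_asymm hi (hWj i hiW)
      simp [hv, h3, hc0 i h4])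
    rw [hsum] at h1
    have h3 : n * ω j / 2 ≤ n * (v ⬝ᵥ S *ᵥ v) / 2 := by gcongr
    have h4 : 0 ≤ n * (v ⬝ᵥ S *ᵥ v) := mul_nonneg hn'.le ((h.2.1 j).le.trans h2)
    have h5 := mul_le_mul_of_nonneg_right hη1 h4
    linarith
  · have hsum : colVec X j - ∑ i ∈ T, B i j • colVec X i =
        ∑ i, (1 - B).col j i • colVec X i := by
      have h1 : ∑ i, B i j • colVec X i = ∑ i ∈ T, B i j • colVec X i :=
        (Finset.sum_subset (Finset.subset_univ _) fun i _ hi => by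
          rw [not_not.1 (mt (hT i).2 hi), zero_smul]).symm
      have h2 : ∑ i, (1 : Matrix (Fin p) (Fin p) ℝ) i j • colVec X i = colVec X j := by
        simp [Matrix.one_apply, ite_smul]
      simp only [Matrix.col_apply, Matrix.sub_apply, sub_smul, Finset.sum_sub_distrib]
      rw [h1, h2]
    rw [hsum]
    refine hnoise j k W hW (fun i hi => by simpa using hWA hi) (by simpa using hk)
      (isUnit_det_gram fun v hv h0 => ?_)
    have h1 := (hgram W (by omega) v hv).1
    rw [h0, norm_zero, zero_pow two_ne_zero] at h1
    have h2 : ∑ i, v i ^ 2 = 0 := le_antisymm (nonpos_of_mul_nonpos_right h1 (by positivity))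
      (Finset.sum_nonneg fun i _ => sq_nonneg _)
    ext i
    have := (Finset.sum_eq_zero_iff_of_nonneg fun i _ => sq_nonneg (v i)).1 h2 i (Finset.mem_univ i)
    simpa using this

/-- Everything random has been isolated in `NodeRegular`, so this step is deterministic: the moves
have gain `R = p ^ t`. The degree `d*_σ` suffices in the counting argument, and it is at most the
`d*` of the hypothesis. -/
theorem samplerMixingTime_le_of_nodeRegular (hS : S.PosDef) {ω : Fin p → ℝ}
    {X : Matrix (Fin n) (Fin p) ℝ} {h : Hyper} {din dout : ℕ} {νlo νhi t Cβ : ℝ}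
    (hreg : ∀ j, NodeRegular X j (Finset.univ.filter fun i => σ.symm i < σ.symm j)
      (parents (minimalIMap S σ) j) (fun i => cholWeights S σ i j) (ω j)
      ((4 * din + 6) * Real.log p) νlo νhi din)
    (hn : 0 < n) (hp : 2 ≤ p) (hdin : 1 ≤ din) (hνlo : 0 < νlo) (hν : νlo ≤ νhi)
    (hω : ∀ j, 0 < ω j) (hωνhi : ∀ j, ω j ≤ νhi)
    (hα : 0 < h.α) (hα1 : h.α < 1) (hκ : 0 ≤ h.κ) (hκn : h.κ ≤ n)
    (hc : 1 ≤ h.c₁ * √(1 + h.α / h.γ)) (hcp : h.c₁ * √(1 + h.α / h.γ) ≤ p)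
    (ht : 3 < t) (hCβ : 8 * t / 3 ≤ Cβ) (hc₂ : (h.α + 1) * (4 * din + 6) + t ≤ h.c₂)
    (hd : (4 * νhi ^ 2 * (νlo ^ 4)⁻¹ * (νhi - νlo) ^ 2 + 1) * maxDegIMap S σ ≤ din)
    (hβ : ∀ i j, cholWeights S σ i j ≠ 0 →
      5 * (Cβ + 4 * h.c₂) * (νhi ^ 2 * Real.log p / (h.α * νlo ^ 2 * n)) ≤
        |cholWeights S σ i j| ^ 2)
    (hdout : min (maxDegAllIMaps S * din + 1) p ≤ dout)
    (hpt : 24 * din * (p : ℝ) ^ 2 ≤ (p : ℝ) ^ t)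
    {N : EdgeSet p → Finset (EdgeSet p)} (hN : N = adsNbhd ∨ N = adsNbhdOrdered σ) :
    (samplerMixingTime h X σ din dout N : ℝ≥0∞) ≤
      ENNReal.ofReal (15 * din * (p : ℝ) ^ 2 * Real.log (4 / posteriorMin h X σ din dout)) := by
  set G := minimalIMap S σ with hG
  have hsub : ∀ (j : Fin p) (W : Finset (Fin p)), (∀ i ∈ W, σ.symm i < σ.symm j) →
      W ⊆ Finset.univ.filter fun i => σ.symm i < σ.symm j := fun j W hW i hi => by
    simpa using hW i hi
  have hGord := minimalIMap_mem_orderedDAGs (σ := σ) hS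
  have hdeg : maxDegIMap S σ ≤ din := by
    have h1 : 0 ≤ 4 * νhi ^ 2 * (νlo ^ 4)⁻¹ * (νhi - νlo) ^ 2 * maxDegIMap S σ := by positivity
    have h2 : (maxDegIMap S σ : ℝ) ≤ din := by linarith
    exact_mod_cast h2
  have hdout' : min (maxDegIMap S σ * din + 1) p ≤ dout :=
    le_trans (min_le_min_right _ (Nat.succ_le_succ
      (Nat.mul_le_mul_right _ maxDegIMap_le_maxDegAllIMaps))) hdout
  have hGmem : G ∈ sparseDAGs σ din dout := by
    rw [sparseDAGs, Finset.mem_filter]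
    refine ⟨hGord, fun j => (card_parents_le_maxDegIMap j).trans hdeg, fun j => ?_⟩
    refine le_trans (le_min ?_ ?_) hdout'
    · exact (card_children_le_maxDegIMap j).trans
        ((Nat.le_mul_of_pos_right _ hdin).trans (Nat.le_succ _))
    · exact (Finset.card_le_univ _).trans (by simp)
  have hpos : ∀ j W, (∀ i ∈ W, σ.symm i < σ.symm j) → W.card ≤ din → 0 < nodeWeight h X j W :=
    fun j W hW hWc =>
      (hreg j).nodeWeight_pos hn (by omega) hνlo (hω j) hc (hsub j W hW) hWc
  refine samplerMixingTime_le hN hdin (by omega) (fun E hE => ?_) hGmem hpt (fun E hE hEG => ?_)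
  · obtain ⟨h1, h2, -⟩ := mem_sparseDAGs.1 hE
    exact Finset.prod_pos fun j _ => hpos j _ (fun i hi => mem_orderedDAGs.1 h1 i j (mem_parents.1 hi)) (h2 j)
  · exact exists_adsNbhd_mul_le hdin hGmem card_children_le_maxDegIMap hdout'
      (fun j W hW hWc => (hpos j W hW hWc).le)
      (fun j W hW hWc hTW => (hreg j).mul_nodeWeight_le_erase hn hp hνlo (hω j) hα hκ hκn hc hc₂
        (hsub j W hW) hWc hTW)
      (fun j W hW hWc hTW => (hreg j).exists_mul_nodeWeight_le hn hp hνlo hν (hω j) (hωνhi j) hα hα1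
        hκ hc hcp ht hCβ hc₂
        (hsub j _ fun i hi => mem_orderedDAGs.1 hGord i j (mem_parents.1 hi))
        (Nat.cast_le.2 (card_parents_le_maxDegIMap j)) hd
        (fun i hi => mem_parents_minimalIMap.1 hi)
        (fun i hi => by simpa using hβ i j (mem_parents_minimalIMap.1 hi)) (hsub j W hW) hWc hTW)
      hE hEG

end GoodEvent

/-! ### Probability of the typical event -/

section Probability

open scoped RealInnerProductSpace

variable {n p : ℕ} {S : Matrix (Fin p) (Fin p) ℝ} {σ : Equiv.Perm (Fin p)}

theorem measure_not_restrictedIsometry_le (hS : S.PosDef) (s : ℕ) {η : ℝ} (hη0 : 0 < η)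
    (hη1 : η ≤ 1) :
    (dataLaw n S).real {x | ¬ RestrictedIsometry (dataMatrix x) S s (4 * η)} ≤
      (p + 1) ^ s * (4 * 25 ^ s * Real.exp (-(η ^ 2 / 16 * n))) := by
  set F : Finset (Finset (Fin p)) := Finset.univ.filter fun W => W.card ≤ s with hF
  set bad : Finset (Fin p) → Set (Fin n → EuclideanSpace ℝ (Fin p)) := fun W =>
    {x | ¬ ∀ v : Fin p → ℝ, (∀ i, i ∉ W → v i = 0) →
      |‖∑ i, v i • colVec (dataMatrix x) i‖ ^ 2 - n * (v ⬝ᵥ S *ᵥ v)| ≤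
        4 * η * (n * (v ⬝ᵥ S *ᵥ v))} with hbad
  have hsub : {x : Fin n → EuclideanSpace ℝ (Fin p) |
      ¬ RestrictedIsometry (dataMatrix x) S s (4 * η)} ⊆ ⋃ W ∈ F, bad W := by
    intro x hx
    by_contra hcon
    refine hx fun W hW => ?_
    by_contra h
    exact hcon (Set.mem_biUnion (show W ∈ F by simpa [hF] using hW) h)
  have hFc : (F.card : ℝ) ≤ (p + 1) ^ s := by exact_mod_cast card_filter_card_le (p := p) s
  calc _ ≤ (dataLaw n S).real (⋃ W ∈ F, bad W) := measureReal_mono hsub (measure_ne_top _ _)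
    _ ≤ ∑ W ∈ F, (dataLaw n S).real (bad W) := measureReal_biUnion_finset_le _ _
    _ ≤ ∑ W ∈ F, 4 * 25 ^ s * Real.exp (-(η ^ 2 / 16 * n)) :=
      Finset.sum_le_sum fun W hW => (measure_not_isometry_le hS W hη0 hη1).trans (by
        have : W.card ≤ s := by simpa [hF] using hW
        gcongr
        norm_num)
    _ = F.card * (4 * 25 ^ s * Real.exp (-(η ^ 2 / 16 * n))) := by
      rw [Finset.sum_const, nsmul_eq_mul]
    _ ≤ _ := by gcongr

theorem IsModifiedCholesky.measure_not_smallNoise_le (hS : S.PosDef)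
    {B : Matrix (Fin p) (Fin p) ℝ} {ω : Fin p → ℝ} (h : IsModifiedCholesky S σ B ω) (s : ℕ)
    {u : ℝ} (hu : 0 ≤ u) :
    (dataLaw n S).real {x | ¬ SmallNoise (dataMatrix x) σ B ω u s} ≤
      p * (p * (p + 1) ^ s) * (2 * Real.exp (-(u / 2))) := by
  set F : Finset (Fin p × Fin p × Finset (Fin p)) :=
    Finset.univ ×ˢ Finset.univ ×ˢ Finset.univ.filter fun W => W.card ≤ s with hF
  set bad : Fin p × Fin p × Finset (Fin p) → Set (Fin n → EuclideanSpace ℝ (Fin p)) := fun z =>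
    {x | (∀ i ∈ z.2.2, σ.symm i < σ.symm z.1) ∧ σ.symm z.2.1 < σ.symm z.1 ∧
      IsUnit ((cols (dataMatrix x) z.2.2)ᵀ * cols (dataMatrix x) z.2.2).det ∧
      ω z.1 * u * ‖resid (colVec (dataMatrix x)) z.2.2 (colVec (dataMatrix x) z.2.1)‖ ^ 2 <
        ⟪resid (colVec (dataMatrix x)) z.2.2 (colVec (dataMatrix x) z.2.1),
          ∑ i, (1 - B).col z.1 i • colVec (dataMatrix x) i⟫ ^ 2} with hbad
  have hsub : {x : Fin n → EuclideanSpace ℝ (Fin p) |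
      ¬ SmallNoise (dataMatrix x) σ B ω u s} ⊆ ⋃ z ∈ F, bad z := by
    intro x hx
    by_contra hcon
    refine hx fun j k T hT hTj hkj hunit => ?_
    by_contra hlt
    exact hcon (Set.mem_biUnion (show (j, k, T) ∈ F by simpa [hF] using hT)
      ⟨hTj, hkj, hunit, not_le.1 hlt⟩)
  have hFc : (F.card : ℝ) ≤ p * (p * (p + 1) ^ s) := by
    have h1 := card_filter_card_le (p := p) s
    rw [hF, Finset.card_product, Finset.card_product, Finset.card_univ, Fintype.card_fin]
    push_cast
    gcongr
    exact_mod_cast h1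
  have hle : ∀ z, (dataLaw n S).real (bad z) ≤ 2 * Real.exp (-(u / 2)) := by
    intro z
    by_cases hz : (∀ i ∈ z.2.2, σ.symm i < σ.symm z.1) ∧ σ.symm z.2.1 < σ.symm z.1
    · exact (measureReal_mono (fun x hx => hx.2.2) (measure_ne_top _ _)).trans
        (h.measure_noise_le hS hz.1 hz.2 hu)
    · have : bad z = ∅ := Set.eq_empty_of_forall_notMem fun x hx => hz ⟨hx.1, hx.2.1⟩
      rw [this, measureReal_empty]
      positivity
  calc _ ≤ (dataLaw n S).real (⋃ z ∈ F, bad z) := measureReal_mono hsub (measure_ne_top _ _)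
    _ ≤ ∑ z ∈ F, (dataLaw n S).real (bad z) := measureReal_biUnion_finset_le _ _
    _ ≤ ∑ z ∈ F, 2 * Real.exp (-(u / 2)) := Finset.sum_le_sum fun z _ => hle z
    _ = F.card * (2 * Real.exp (-(u / 2))) := by rw [Finset.sum_const, nsmul_eq_mul]
    _ ≤ _ := by gcongr

/-- Bounding `p + 1` by `p ^ 2`, and 4 and 25 by `p`, the prefactor times `p` is at most `p ^ (6 *
din + 2) ≤ p ^ (8 * din)`. -/
theorem isometry_union_bound_le {p din n : ℕ} {c : ℝ} (hp : 25 ≤ p) (hdin : 1 ≤ din)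
    (h : 8 * (din * Real.log p) ≤ c * n) :
    ((p : ℝ) + 1) ^ (2 * din) * (4 * 25 ^ (2 * din) * Real.exp (-(c * n))) ≤ 1 / p := by
  have hp' : (25 : ℝ) ≤ p := by exact_mod_cast hp
  have hp0 : (0 : ℝ) < p := by linarith
  have h1 : (p : ℝ) ^ (8 * din) ≤ Real.exp (c * n) := by
    rw [← Real.rpow_natCast, Real.rpow_def_of_pos hp0, Real.exp_le_exp]
    push_cast
    linarith
  have h2 : ((p : ℝ) + 1) ^ (2 * din) * (4 * 25 ^ (2 * din)) * p ≤ (p : ℝ) ^ (8 * din) := by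
    calc ((p : ℝ) + 1) ^ (2 * din) * (4 * 25 ^ (2 * din)) * p
        ≤ ((p : ℝ) ^ 2) ^ (2 * din) * (p * (p : ℝ) ^ (2 * din)) * p := by
          gcongr
          · nlinarith
          · linarith
      _ = (p : ℝ) ^ (6 * din + 2) := by ring
      _ ≤ _ := pow_le_pow_right₀ (by linarith) (by omega)
  rw [Real.exp_neg, le_div_iff₀ hp0]
  calc _ = (((p : ℝ) + 1) ^ (2 * din) * (4 * 25 ^ (2 * din)) * p) / Real.exp (c * n) := by
        rw [div_eq_mul_inv]; ring
    _ ≤ 1 := (div_le_one (Real.exp_pos _)).2 (h2.trans h1)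

/-- The level `u = (4 * din + 6) * log p` gives the tail `p ^ (-(2 * din + 3))`. It pays for `p ^ 2`
pairs of nodes, for `2 * (p + 1) ^ din ≤ p ^ (2 * din)`, and leaves `1 / p`. -/
theorem noise_union_bound_le {p din : ℕ} (hp : 3 ≤ p) (hdin : 1 ≤ din) :
    (p : ℝ) * (p * (p + 1) ^ din) * (2 * Real.exp (-((4 * din + 6) * Real.log p / 2))) ≤
      1 / p := by
  have hp' : (3 : ℝ) ≤ p := by exact_mod_cast hp
  have hp0 : (0 : ℝ) < p := by linarith
  have h1 : Real.exp ((4 * din + 6) * Real.log p / 2) = (p : ℝ) ^ (2 * din + 3) := by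
    rw [← Real.rpow_natCast, Real.rpow_def_of_pos hp0]
    push_cast
    congr 1
    ring
  have h2 : 2 * ((p : ℝ) + 1) ^ din ≤ (p : ℝ) ^ (2 * din) := by
    calc 2 * ((p : ℝ) + 1) ^ din ≤ 2 ^ din * ((p : ℝ) + 1) ^ din := by
          gcongr
          exact le_self_pow₀ (by norm_num) (by omega)
      _ = (2 * ((p : ℝ) + 1)) ^ din := by rw [mul_pow]
      _ ≤ ((p : ℝ) ^ 2) ^ din := by gcongr; nlinarith
      _ = _ := by rw [← pow_mul]
  rw [Real.exp_neg, h1, le_div_iff₀ hp0]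
  calc _ = (p : ℝ) ^ 3 * (2 * ((p : ℝ) + 1) ^ din) / (p : ℝ) ^ (2 * din + 3) := by
        rw [div_eq_mul_inv]; ring
    _ ≤ 1 := by
      rw [div_le_one (by positivity), pow_add, mul_comm]
      gcongr

/-- Stated through subadditivity and not complements, so that none of the events has to be
measurable. -/
theorem one_sub_le_measureReal {Ω : Type*} [MeasurableSpace Ω] (μ : Measure Ω)
    [IsProbabilityMeasure μ] {s a b : Set Ω} {ε : ℝ} (h : ∀ x, x ∉ a → x ∉ b → x ∈ s)
    (hab : μ.real a + μ.real b ≤ ε) : 1 - ε ≤ μ.real s := by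
  have h1 : μ.real Set.univ ≤ μ.real (s ∪ (a ∪ b)) := measureReal_mono (fun x _ => by
    by_cases ha : x ∈ a
    · exact Or.inr (Or.inl ha)
    · by_cases hb : x ∈ b
      · exact Or.inr (Or.inr hb)
      · exact Or.inl (h x ha hb)) (measure_ne_top _ _)
  rw [probReal_univ] at h1
  have h2 := measureReal_union_le (μ := μ) s (a ∪ b)
  have h3 := measureReal_union_le (μ := μ) a b
  linarith

end Probability

end SparseDAG

/-! ### The main theorem: choice of constants and assembly -/

open SparseDAG in
theorem theorem6 :
    ∃ C : ℝ, 0 < C ∧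
    ∀ (p din dout : ℕ → ℕ)
      (S : ∀ n, Matrix (Fin (p n)) (Fin (p n)) ℝ) (hS : ∀ n, (S n).PosDef)
      (σ : ∀ n, Equiv.Perm (Fin (p n)))
      (h : ℕ → SparseDAG.Hyper) (νlo νhi : ℕ → ℝ) (δ₀ t Cβ : ℝ),
      Tendsto p atTop atTop →
      (∀ᶠ n in atTop, 1 ≤ din n ∧ din n ≤ p n ∧ 1 ≤ dout n ∧ dout n ≤ p n) →
      (∀ᶠ n in atTop, 0 < (h n).c₁ ∧ 0 ≤ (h n).c₂ ∧ 0 < (h n).α ∧ (h n).α < 1 ∧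
        0 < (h n).γ ∧ 0 ≤ (h n).κ) →
      0 < δ₀ → δ₀ < 1 → 3 < t → 8 * t / 3 ≤ Cβ →
      -- restricted eigenvalues
      (∀ᶠ n in atTop, 0 < νlo n ∧ 0 < νhi n ∧ ∀ i,
        νlo n / (1 - δ₀) ^ 2 ≤ (hS n).isHermitian.eigenvalues i ∧
        (hS n).isHermitian.eigenvalues i ≤ νhi n / (1 + δ₀) ^ 2) →
      -- growth
      ((fun n => (din n : ℝ) * Real.log (p n)) =o[atTop] fun n => (n : ℝ)) →
      -- prior parameters
      (∀ᶠ n in atTop, (h n).κ ≤ n ∧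
        1 ≤ (h n).c₁ * √(1 + (h n).α / (h n).γ) ∧
        (h n).c₁ * √(1 + (h n).α / (h n).γ) ≤ p n ∧
        ((h n).α + 1) * (4 * din n + 6) + t ≤ (h n).c₂) →
      -- sparsity of the minimal I-map with ordering σ
      (∀ᶠ n in atTop,
        (4 * νhi n ^ 2 * (νlo n ^ 4)⁻¹ * (νhi n - νlo n) ^ 2 + 1) *
          SparseDAG.maxDegIMap (S n) (σ n) ≤ din n) →
      -- beta-min condition
      (∀ᶠ n in atTop, ∀ i j, SparseDAG.cholWeights (S n) (σ n) i j ≠ 0 →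
        5 * (Cβ + 4 * (h n).c₂) * (νhi n ^ 2 * Real.log (p n) / ((h n).α * νlo n ^ 2 * n)) ≤
          |SparseDAG.cholWeights (S n) (σ n) i j| ^ 2) →
      -- out-degree bound
      (∀ᶠ n in atTop, min (SparseDAG.maxDegAllIMaps (S n) * din n + 1) (p n) ≤ dout n) →
      ∀ᶠ n in atTop,
        1 - 3 / (p n : ℝ) ≤ (SparseDAG.dataLaw n (S n)).real
          {x | ∀ N ∈ ({SparseDAG.adsNbhd, SparseDAG.adsNbhdOrdered (σ n)} :
                Set (SparseDAG.EdgeSet (p n) → Finset (SparseDAG.EdgeSet (p n)))),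
              (SparseDAG.samplerMixingTime (h n) (SparseDAG.dataMatrix x) (σ n)
                (din n) (dout n) N : ℝ≥0∞) ≤
              ENNReal.ofReal (C * (din n : ℝ) ^ 2 * (p n : ℝ) ^ 3 *
                Real.log (4 / SparseDAG.posteriorMin (h n) (SparseDAG.dataMatrix x) (σ n)
                  (din n) (dout n)))} := by
  refine ⟨15, by norm_num, ?_⟩
  intro p din dout S hS σ h νlo νhi δ₀ t Cβ hp hdeg hh hδ0 hδ1 ht hCβ hν hgrowth hprior hsparse hbeta
    hout
  -- The isometry constant is `4 * η`. Being at most `δ₀`, it fits into the margin of the eigenvalue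
  -- condition; being at most 1/2, it keeps half of the noise variance.
  set η := min δ₀ (1 / 2) / 4 with hη
  have hm0 : 0 < min δ₀ (1 / 2) := lt_min hδ0 (by norm_num)
  have hη0 : 0 < η := by positivity
  have hη4 : 4 * η = min δ₀ (1 / 2) := by rw [hη]; ring
  have hηδ : 4 * η ≤ δ₀ := hη4 ▸ min_le_left _ _
  have hηh : 4 * η ≤ 1 / 2 := hη4 ▸ min_le_right _ _
  -- The only use of the strict inequality `t > 3` in the limit: `24 * din * p ^ 2 ≤ 24 * p ^ 3 ≤ p
  -- ^ t` eventually.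
  have hpow : ∀ᶠ n in atTop, (24 : ℝ) ≤ (p n : ℝ) ^ (t - 3) :=
    ((tendsto_rpow_atTop (by linarith : 0 < t - 3)).comp
      (tendsto_natCast_atTop_atTop.comp hp)).eventually_ge_atTop 24
  -- The growth constant `η ^ 2 / 128` is the tail exponent `η ^ 2 / 16` divided by the 8 of
  -- `isometry_union_bound_le`.
  filter_upwards [hdeg, hh, hν, hprior, hsparse, hbeta, hout, hpow, hp.eventually_ge_atTop 25,
    eventually_gt_atTop 0, hgrowth.bound (show 0 < η ^ 2 / 128 by positivity)] with n hdeg hh hν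
    hprior hsparse hbeta hout hpow hp25 hn hgrowth
  obtain ⟨hdin, hdinp, -, -⟩ := hdeg
  obtain ⟨-, -, hα, hα1, -, hκ⟩ := hh
  obtain ⟨hνlo, hνhi, heig⟩ := hν
  obtain ⟨hκn, hc, hcp, hc₂⟩ := hprior
  obtain ⟨ω, hω⟩ := cholWeights_spec (hS n) (σ n)
  have hq := quadForm_bounds (hS n).isHermitian heig
  have hp1 : (25 : ℝ) ≤ p n := by exact_mod_cast hp25
  have hp0 : (0 : ℝ) < p n := by linarith
  have hlog : 0 ≤ Real.log (p n) := Real.log_nonneg (by linarith)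
  have hlo : νlo n ≤ (1 - 4 * η) * (νlo n / (1 - δ₀) ^ 2) := by
    have h1 : 0 < 1 - δ₀ := by linarith
    have h2 : (1 - δ₀) ^ 2 ≤ 1 - 4 * η := by nlinarith
    rw [mul_div_assoc', le_div_iff₀ (by positivity), mul_comm]
    gcongr
  have hhi : (1 + 4 * η) * (νhi n / (1 + δ₀) ^ 2) ≤ νhi n := by
    have h2 : 1 + 4 * η ≤ (1 + δ₀) ^ 2 := by nlinarith
    rw [mul_div_assoc', div_le_iff₀ (by positivity), mul_comm (νhi n)]
    gcongr
  have hb : νhi n / (1 + δ₀) ^ 2 ≤ νhi n := div_le_self hνhi.le (by nlinarith)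
  have hνle : νlo n ≤ νhi n := by
    have h1 := heig ⟨0, by omega⟩
    have h2 : νlo n ≤ νlo n / (1 - δ₀) ^ 2 :=
      le_div_self hνlo.le (pow_pos (by linarith) 2) (by nlinarith)
    linarith [h1.1, h1.2]
  have hωνhi : ∀ j, ω j ≤ νhi n := fun j => by
    have h1 := hω.le_quadForm (hS n) (j := j) (v := Pi.single j 1) (by simp) (fun i hi => by
      have : i ≠ j := by rintro rfl; exact lt_irrefl _ hi
      simp [this])
    have h2 := (hq (Pi.single j 1)).2
    have h3 : ∑ i, (Pi.single j (1 : ℝ) : Fin (p n) → ℝ) i ^ 2 = 1 := by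
      simp [Pi.single_apply, ite_pow]
    rw [h3, mul_one] at h2
    linarith
  have hpt : 24 * din n * (p n : ℝ) ^ 2 ≤ (p n : ℝ) ^ t := by
    have h1 : (p n : ℝ) ^ t = (p n : ℝ) ^ (t - 3) * (p n : ℝ) ^ 3 := by
      rw [← Real.rpow_natCast, ← Real.rpow_add hp0]; congr 1; push_cast; ring
    have h2 : (din n : ℝ) ≤ p n := by exact_mod_cast hdinp
    calc 24 * din n * (p n : ℝ) ^ 2 ≤ 24 * p n * (p n : ℝ) ^ 2 := by gcongr
      _ = 24 * (p n : ℝ) ^ 3 := by ring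
      _ ≤ _ := by rw [h1]; gcongr
  refine one_sub_le_measureReal (dataLaw n (S n))
    (a := {x | ¬ RestrictedIsometry (dataMatrix x) (S n) (2 * din n) (4 * η)})
    (b := {x | ¬ SmallNoise (dataMatrix x) (σ n) (cholWeights (S n) (σ n)) ω
      ((4 * din n + 6) * Real.log (p n)) (din n)}) (fun x hx1 hx2 N hN => ?_) ?_
  · have hx1 := not_not.1 hx1
    have hx2 := not_not.1 hx2
    refine (samplerMixingTime_le_of_nodeRegular (hS n) (fun j =>
      nodeRegular_of_restrictedIsometry (hS n) hω hn hdin hx1 hx2 (by positivity) hηh hq hνlo hlo hhi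
        j fun i => mem_parents_minimalIMap) hn (by omega) hdin hνlo hνle hω.2.1 hωνhi hα hα1 hκ hκn
      hc hcp ht hCβ hc₂ hsparse hbeta hout hpt hN).trans ?_
    set l := Real.log (4 / posteriorMin (h n) (dataMatrix x) (σ n) (din n) (dout n))
    -- For `l ≤ 0` the bound already obtained is 0, so the sign of the logarithm needs no proof.
    -- Otherwise `15 * din * p ^ 2` is weakened to the stated form.
    rcases le_total l 0 with hl | hl
    · rw [ENNReal.ofReal_of_nonpos (mul_nonpos_of_nonneg_of_nonpos (by positivity) hl)]
      exact zero_le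
    · refine ENNReal.ofReal_le_ofReal ?_
      have h1 : (1 : ℝ) ≤ din n := by exact_mod_cast hdin
      gcongr
      · exact le_self_pow₀ h1 two_ne_zero
      · linarith
      · norm_num
  · have h1 := (measure_not_restrictedIsometry_le (n := n) (hS n) (2 * din n) hη0
      (by linarith)).trans (isometry_union_bound_le hp25 hdin (by
        rw [Real.norm_of_nonneg (by positivity), Real.norm_of_nonneg (by positivity)] at hgrowth
        linarith))
    have h2 := (hω.measure_not_smallNoise_le (n := n) (hS n) (din n)
      (u := (4 * din n + 6) * Real.log (p n)) (by positivity)).trans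
      (noise_union_bound_le (by omega) hdin)
    have h3 : 1 / (p n : ℝ) + 1 / p n ≤ 3 / p n := by
      rw [← add_div]; gcongr; norm_num
    linarith
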